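/- **Setting.** An *$L$-distribution* is a Borel probability measure $\mathsf a$ on $(-\infty,+\infty]$ that is symmetric, $\mathsf a(-dy)=e^{-y}\,\mathsf a(dy)$ (the law of the log-likelihood ratio of a binary-input memoryless output-symmetric channel given that $X=+1$ is sent). $\Delta_{+\infty}$ is the point mass at $+\infty$. $\mathsf a\circledast\mathsf b$ is the law of $Y_1+Y_2$ and $\mathsf a\boxast\mathsf b$ the law of $2\tanh^{-1}(\tanh(Y_1/2)\tanh(Y_2/2))$ for independent $Y_1\sim\mathsf a$, $Y_2\sim\mathsf b$; $\mathsf a^{\circledast n},\mathsf a^{\boxast n}$ are the corresponding powers. $\mathrm H(\mathsf a)=\int\log_2(1+e^{-y})\,\mathsf a(dy)$. The distance is the Wasserstein distance $d(\mathsf a,\mathsf b)=\sup_f|\int f\,d|\mathsf a|-\int f\,d|\mathsf b||$ over all $1$-Lipschitz $f:[0,1]\to\mathbb R$, where $|\mathsf a|$ is the law of $|\tanh(Y/2)|$, $Y\sim\mathsf a$. $\mathsf a\prec\mathsf b$ means that the channel $\mathsf b$ is degraded with respect to the channel $\mathsf a$ (obtained from it by processing its output with a further channel). A family $\{\mathsf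 a_\sigma\}$, $\sigma\in[\underline\sigma,\overline\sigma]$, is *ordered by degradation and increasing* if $\sigma\le\sigma'$ implies $\mathsf a_\sigma\prec\mathsf a_{\sigma'}$; it is *piecewise linear* if $[\underline\sigma,\overline\sigma]$ is divided by finitely many nodes, between consecutive ones of which $\mathsf a_\sigma$ is the linear interpolation of its values at the two nodes. Fix integers $3\le l\le r$, $w\ge1$, $L\ge0$. For $(\mathsf x_i)_{i\in\mathbb Z}$ put $$\mathsf y_i=\frac1w\sum_{j=0}^{w-1}\Bigl(\frac1w\sum_{k=0}^{w-1}\mathsf x_{i+j-k}\Bigr)^{\boxast (r-1)},\qquad g(\mathsf x_{i-w+1},\dots,\mathsf x_{i+w-1})=\mathsf y_i^{\circledast(l-1)},\qquad \hat g(\mathsf x_{i-w+1},\dots,\mathsf x_{i+w-1})=\mathsf y_i^{\circledast l}.$$ The GEXIT integral of two families is $G(\{\mathsf c_\sigma,\mathsf z_\sigma\}_{\underline\sigma}^{\overline\sigma})=\int_{\underline\sigma}^{\overline\sigma}\mathrm H\bigl(\tfrac{d\mathsf c_\sigma}{d\sigma}\circledast\mathsf z_\sigma\bigr)\,d\sigma$,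 where $\mathrm H(\frac{d\mathsf c_\sigma}{d\sigma}\circledast\mathsf z_\sigma)$ is the derivative of $s\mapsto\mathrm H(\mathsf c_s\circledast\mathsf z_\sigma)$ at $s=\sigma$ ($\mathsf z_\sigma$ being held fixed). **Theorem (Area theorem for approximate fixed-point families).** Let $\delta\ge0$, $\underline\sigma\le\overline\sigma$, and let $\{\mathsf c_\sigma\}$ and $\{\mathsf x_{\sigma,i}\}$, $i\in\mathbb Z$, be families of $L$-distributions indexed by $\sigma\in[\underline\sigma,\overline\sigma]$ such that 1. $\{\mathsf c_\sigma\}$ and, for every $i$, $\{\mathsf x_{\sigma,i}\}$ are ordered by degradation, increasing, and piecewise linear; 2. $\mathsf x_{\sigma,i}=\Delta_{+\infty}$ for all $i\notin[-L,L]$ and all $\sigma$; 3. $\mathsf x_{\underline\sigma,i}=\mathsf x_{\underline\sigma}$ for all $i\in[-L,L]$, with $\mathsf x_{\underline\sigma}$ independent of $i$; 4. $\mathsf x_{\overline\sigma,i}=\mathsf x_{\overline\sigma}$ for all $i\in[-L,L]$, with $\mathsf x_{\overline\sigma}$ independent of $i$; 5. for all integers $i\in[-L+w-1,-w+1]\cup[w-1,L-w+1]$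 and all $\sigma\in[\underline\sigma,\overline\sigma]$, $$d\bigl(\mathsf x_{\sigma,i},\ \mathsf c_\sigma\circledast g(\mathsf x_{\sigma,i-w+1},\dots,\mathsf x_{\sigma,i+w-1})\bigr)\le\delta .$$ Define $$A(\{\mathsf c_\sigma,\underline{\mathsf x}_\sigma\})=\sum_{i=-L}^{L}G\bigl(\{\mathsf c_\sigma,\hat g(\mathsf x_{\sigma,i-w+1},\dots,\mathsf x_{\sigma,i+w-1})\}_{\underline\sigma}^{\overline\sigma}\bigr),$$ $$A(\mathsf x)=\mathrm H(\mathsf x)+\Bigl(l-1-\frac lr\Bigr)\mathrm H(\mathsf x^{\boxast r})-(l-1)\,\mathrm H(\mathsf x^{\boxast(r-1)}).$$ Then $A(\{\mathsf c_\sigma,\underline{\mathsf x}_\sigma\})$ is well defined (for each $i\in[-L,L]$ the entropies involved are finite, the derivative in the integrand exists at all but finitely many $\sigma\in(\underline\sigma,\overline\sigma)$, and the integrand is integrable), and $$\left|\frac{A(\{\mathsf c_\sigma,\underline{\mathsf x}_\sigma\})}{2L+1}-A(\mathsf x_{\overline\sigma})+A(\mathsf x_{\underline\sigma})\right|\le\frac{11\,w\,(1+lr)}{2L+1}+4\Bigl(\sqrt2+\frac{2}{\ln2}\,l(r-1)\Bigr)\sqrt\delta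 .$$ -/

import Mathlib

open MeasureTheory ProbabilityTheory Set
open scoped ENNReal NNReal

namespace CoupledDE

noncomputable section

/-! ### Symmetric `L`-distributions

An `L`-distribution is the law, given `X = +1`, of the log-likelihood ratio
`ln (p (Y | 1) / p (Y | -1))` of a binary-input channel.  It is a probability measure on
the extended reals; the atom at `⊤` is the part that carries perfect information. -/

/-- `a` is the `L`-distribution of a binary-input memoryless output-symmetric channel: a
probability measure with `a (-dy) = e ^ (-y) a (dy)` on `(-∞, +∞]`.  For the set `{⊤}` the
symmetry condition says that there is no mass at `-∞`. -/
structure IsLDistribution (a : Measure EReal) : Prop where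
  isProbabilityMeasure : IsProbabilityMeasure a
  symmetric : ∀ s : Set EReal, MeasurableSet s → ⊥ ∉ s →
    a ((fun y => -y) ⁻¹' s) = ∫⁻ y in s, EReal.exp (-y) ∂a

/-- The perfect-decoding distribution `Δ_{+∞}`. -/
def deltaTop : Measure EReal := Measure.dirac ⊤

/-- The conditional mean `tanh (y / 2)` of the bit `X = ±1` given the log-likelihood ratio `y`
(the `D`-domain value of `y`). -/
def softBit (y : EReal) : ℝ :=
  EReal.rec (-1) (fun t : ℝ => Real.tanh (t / 2)) 1 y

/-- The inverse of `softBit` on `[-1, 1]`: the log-likelihood ratio `ln ((1 + d) / (1 - d))`. -/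
def ofSoftBit (d : ℝ) : EReal :=
  if d ≤ -1 then ⊥ else if 1 ≤ d then ⊤ else ((Real.log ((1 + d) / (1 - d)) : ℝ) : EReal)

/-- Variable-node convolution `a ⊛ b`: the law of the sum of two independent log-likelihood
ratios. -/
def varConv (a b : Measure EReal) : Measure EReal := Measure.conv a b

/-- Check-node convolution `a ⊠ b`: the law of `2 artanh (tanh (Y₁ / 2) tanh (Y₂ / 2))` for
independent `Y₁ ∼ a`, `Y₂ ∼ b`. -/
def checkConv (a b : Measure EReal) : Measure EReal :=
  (a.prod b).map (fun p => ofSoftBit (softBit p.1 * softBit p.2))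

/-- The variable-node power `a ^ {⊛ n}`; the unit is the point mass at `0`. -/
def varPow (a : Measure EReal) : ℕ → Measure EReal
  | 0 => Measure.dirac 0
  | n + 1 => varConv (varPow a n) a

/-- The check-node power `a ^ {⊠ n}`; the unit is the point mass at `+∞`. -/
def checkPow (a : Measure EReal) : ℕ → Measure EReal
  | 0 => deltaTop
  | n + 1 => checkConv (checkPow a n) a

/-- The uniform mixture `(1 / w) ∑_{k < w} a k`. -/
def average (w : ℕ) (a : ℕ → Measure EReal) : Measure EReal :=
  (w : ℝ≥0∞)⁻¹ • ∑ k ∈ Finset.range w, a k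

/-! ### Entropy, Wasserstein distance, degradation -/

/-- The kernel `log₂ (1 + e ^ (-y))`; at `⊤` it is `0`, and the value at `⊥` is irrelevant since
`L`-distributions have no mass there. -/
def entropyKernel (y : EReal) : ℝ :=
  EReal.rec 0 (fun t : ℝ => Real.logb 2 (1 + Real.exp (-t))) 0 y

/-- The entropy functional `H (a) = ∫ log₂ (1 + e ^ (-y)) a (dy)`. -/
def entropy (a : Measure EReal) : ℝ := ∫ y, entropyKernel y ∂a

/-- The `|D|`-distribution on `[0, 1]`: the law of `|tanh (Y / 2)|`. -/
def absD (a : Measure EReal) : Measure ℝ := a.map (fun y => |softBit y|)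

/-- The Wasserstein distance of two `L`-distributions, measured in the `|D|`-domain. -/
def wasserstein (a b : Measure EReal) : ℝ :=
  sSup {t : ℝ | ∃ f : ℝ → ℝ, LipschitzOnWith 1 f (Icc 0 1) ∧
    t = |(∫ u in Icc (0 : ℝ) 1, f u ∂(absD a)) - ∫ u in Icc (0 : ℝ) 1, f u ∂(absD b)|}

/-- `a ≺ b`: the channel with `L`-distribution `b` is degraded with respect to the channel with
`L`-distribution `a`, i.e. it arises from it by post-processing the output with a channel `κ`.
Given `X = +1` and `X = -1`, the output of the channel `a` has law `a`, respectively the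
reflection of `a`. -/
def Degraded (a b : Measure EReal) : Prop :=
  ∃ κ : Kernel EReal EReal, IsMarkovKernel κ ∧ a.bind κ = b ∧
    (a.map (fun y => -y)).bind κ = b.map (fun y => -y)

/-! ### Families indexed by a real parameter in `[s₀, s₁]` -/

/-- The family is ordered by degradation and increasing on `[s₀, s₁]`. -/
def OrderedFamily (a : ℝ → Measure EReal) (s₀ s₁ : ℝ) : Prop :=
  ∀ s ∈ Icc s₀ s₁, ∀ t ∈ Icc s₀ s₁, s ≤ t → Degraded (a s) (a t)

/-- The family is piecewise linear on `[s₀, s₁]`: there are finitely many nodes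
`s₀ = t 0 ≤ t 1 ≤ ⋯ ≤ t n = s₁`, and between consecutive nodes the family is the linear
interpolation of its members at these two nodes. -/
def PiecewiseLinearFamily (a : ℝ → Measure EReal) (s₀ s₁ : ℝ) : Prop :=
  ∃ (n : ℕ) (t : ℕ → ℝ), Monotone t ∧ t 0 = s₀ ∧ t n = s₁ ∧
    ∀ k < n, ∀ u ∈ Icc (0 : ℝ) 1,
      a ((1 - u) * t k + u * t (k + 1)) =
        ENNReal.ofReal (1 - u) • a (t k) + ENNReal.ofReal u • a (t (k + 1))

/-! ### Density evolution of the `(l, r, L, w)` ensemble -/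

/-- The average over the `w` check positions `i, …, i + w - 1` of the density that a check node
sends to a variable node at position `i`:
`(1 / w) ∑_{j < w} ((1 / w) ∑_{k < w} x (i + j - k)) ^ {⊠ (r - 1)}`. -/
def checkMessage (r w : ℕ) (x : ℤ → Measure EReal) (i : ℤ) : Measure EReal :=
  average w fun j => checkPow (average w fun k => x (i + (j : ℤ) - (k : ℤ))) (r - 1)

/-- `g (x_{i-w+1}, …, x_{i+w-1})`. -/
def g (l r w : ℕ) (x : ℤ → Measure EReal) (i : ℤ) : Measure EReal :=
  varPow (checkMessage r w x i) (l - 1)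

/-- `ĝ (x_{i-w+1}, …, x_{i+w-1})`. -/
def gHat (l r w : ℕ) (x : ℤ → Measure EReal) (i : ℤ) : Measure EReal :=
  varPow (checkMessage r w x i) l

/-! ### GEXIT integrals -/

/-- The GEXIT integrand `H (dc_σ/dσ ⊛ z_σ)`, that is the derivative of `s ↦ H (c_s ⊛ z_σ)` at
`s = σ`, with `z_σ` held fixed. -/
def gexit (c z : ℝ → Measure EReal) (σ : ℝ) : ℝ :=
  deriv (fun s => entropy (varConv (c s) (z σ))) σ

/-- The GEXIT integral `∫ H (dc_σ/dσ ⊛ z_σ) dσ` over `[s₀, s₁]`. -/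
def gexitIntegral (c z : ℝ → Measure EReal) (s₀ s₁ : ℝ) : ℝ :=
  ∫ σ in s₀..s₁, gexit c z σ

/-- The GEXIT integral over `[s₀, s₁]` is well defined: all entropies involved are finite, the
derivative in the integrand exists at all but finitely many interior points, and the integrand is
integrable. -/
def GexitIntegralExists (c z : ℝ → Measure EReal) (s₀ s₁ : ℝ) : Prop :=
  (∀ s ∈ Icc s₀ s₁, ∀ σ ∈ Icc s₀ s₁, Integrable entropyKernel (varConv (c s) (z σ))) ∧
  (∃ E : Set ℝ, E.Finite ∧ ∀ σ ∈ Ioo s₀ s₁ \ E,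
    DifferentiableAt ℝ (fun s => entropy (varConv (c s) (z σ))) σ) ∧
  IntervalIntegrable (gexit c z) volume s₀ s₁

/-- The total GEXIT integral of a family `{c_σ, x_σ}` of constellations: the sum over the
positions `i ∈ [-L, L]` of the GEXIT integrals of `c_σ` and `ĝ (x_{σ,i-w+1}, …, x_{σ,i+w-1})`. -/
def totalGexitIntegral (l r L w : ℕ) (c : ℝ → Measure EReal) (x : ℝ → ℤ → Measure EReal)
    (s₀ s₁ : ℝ) : ℝ :=
  ∑ i ∈ Finset.Icc (-(L : ℤ)) L, gexitIntegral c (fun σ => gHat l r w (x σ) i) s₀ s₁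

/-- `A (x) = H (x) + (l - 1 - l / r) H (x ^ {⊠ r}) - (l - 1) H (x ^ {⊠ (r - 1)})`. -/
def areaFunctional (l r : ℕ) (x : Measure EReal) : ℝ :=
  entropy x + ((l : ℝ) - 1 - (l : ℝ) / r) * entropy (checkPow x r)
    - ((l : ℝ) - 1) * entropy (checkPow x (r - 1))

end

end CoupledDE

/-! The proof runs through the even moments m_n(a) = E[tanh(Y/2)^(2n+2)]. For a symmetric law the
entropy is the series H(a) = Σ c_n (1 - m_n(a)) with c_n = 1 / ((2n+2)(2n+1) ln 2) and Σ c_n = 1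
(`SymmetricLaw.hasSum_entropy`). Check convolution multiplies these moments, and the duality H(a ⊛
b) = H(a) + H(b) - H(a ⊠ b) then gives H(a ⊛ b) = Σ c_n (1 - m_n(a)) (1 - m_n(b))
(`SymmetricLaw.hasSum_entropy_varConv`). Degradation decreases every m_n (`Degraded.softMoment_le`),
and Wasserstein distance δ changes m_n by at most min(1, (2n+2)δ), whose c_n-weighted sum K is O(√δ)
(`tsum_entropyCoeff_mul_momentGap_le`).

The potential is the Bethe functional `bethe` of the whole chain. Write y_i for the message arriving
at position i and X_m for the density entering the checks at m. Along the family its derivative is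
the total GEXIT integrand plus l times a sum of defects, each the difference of the derivatives of
H((c ⊛ g_i) ⊛ y_i) and H(x_i ⊛ y_i) in y_i alone (`hasDerivAt_bethe`). The derivatives in x_i
cancel: the variable-side sum of the H(x_i ⊛ y_i) can be regrouped over check positions
(`sum_entropy_exchange`), where it meets the derivative of the check terms.

A defect is a series in (m_n(x_i) - m_n(c ⊛ g_i)) times the derivative of m_n(y_i). Since the
m_n(y_i) are monotone in σ, it is dominated by minus the derivative of a fixed weighted moment of
y_i (`abs_deriv_entropy_sub_le`). Integration therefore telescopes: the accumulated defect at a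
position is at most K where the fixed-point bound holds and at most 1 elsewhere, independently of
the number of linear pieces (`bethe_increment`).

At the two ends the constellation is flat, and there the Bethe functional is (2L+1) A(x) up to
boundary terms and the fixed-point error (`abs_bethe_sub_le`). Piecewise linearity supplies the
regularity: between nodes all the laws are mixtures with polynomial weights, so every entropy is a
polynomial in the parameter and the calculus is exact. -/

namespace CoupledDE

/-! ### Soft bits -/

@[simp] lemma softBit_top : softBit ⊤ = 1 := rfl
@[simp] lemma softBit_bot : softBit ⊥ = -1 := rfl
@[simp] lemma softBit_coe (t : ℝ) : softBit (t : EReal) = Real.tanh (t / 2) := rfl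

lemma abs_tanh_lt_one (t : ℝ) : |Real.tanh t| < 1 := by
  rw [Real.tanh_eq_sinh_div_cosh, abs_div, abs_of_pos (Real.cosh_pos t),
    div_lt_one (Real.cosh_pos t), abs_lt]
  constructor
  · have := Real.exp_pos t
    rw [Real.sinh_eq, Real.cosh_eq]; linarith
  · exact Real.sinh_lt_cosh t

lemma abs_softBit_le_one (y : EReal) : |softBit y| ≤ 1 := by
  induction y with
  | bot => simp
  | top => simp
  | coe t => exact (abs_tanh_lt_one _).le

lemma softBit_le_one (y : EReal) : softBit y ≤ 1 := (abs_le.1 (abs_softBit_le_one y)).2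
lemma neg_one_le_softBit (y : EReal) : -1 ≤ softBit y := (abs_le.1 (abs_softBit_le_one y)).1

@[simp] lemma softBit_neg (y : EReal) : softBit (-y) = -softBit y := by
  induction y with
  | bot => simp
  | top => simp
  | coe t => rw [← EReal.coe_neg, softBit_coe, softBit_coe, neg_div, Real.tanh_neg]

@[fun_prop] lemma measurable_softBit : Measurable softBit :=
  EReal.measurable_of_measurable_real (by
    have : Continuous fun t : ℝ => Real.tanh (t / 2) := by
      simp only [Real.tanh_eq_sinh_div_cosh]
      exact Continuous.div (by fun_prop) (by fun_prop) fun t => (Real.cosh_pos _).ne'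
    exact this.measurable)

@[fun_prop] lemma measurable_ofSoftBit : Measurable ofSoftBit := by
  unfold ofSoftBit
  refine Measurable.ite measurableSet_Iic measurable_const
    (Measurable.ite measurableSet_Ici measurable_const ?_)
  fun_prop

@[fun_prop] lemma measurable_entropyKernel : Measurable entropyKernel :=
  EReal.measurable_of_measurable_real (by
    have : Measurable fun t : ℝ => Real.logb 2 (1 + Real.exp (-t)) := by
      unfold Real.logb; fun_prop
    exact this)

lemma one_add_tanh_half (t : ℝ) : 1 + Real.tanh (t / 2) = 2 / (1 + Real.exp (-t)) := by
  have h : Real.exp (-t) = Real.exp (-(t / 2)) * Real.exp (-(t / 2)) := by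
    rw [← Real.exp_add]; ring_nf
  have h2 : Real.exp (t / 2) * Real.exp (-(t / 2)) = 1 := by
    rw [← Real.exp_add]; simp
  have p1 := Real.exp_pos (t / 2)
  have p2 := Real.exp_pos (-(t / 2))
  rw [Real.tanh_eq_sinh_div_cosh, Real.sinh_eq, Real.cosh_eq, h]
  generalize Real.exp (t / 2) = A at *
  generalize Real.exp (-(t / 2)) = B at *
  have : 0 < 1 + B * B := by positivity
  field_simp
  linear_combination (2 * B) * h2

/-- This turns the density `e ^ (-y)` of the symmetry condition into the ratio of the bounded
weights 1 - d and 1 + d, where d is the soft bit. -/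
lemma one_sub_tanh_half (t : ℝ) :
    1 - Real.tanh (t / 2) = Real.exp (-t) * (1 + Real.tanh (t / 2)) := by
  have h := one_add_tanh_half t
  have p := Real.exp_pos (-t)
  have : 1 - Real.tanh (t / 2) = 2 - (1 + Real.tanh (t / 2)) := by ring
  rw [this, h]; field_simp; ring

lemma one_add_tanh_half_pos (t : ℝ) : 0 < 1 + Real.tanh (t / 2) := by
  have := (abs_lt.1 (abs_tanh_lt_one (t / 2))).1; linarith

lemma ofSoftBit_of_mem_Ioo {d : ℝ} (h : d ∈ Ioo (-1 : ℝ) 1) :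
    ofSoftBit d = ((Real.log ((1 + d) / (1 - d)) : ℝ) : EReal) := by
  rw [ofSoftBit, if_neg (not_le.2 h.1), if_neg (not_le.2 h.2)]

@[simp] lemma ofSoftBit_one : ofSoftBit 1 = ⊤ := by norm_num [ofSoftBit]
@[simp] lemma ofSoftBit_neg_one : ofSoftBit (-1) = ⊥ := by norm_num [ofSoftBit]

lemma softBit_ofSoftBit {d : ℝ} (h : |d| ≤ 1) : softBit (ofSoftBit d) = d := by
  obtain ⟨h1, h2⟩ := abs_le.1 h
  rcases h1.eq_or_lt with rfl | h1
  · simp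
  rcases h2.eq_or_lt with rfl | h2
  · simp
  rw [ofSoftBit_of_mem_Ioo ⟨h1, h2⟩, softBit_coe]
  have a1 : 0 < 1 + d := by linarith
  have a2 : 0 < 1 - d := by linarith
  have := one_add_tanh_half (Real.log ((1 + d) / (1 - d)))
  rw [Real.exp_neg, Real.exp_log (by positivity)] at this
  have e : 2 / (1 + ((1 + d) / (1 - d))⁻¹) = 1 + d := by
    field_simp
    ring
  linarith

lemma ofSoftBit_neg (d : ℝ) : ofSoftBit (-d) = -ofSoftBit d := by
  by_cases h1 : d ≤ -1
  · rw [ofSoftBit, ofSoftBit, if_neg (by linarith), if_pos (by linarith), if_pos h1]; simp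
  by_cases h2 : 1 ≤ d
  · rw [ofSoftBit, ofSoftBit, if_pos (by linarith), if_neg h1, if_pos h2]; simp
  push Not at h1 h2
  rw [ofSoftBit_of_mem_Ioo ⟨h1, h2⟩, ofSoftBit_of_mem_Ioo ⟨by linarith, by linarith⟩,
    ← EReal.coe_neg, ← Real.log_inv]
  congr 2
  rw [inv_div]; congr 1 ; ring

lemma abs_mul_softBit_le_one (y z : EReal) : |softBit y * softBit z| ≤ 1 := by
  rw [abs_mul]
  exact mul_le_one₀ (abs_softBit_le_one y) (abs_nonneg _) (abs_softBit_le_one z)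

lemma abs_softBit_pow_le_one (y : EReal) (n : ℕ) : |softBit y ^ n| ≤ 1 := by
  rw [abs_pow]; exact pow_le_one₀ (abs_nonneg _) (abs_softBit_le_one y)

/-- The check-node combination of two log-likelihood ratios. -/
noncomputable def boxPlus (y z : EReal) : EReal := ofSoftBit (softBit y * softBit z)

@[simp] lemma softBit_boxPlus (y z : EReal) : softBit (boxPlus y z) = softBit y * softBit z :=
  softBit_ofSoftBit (abs_mul_softBit_le_one y z)

lemma neg_boxPlus (y z : EReal) : -boxPlus y z = boxPlus (-y) z := by
  rw [boxPlus, boxPlus, ← ofSoftBit_neg, softBit_neg, neg_mul]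

lemma boxPlus_comm (y z : EReal) : boxPlus y z = boxPlus z y := by
  rw [boxPlus, boxPlus, mul_comm]

lemma boxPlus_assoc (x y z : EReal) : boxPlus (boxPlus x y) z = boxPlus x (boxPlus y z) := by
  simp only [boxPlus.eq_1 (boxPlus x y), boxPlus.eq_1 x (boxPlus y z), softBit_boxPlus, mul_assoc]

@[fun_prop] lemma measurable_boxPlus : Measurable fun p : EReal × EReal => boxPlus p.1 p.2 := by
  unfold boxPlus; fun_prop

lemma checkConv_eq (a b : Measure EReal) :
    checkConv a b = (a.prod b).map fun p => boxPlus p.1 p.2 := rfl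

lemma entropyKernel_nonneg (y : EReal) : 0 ≤ entropyKernel y := by
  induction y with
  | bot => exact le_rfl
  | top => exact le_rfl
  | coe t =>
    exact Real.logb_nonneg (by norm_num) (by have := Real.exp_pos (-t); linarith)

lemma entropyKernel_eq {y : EReal} (hy : y ≠ ⊥) :
    entropyKernel y = 1 - Real.logb 2 (1 + softBit y) := by
  induction y with
  | bot => exact absurd rfl hy
  | top =>
    show (0 : ℝ) = _
    rw [softBit_top, one_add_one_eq_two, Real.logb_self_eq_one (by norm_num), sub_self]
  | coe t =>
    show Real.logb 2 (1 + Real.exp (-t)) = _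
    have := Real.exp_pos (-t)
    rw [softBit_coe, one_add_tanh_half, Real.logb_div (by norm_num) (by positivity),
      Real.logb_self_eq_one (by norm_num)]
    ring

lemma one_add_softBit_pos {y : EReal} (hy : y ≠ ⊥) : 0 < 1 + softBit y := by
  induction y with
  | bot => exact absurd rfl hy
  | top => norm_num
  | coe t => exact one_add_tanh_half_pos t

lemma one_add_mul_softBit_pos {y z : EReal} (hy : y ≠ ⊥) (hz : z ≠ ⊥) :
    0 < 1 + softBit y * softBit z := by
  have h1 := one_add_softBit_pos hy
  have h2 := one_add_softBit_pos hz
  have h3 := softBit_le_one y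
  have h4 := softBit_le_one z
  rcases h4.eq_or_lt with h | h
  · rw [h]; linarith
  · nlinarith [mul_pos h1 h2, mul_nonneg (sub_nonneg.2 h3) (sub_nonneg.2 h4)]

lemma boxPlus_ne_bot {y z : EReal} (hy : y ≠ ⊥) (hz : z ≠ ⊥) : boxPlus y z ≠ ⊥ := by
  intro h
  have := softBit_boxPlus y z
  rw [h, softBit_bot] at this
  have := one_add_mul_softBit_pos hy hz
  linarith

lemma add_ne_bot' {y z : EReal} (hy : y ≠ ⊥) (hz : z ≠ ⊥) : y + z ≠ ⊥ := by
  simp [EReal.add_eq_bot_iff, hy, hz]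

/-- The addition law of tanh, cleared of denominators so that it also covers the value `⊤`. Taking
logarithms turns it into entropy duality; its companion with minus signs factors the symmetry weight
of a sum. -/
lemma one_add_softBit_add {y z : EReal} (hy : y ≠ ⊥) (hz : z ≠ ⊥) :
    (1 + softBit (y + z)) * (1 + softBit y * softBit z) =
      (1 + softBit y) * (1 + softBit z) := by
  induction y with
  | bot => exact absurd rfl hy
  | top => rw [EReal.top_add_of_ne_bot hz]; simp
  | coe s =>
    induction z with
    | bot => exact absurd rfl hz
    | top => rw [EReal.add_top_of_ne_bot hy]; simp; ring
    | coe t =>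
      rw [← EReal.coe_add]
      simp only [softBit_coe]
      have e1 := one_add_tanh_half s
      have e2 := one_add_tanh_half t
      have e3 := one_add_tanh_half (s + t)
      rw [neg_add, Real.exp_add] at e3
      have p1 := Real.exp_pos (-s)
      have p2 := Real.exp_pos (-t)
      rw [e3, e1, e2, show Real.tanh (s / 2) = 2 / (1 + Real.exp (-s)) - 1 by linarith,
        show Real.tanh (t / 2) = 2 / (1 + Real.exp (-t)) - 1 by linarith]
      have : 0 < 1 + Real.exp (-s) * Real.exp (-t) := by positivity
      field_simp
      ring

lemma one_sub_softBit_add {y z : EReal} (hy : y ≠ ⊥) (hz : z ≠ ⊥) :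
    (1 - softBit (y + z)) * (1 + softBit y * softBit z) =
      (1 - softBit y) * (1 - softBit z) := by
  linear_combination -one_add_softBit_add hy hz

/-- The duality between the two convolutions already holds pointwise, because the kernel is 1 -
log₂(1 + d) and the addition law is multiplicative in 1 + d. -/
lemma entropyKernel_add {y z : EReal} (hy : y ≠ ⊥) (hz : z ≠ ⊥) :
    entropyKernel (y + z) = entropyKernel y + entropyKernel z - entropyKernel (boxPlus y z) := by
  have h := one_add_mul_softBit_pos hy hz
  have h1 := one_add_softBit_pos hy
  have h2 := one_add_softBit_pos hz
  have h3 := one_add_softBit_pos (add_ne_bot' hy hz)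
  rw [entropyKernel_eq hy, entropyKernel_eq hz, entropyKernel_eq (add_ne_bot' hy hz),
    entropyKernel_eq (boxPlus_ne_bot hy hz), softBit_boxPlus]
  have := congrArg (Real.logb 2) (one_add_softBit_add hy hz)
  rw [Real.logb_mul h3.ne' h.ne', Real.logb_mul h1.ne' h2.ne'] at this
  linarith

/-! ### Symmetric laws -/

/-- A probability measure on the extended reals which is symmetric in the sense that its
`(1 - softBit)`-weighting is invariant under reflection. -/
structure SymmetricLaw (a : Measure EReal) : Prop where
  prob : IsProbabilityMeasure a
  symm : ∀ f : EReal → ℝ≥0∞, Measurable f →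
    ∫⁻ y, f (-y) * ENNReal.ofReal (1 - softBit y) ∂a =
      ∫⁻ y, f y * ENNReal.ofReal (1 - softBit y) ∂a

/-- Testing symmetry on the indicator of `⊤` gives 2 a{⊥} = 0, since the weight 1 - d is 2 at `⊥`
and 0 at `⊤`. -/
lemma SymmetricLaw.ae_ne_bot {a : Measure EReal} (ha : SymmetricLaw a) : ∀ᵐ y ∂a, y ≠ ⊥ := by
  have h := ha.symm (indicator {⊤} 1) (measurable_one.indicator (measurableSet_singleton _))
  have h1 : ∀ y : EReal, indicator {⊤} (1 : EReal → ℝ≥0∞) (-y) * ENNReal.ofReal (1 - softBit y) =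
      indicator {⊥} (fun _ => 2) y := by
    intro y
    by_cases hy : y = ⊥
    · subst hy; norm_num
    · have : -y ≠ ⊤ := by simpa using hy
      simp [hy]
  have h2 : ∀ y : EReal, indicator {⊤} (1 : EReal → ℝ≥0∞) y * ENNReal.ofReal (1 - softBit y) =
      0 := by
    intro y
    by_cases hy : y = ⊤
    · subst hy; simp
    · simp [hy]
  simp_rw [h1, h2, lintegral_indicator (measurableSet_singleton _)] at h
  simp at h
  rw [ae_iff]
  simpa using h

lemma IsLDistribution.symmetricLaw {a : Measure EReal} (ha : IsLDistribution a) :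
    SymmetricLaw a := by
  refine ⟨ha.isProbabilityMeasure, fun f hf => ?_⟩
  have hbot : a {⊥} = 0 := by
    have h := ha.symmetric {⊤} (measurableSet_singleton _) (by simp)
    have e : (fun y : EReal => -y) ⁻¹' {⊤} = {⊥} := by ext y; simp
    rw [e] at h
    rw [h]
    simp [Measure.restrict_singleton]
  have hne : ∀ᵐ y ∂a, y ≠ ⊥ := by rw [ae_iff]; simpa using hbot
  have hm : Measurable fun y : EReal => EReal.exp (-y) :=
    EReal.expHomeomorph.continuous.measurable.comp measurable_neg
  have hmeas : (a.map fun y => -y).restrict {⊥}ᶜ =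
      (a.withDensity fun y => EReal.exp (-y)).restrict {⊥}ᶜ := by
    ext s hs
    have hs' : MeasurableSet (s ∩ {⊥}ᶜ) := hs.inter (measurableSet_singleton _).compl
    rw [Measure.restrict_apply hs, Measure.restrict_apply hs, Measure.map_apply measurable_neg hs',
      withDensity_apply _ hs']
    exact ha.symmetric _ hs' (by simp)
  -- The factor 1 + d vanishes at `⊥`, the one point where the symmetry condition says nothing, and
  -- it absorbs the density: e^(-y) (1 + d) = 1 - d.
  let g : EReal → ℝ≥0∞ := fun z => f z * ENNReal.ofReal (1 + softBit z)
  have hg : Measurable g := by unfold g; fun_prop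
  have hg0 : ∀ μ : Measure EReal, ∫⁻ z in {⊥}ᶜ, g z ∂μ = ∫⁻ z, g z ∂μ := by
    intro μ
    rw [← lintegral_indicator (measurableSet_singleton _).compl]
    congr 1; ext z
    by_cases hz : z = ⊥
    · subst hz; simp [g]
    · simp [hz]
  have key : ∫⁻ z, g z ∂(a.map fun y => -y) =
      ∫⁻ z, g z ∂(a.withDensity fun y => EReal.exp (-y)) := by
    rw [← hg0 (a.map _), ← hg0 (a.withDensity _), hmeas]
  rw [lintegral_map hg measurable_neg, lintegral_withDensity_eq_lintegral_mul _ hm hg] at key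
  refine (Eq.trans ?_ key).trans ?_
  · simp [g, sub_eq_add_neg]
  · refine lintegral_congr_ae ?_
    filter_upwards [hne] with y hy
    induction y with
    | bot => exact absurd rfl hy
    | top => simp [g]
    | coe t =>
      simp only [Pi.mul_apply, g, softBit_coe]
      rw [← EReal.coe_neg, EReal.exp_coe, mul_left_comm, ← ENNReal.ofReal_mul (Real.exp_pos _).le,
        ← one_sub_tanh_half]

/-! ### Closure of symmetric laws under convolutions, mixtures and powers. -/

lemma symmetricLaw_deltaTop : SymmetricLaw deltaTop where
  prob := by unfold deltaTop; infer_instance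
  symm f hf := by
    unfold deltaTop
    rw [lintegral_dirac, lintegral_dirac]; simp

lemma symmetricLaw_dirac_zero : SymmetricLaw (Measure.dirac 0) where
  prob := inferInstance
  symm f hf := by
    rw [lintegral_dirac, lintegral_dirac]; simp

lemma isProbabilityMeasure_varConv (a b : Measure EReal) [IsProbabilityMeasure a]
    [IsProbabilityMeasure b] : IsProbabilityMeasure (varConv a b) := by
  unfold varConv; infer_instance

lemma isProbabilityMeasure_checkConv (a b : Measure EReal) [IsProbabilityMeasure a]
    [IsProbabilityMeasure b] : IsProbabilityMeasure (checkConv a b) := by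
  rw [checkConv_eq]
  exact Measure.isProbabilityMeasure_map measurable_boxPlus.aemeasurable

lemma lintegral_checkConv (a b : Measure EReal) [SFinite b] {f : EReal → ℝ≥0∞}
    (hf : Measurable f) :
    ∫⁻ x, f x ∂(checkConv a b) = ∫⁻ y, ∫⁻ z, f (boxPlus y z) ∂b ∂a := by
  rw [checkConv_eq, lintegral_map hf measurable_boxPlus, lintegral_prod]
  exact (hf.comp measurable_boxPlus).aemeasurable

lemma lintegral_varConv (a b : Measure EReal) [SFinite b] {f : EReal → ℝ≥0∞}
    (hf : Measurable f) :
    ∫⁻ x, f x ∂(varConv a b) = ∫⁻ y, ∫⁻ z, f (y + z) ∂b ∂a :=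
  Measure.lintegral_conv hf

/-- The weight splits as 1 - dd' = (1 + d')/2 · (1 - d) + (1 + d)/2 · (1 - d'). Negating either
argument of `boxPlus` negates the result, so the first summand is handled by the symmetry of `a`
with z frozen and the second by that of `b` with y frozen. -/
lemma SymmetricLaw.checkConv {a b : Measure EReal} (ha : SymmetricLaw a) (hb : SymmetricLaw b) :
    SymmetricLaw (checkConv a b) := by
  have := ha.prob
  have := hb.prob
  refine ⟨isProbabilityMeasure_checkConv a b, fun f hf => ?_⟩
  have split : ∀ F : EReal → EReal → ℝ≥0∞, Measurable (fun p : EReal × EReal => F p.1 p.2) →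
      ∫⁻ y, ∫⁻ z, F y z * ENNReal.ofReal (1 - softBit y * softBit z) ∂b ∂a =
      (∫⁻ z, ENNReal.ofReal ((1 + softBit z) / 2) *
          ∫⁻ y, F y z * ENNReal.ofReal (1 - softBit y) ∂a ∂b) +
        ∫⁻ y, ENNReal.ofReal ((1 + softBit y) / 2) *
          ∫⁻ z, F y z * ENNReal.ofReal (1 - softBit z) ∂b ∂a := by
    intro F hF
    have e : ∀ y z : EReal, F y z * ENNReal.ofReal (1 - softBit y * softBit z) =
        ENNReal.ofReal ((1 + softBit z) / 2) * (F y z * ENNReal.ofReal (1 - softBit y)) +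
        ENNReal.ofReal ((1 + softBit y) / 2) * (F y z * ENNReal.ofReal (1 - softBit z)) := by
      intro y z
      have h1 := neg_one_le_softBit y
      have h2 := neg_one_le_softBit z
      have h3 := softBit_le_one y
      have h4 := softBit_le_one z
      rw [mul_left_comm, mul_left_comm _ (F y z), ← mul_add, ← ENNReal.ofReal_mul (by linarith),
        ← ENNReal.ofReal_mul (by linarith), ← ENNReal.ofReal_add
          (mul_nonneg (by linarith) (by linarith)) (mul_nonneg (by linarith) (by linarith))]
      congr 2; ring
    simp_rw [e]
    have m1 : Measurable fun p : EReal × EReal =>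
        ENNReal.ofReal ((1 + softBit p.2) / 2) * (F p.1 p.2 * ENNReal.ofReal (1 - softBit p.1)) := by
      fun_prop
    have m2 : Measurable fun p : EReal × EReal =>
        ENNReal.ofReal ((1 + softBit p.1) / 2) * (F p.1 p.2 * ENNReal.ofReal (1 - softBit p.2)) := by
      fun_prop
    have : ∀ y, ∫⁻ z, (ENNReal.ofReal ((1 + softBit z) / 2) *
        (F y z * ENNReal.ofReal (1 - softBit y)) +
        ENNReal.ofReal ((1 + softBit y) / 2) * (F y z * ENNReal.ofReal (1 - softBit z))) ∂b =
      (∫⁻ z, ENNReal.ofReal ((1 + softBit z) / 2) *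
        (F y z * ENNReal.ofReal (1 - softBit y)) ∂b) +
      ∫⁻ z, ENNReal.ofReal ((1 + softBit y) / 2) * (F y z * ENNReal.ofReal (1 - softBit z)) ∂b :=
      fun y => lintegral_add_left (m1.comp measurable_prodMk_left) _
    simp_rw [this]
    rw [lintegral_add_left m1.lintegral_prod_right', lintegral_lintegral_swap m1.aemeasurable]
    congr 1
    · refine lintegral_congr fun z => ?_
      dsimp only
      refine lintegral_const_mul _ ?_
      exact (hF.comp measurable_prodMk_right).mul (by fun_prop)
    · refine lintegral_congr fun y => lintegral_const_mul _ ?_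
      exact (hF.comp measurable_prodMk_left).mul (by fun_prop)
  rw [lintegral_checkConv _ _ (by fun_prop), lintegral_checkConv _ _ (by fun_prop)]
  simp only [softBit_boxPlus]
  rw [split (fun y z => f (-boxPlus y z)) (by fun_prop), split (fun y z => f (boxPlus y z))
    (by fun_prop)]
  congr 1
  · refine lintegral_congr fun z => ?_
    rw [← ha.symm (fun y => f (boxPlus y z)) (hf.comp (measurable_boxPlus.comp
      measurable_prodMk_right))]
    simp_rw [neg_boxPlus]
  · refine lintegral_congr fun y => ?_
    rw [← hb.symm (fun z => f (boxPlus y z)) (hf.comp (measurable_boxPlus.comp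
      measurable_prodMk_left))]
    simp_rw [boxPlus_comm y, neg_boxPlus]

/-- The weight of a sum factors as (1 - d)(1 - d') / (1 + dd'). The denominator is unchanged when
both arguments are reflected, so reflecting z by the symmetry of `b` and then y by that of `a` gives
the claim. -/
lemma SymmetricLaw.varConv {a b : Measure EReal} (ha : SymmetricLaw a) (hb : SymmetricLaw b) :
    SymmetricLaw (varConv a b) := by
  have := ha.prob
  have := hb.prob
  refine ⟨isProbabilityMeasure_varConv a b, fun f hf => ?_⟩
  obtain ⟨v, v_def⟩ : ∃ v : EReal → EReal → ℝ≥0∞,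
      ∀ y z, v y z = (ENNReal.ofReal (1 + softBit y * softBit z))⁻¹ := ⟨_, fun _ _ => rfl⟩
  have hv : Measurable fun p : EReal × EReal => v p.1 p.2 := by simp_rw [v_def]; fun_prop
  have weight : ∀ G : EReal → EReal → ℝ≥0∞,
      ∫⁻ y, ∫⁻ z, G y z * ENNReal.ofReal (1 - softBit (y + z)) ∂b ∂a =
      ∫⁻ y, ∫⁻ z, (G y z * v y z * ENNReal.ofReal (1 - softBit y)) *
        ENNReal.ofReal (1 - softBit z) ∂b ∂a := by
    intro G
    refine lintegral_congr_ae ?_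
    filter_upwards [ha.ae_ne_bot] with y hy
    refine lintegral_congr_ae ?_
    filter_upwards [hb.ae_ne_bot] with z hz
    have hp := one_add_mul_softBit_pos hy hz
    have hz1 := softBit_le_one z
    have hy1 := softBit_le_one y
    rw [mul_assoc, mul_assoc]
    congr 1
    rw [v_def, ← ENNReal.ofReal_inv_of_pos hp, ← ENNReal.ofReal_mul (by linarith), ← ENNReal.ofReal_mul
      (by positivity), ← one_sub_softBit_add hy hz]
    congr 1; field_simp
  rw [lintegral_varConv _ _ (by fun_prop), lintegral_varConv _ _ (by fun_prop)]
  rw [weight (fun y z => f (-(y + z))), weight (fun y z => f (y + z))]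
  have s1 : ∀ y, ∫⁻ z, (f (-(y + z)) * v y z * ENNReal.ofReal (1 - softBit y)) *
        ENNReal.ofReal (1 - softBit z) ∂b =
      ∫⁻ z, (f (-(y + -z)) * v y (-z) * ENNReal.ofReal (1 - softBit y)) *
        ENNReal.ofReal (1 - softBit z) ∂b := by
    intro y
    have m1 : Measurable fun z => v y z := hv.comp (measurable_prodMk_left (x := y))
    have m2 : Measurable fun z => f (-(y + z)) :=
      hf.comp (measurable_neg.comp (measurable_const.add measurable_id))
    exact (hb.symm (fun z => f (-(y + z)) * v y z * ENNReal.ofReal (1 - softBit y))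
      ((m2.mul m1).mul_const _)).symm
  simp_rw [s1]
  have mm : Measurable fun p : EReal × EReal => f (-(p.1 + -p.2)) * v p.1 (-p.2) := by
    have : Measurable fun p : EReal × EReal => v p.1 (-p.2) :=
      hv.comp (measurable_fst.prodMk measurable_snd.neg)
    exact (hf.comp (measurable_neg.comp (measurable_fst.add measurable_snd.neg))).mul this
  have mm2 : Measurable fun p : EReal × EReal => f (p.1 + p.2) * v p.1 p.2 :=
    (hf.comp (measurable_fst.add measurable_snd)).mul hv
  have swap : ∀ G : EReal × EReal → ℝ≥0∞, Measurable G →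
      ∫⁻ y, ∫⁻ z, G (y, z) * ENNReal.ofReal (1 - softBit y) * ENNReal.ofReal (1 - softBit z) ∂b ∂a =
      ∫⁻ z, ∫⁻ y, G (y, z) * ENNReal.ofReal (1 - softBit y) * ENNReal.ofReal (1 - softBit z) ∂a ∂b :=
    fun G hG => lintegral_lintegral_swap (Measurable.aemeasurable (by
      unfold Function.uncurry; fun_prop))
  refine (swap _ mm).trans (Eq.trans ?_ (swap _ mm2).symm)
  refine lintegral_congr_ae ?_
  filter_upwards [hb.ae_ne_bot] with z hz
  have c1 : ∀ y, f (-(y + -z)) * v y (-z) * ENNReal.ofReal (1 - softBit y) *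
      ENNReal.ofReal (1 - softBit z) =
      (f (-(y + -z)) * v y (-z) * ENNReal.ofReal (1 - softBit z)) *
        ENNReal.ofReal (1 - softBit y) := fun y => mul_right_comm _ _ _
  have c2 : ∀ y, f (y + z) * v y z * ENNReal.ofReal (1 - softBit y) *
      ENNReal.ofReal (1 - softBit z) =
      (f (y + z) * v y z * ENNReal.ofReal (1 - softBit z)) *
        ENNReal.ofReal (1 - softBit y) := fun y => mul_right_comm _ _ _
  simp_rw [c1, c2]
  rw [← ha.symm (fun y => f (-(y + -z)) * v y (-z) * ENNReal.ofReal (1 - softBit z))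
    ((mm.comp measurable_prodMk_right).mul_const _)]
  refine lintegral_congr_ae ?_
  filter_upwards [ha.ae_ne_bot] with y hy
  congr 3
  · rw [EReal.neg_add (.inr (by simpa using hz)) (.inl (by simpa using hy)), neg_neg,
      sub_eq_add_neg, neg_neg]
  · simp [v_def]

lemma SymmetricLaw.add_smul {ι : Type*} {s : Finset ι} {p : ι → ℝ≥0∞} {a : ι → Measure EReal}
    (ha : ∀ i ∈ s, SymmetricLaw (a i)) (hp : ∑ i ∈ s, p i = 1) :
    SymmetricLaw (∑ i ∈ s, p i • a i) where
  prob := by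
    constructor
    rw [Measure.finsetSum_apply, ← hp]
    refine Finset.sum_congr rfl fun i hi => ?_
    have := (ha i hi).prob
    simp
  symm f hf := by
    simp_rw [lintegral_finsetSum_measure, lintegral_smul_measure]
    exact Finset.sum_congr rfl fun i hi => by rw [(ha i hi).symm f hf]

lemma average_eq (w : ℕ) (a : ℕ → Measure EReal) :
    average w a = ∑ k ∈ Finset.range w, (w : ℝ≥0∞)⁻¹ • a k := by
  rw [average, Finset.smul_sum]

lemma SymmetricLaw.average {w : ℕ} (hw : 1 ≤ w) {a : ℕ → Measure EReal}
    (ha : ∀ k < w, SymmetricLaw (a k)) : SymmetricLaw (average w a) := by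
  rw [average_eq]
  refine SymmetricLaw.add_smul (fun i hi => ha i (Finset.mem_range.1 hi)) ?_
  rw [Finset.sum_const, Finset.card_range, nsmul_eq_mul, ENNReal.mul_inv_cancel] <;> simp
  omega

lemma SymmetricLaw.varPow {a : Measure EReal} (ha : SymmetricLaw a) (n : ℕ) :
    SymmetricLaw (varPow a n) := by
  induction n with
  | zero => exact symmetricLaw_dirac_zero
  | succ n ih => exact ih.varConv ha

lemma SymmetricLaw.checkPow {a : Measure EReal} (ha : SymmetricLaw a) (n : ℕ) :
    SymmetricLaw (checkPow a n) := by
  induction n with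
  | zero => exact symmetricLaw_deltaTop
  | succ n ih => exact ih.checkConv ha

lemma SymmetricLaw.checkMessage {r w : ℕ} (hw : 1 ≤ w) {x : ℤ → Measure EReal}
    (hx : ∀ i, SymmetricLaw (x i)) (i : ℤ) : SymmetricLaw (checkMessage r w x i) :=
  .average hw fun _ _ => (SymmetricLaw.average hw fun _ _ => hx _).checkPow _

/-! ### The entropy as a series in the even moments of the soft bit -/

/-- The coefficients of the power series of the binary entropy function. -/
noncomputable def entropyCoeff (n : ℕ) : ℝ := 1 / ((2 * n + 2) * (2 * n + 1) * Real.log 2)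

/-- The entropy of a bit whose conditional mean is `d`. -/
noncomputable def bitEntropy (d : ℝ) : ℝ :=
  1 - ((1 + d) * Real.log (1 + d) + (1 - d) * Real.log (1 - d)) / (2 * Real.log 2)

lemma log_two_pos : 0 < Real.log 2 := Real.log_pos one_lt_two

lemma entropyCoeff_nonneg (n : ℕ) : 0 ≤ entropyCoeff n := by
  have := log_two_pos
  unfold entropyCoeff; positivity

lemma summable_entropyCoeff : Summable entropyCoeff := by
  have h : Summable fun n : ℕ => 1 / ((n : ℝ) + 1) ^ 2 * (1 / Real.log 2) := by
    have := (summable_nat_add_iff 1).2 (Real.summable_one_div_nat_pow.2 one_lt_two)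
    push_cast at this
    exact this.mul_right _
  refine Summable.of_nonneg_of_le entropyCoeff_nonneg (fun n => ?_) h
  have := log_two_pos
  rw [entropyCoeff, ← one_div_mul_one_div]
  gcongr
  nlinarith [(n.cast_nonneg : (0 : ℝ) ≤ n)]

/-- For |d| < 1 this combines the power series of log((1+d)/(1-d)) and log(1-d²), with c_n arising
from 1/(2n+1) - 1/(2n+2). The endpoints, where those logarithms are singular, follow by continuity:
the coefficients are summable, so the series converges uniformly on [-1, 1]. -/
lemma hasSum_entropyCoeff_mul_pow {d : ℝ} (hd : |d| ≤ 1) :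
    HasSum (fun n => entropyCoeff n * d ^ (2 * n + 2)) (1 - bitEntropy d) := by
  have hl := log_two_pos
  have summ : ∀ d : ℝ, |d| ≤ 1 → Summable fun n => entropyCoeff n * d ^ (2 * n + 2) := by
    intro d hd
    refine summable_entropyCoeff.of_norm_bounded fun n => ?_
    rw [norm_mul, Real.norm_of_nonneg (entropyCoeff_nonneg n), norm_pow, Real.norm_eq_abs]
    exact mul_le_of_le_one_right (entropyCoeff_nonneg n) (pow_le_one₀ (abs_nonneg _) hd)
  have interior : ∀ d ∈ Ioo (-1 : ℝ) 1, ∑' n, entropyCoeff n * d ^ (2 * n + 2) = 1 - bitEntropy d := by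
    intro d hd
    have hd1 : |d| < 1 := abs_lt.2 hd
    have hd2 : |d ^ 2| < 1 := by rw [abs_pow]; exact pow_lt_one₀ (abs_nonneg _) hd1 two_ne_zero
    have h1 := (Real.hasSum_log_sub_log_of_abs_lt_one hd1).mul_left d
    have h2 := Real.hasSum_pow_div_log_of_abs_lt_one hd2
    have h3 := (h1.sub h2).div_const (2 * Real.log 2)
    refine (HasSum.tsum_eq ?_)
    have e : 1 - d ^ 2 = (1 + d) * (1 - d) := by ring
    convert! h3 using 1
    · ext n
      have h4 : ((n : ℝ) + 1) ≠ 0 := by positivity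
      have h5 : (2 * (n : ℝ) + 1) ≠ 0 := by positivity
      have h6 : (2 * (n : ℝ) + 2) ≠ 0 := by positivity
      rw [entropyCoeff]
      field_simp
      ring
    · rw [e, Real.log_mul (by linarith [hd.1]) (by linarith [hd.2]), bitEntropy]
      ring
  have cont : ContinuousOn (fun d : ℝ => ∑' n, entropyCoeff n * d ^ (2 * n + 2)) (Icc (-1) 1) := by
    refine continuousOn_tsum (fun n => by fun_prop) summable_entropyCoeff fun n d hd => ?_
    rw [norm_mul, Real.norm_of_nonneg (entropyCoeff_nonneg n), norm_pow, Real.norm_eq_abs]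
    exact mul_le_of_le_one_right (entropyCoeff_nonneg n) (pow_le_one₀ (abs_nonneg _) (abs_le.2 hd))
  have cont2 : Continuous fun d : ℝ => 1 - bitEntropy d := by
    unfold bitEntropy
    have h1 := Real.continuous_mul_log.comp (continuous_const.add continuous_id : Continuous fun d : ℝ => 1 + d)
    have h2 := Real.continuous_mul_log.comp (continuous_const.sub continuous_id : Continuous fun d : ℝ => 1 - d)
    exact continuous_const.sub (continuous_const.sub ((h1.add h2).div_const _))
  have all : EqOn (fun d : ℝ => ∑' n, entropyCoeff n * d ^ (2 * n + 2)) (fun d => 1 - bitEntropy d)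
      (Icc (-1) 1) :=
    EqOn.of_subset_closure (s := Ioo (-1) 1) interior cont cont2.continuousOn Ioo_subset_Icc_self
      (by rw [closure_Ioo (by norm_num)])
  exact (summ d hd).hasSum_iff.2 (all (abs_le.1 hd))

lemma hasSum_entropyCoeff : HasSum entropyCoeff 1 := by
  have h := hasSum_entropyCoeff_mul_pow (d := 1) (by simp)
  have hl := log_two_pos
  have e : bitEntropy 1 = 0 := by
    rw [bitEntropy]; norm_num
  simpa [e] using h

/-- The even moments of the soft bit. -/
noncomputable def softMoment (a : Measure EReal) (n : ℕ) : ℝ := ∫ y, softBit y ^ (2 * n + 2) ∂a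

lemma even_two_mul_add_two (n : ℕ) : Even (2 * n + 2) := ⟨n + 1, by ring⟩

lemma integrable_softBit_pow (a : Measure EReal) [IsFiniteMeasure a] (n : ℕ) :
    Integrable (fun y => softBit y ^ n) a :=
  Integrable.of_bound (by fun_prop) 1 (.of_forall fun y => abs_softBit_pow_le_one y n)

lemma softMoment_nonneg (a : Measure EReal) (n : ℕ) : 0 ≤ softMoment a n :=
  integral_nonneg fun _ => (even_two_mul_add_two n).pow_nonneg _

lemma softMoment_le_one (a : Measure EReal) [IsProbabilityMeasure a] (n : ℕ) :
    softMoment a n ≤ 1 := by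
  have := integral_mono (integrable_softBit_pow a (2 * n + 2)) (integrable_const (1 : ℝ))
    fun y => (abs_le.1 (abs_softBit_pow_le_one y (2 * n + 2))).2
  simpa [softMoment] using this

lemma softMoment_deltaTop (n : ℕ) : softMoment deltaTop n = 1 := by
  simp [softMoment, deltaTop]

lemma softMoment_checkConv (a b : Measure EReal) [IsProbabilityMeasure a]
    [IsProbabilityMeasure b] (n : ℕ) :
    softMoment (checkConv a b) n = softMoment a n * softMoment b n := by
  rw [softMoment, checkConv_eq, integral_map measurable_boxPlus.aemeasurable
    (by fun_prop)]
  simp only [softBit_boxPlus, mul_pow]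
  exact integral_prod_mul (fun y => softBit y ^ (2 * n + 2)) fun z => softBit z ^ (2 * n + 2)

/-- Conditionally on |y|, the sign of y has probabilities (1 ± d)/2. Applied to the entropy kernel,
this averaging replaces an unbounded integrand by the bounded binary entropy of the soft bit. -/
lemma SymmetricLaw.lintegral_eq {a : Measure EReal} (ha : SymmetricLaw a) {f : EReal → ℝ≥0∞}
    (hf : Measurable f) :
    ∫⁻ y, f y ∂a = ∫⁻ y, (f y * ENNReal.ofReal ((1 + softBit y) / 2) +
      f (-y) * ENNReal.ofReal ((1 - softBit y) / 2)) ∂a := by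
  have hfn : Measurable fun y => f (-y) := hf.comp measurable_neg
  rw [lintegral_add_left (by fun_prop)]
  have half : ∀ g : EReal → ℝ≥0∞, Measurable g → ∫⁻ y, g y * ENNReal.ofReal ((1 - softBit y) / 2) ∂a =
      (∫⁻ y, g y * ENNReal.ofReal (1 - softBit y) ∂a) * ENNReal.ofReal (1 / 2) := by
    intro g hg
    rw [← lintegral_mul_const _ (by fun_prop)]
    refine lintegral_congr fun y => ?_
    rw [mul_assoc, ← ENNReal.ofReal_mul (by linarith [softBit_le_one y]), mul_one_div]
  rw [half _ hfn, ha.symm f hf, ← half f hf, ← lintegral_add_left (by fun_prop)]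
  refine lintegral_congr fun y => ?_
  rw [← mul_add, ← ENNReal.ofReal_add (by linarith [neg_one_le_softBit y])
    (by linarith [softBit_le_one y])]
  ring_nf
  simp

lemma entropyKernel_symmetrized (y : EReal) :
    entropyKernel y * ((1 + softBit y) / 2) + entropyKernel (-y) * ((1 - softBit y) / 2) =
      bitEntropy (softBit y) := by
  have hl := log_two_pos
  induction y with
  | bot =>
    have : entropyKernel ⊤ = 0 := rfl
    have e : bitEntropy (-1) = 0 := by rw [bitEntropy]; norm_num
    simp [this, e]
  | top =>
    have : entropyKernel ⊤ = 0 := rfl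
    have e : bitEntropy 1 = 0 := by rw [bitEntropy]; norm_num
    simp [this, e]
  | coe t =>
    rw [entropyKernel_eq (EReal.coe_ne_bot t), entropyKernel_eq (by simp), softBit_neg, bitEntropy,
      Real.logb, Real.logb, ← sub_eq_add_neg]
    field_simp
    ring

lemma bitEntropy_le_one {d : ℝ} (hd : |d| ≤ 1) : bitEntropy d ≤ 1 := by
  have := (hasSum_entropyCoeff_mul_pow hd).nonneg fun n =>
    mul_nonneg (entropyCoeff_nonneg n) ((even_two_mul_add_two n).pow_nonneg d)
  linarith

lemma bitEntropy_nonneg {d : ℝ} (hd : |d| ≤ 1) : 0 ≤ bitEntropy d := by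
  have := hasSum_le (fun n => mul_le_of_le_one_right (entropyCoeff_nonneg n)
    ((le_abs_self _).trans ((abs_pow d (2 * n + 2)).le.trans (pow_le_one₀ (abs_nonneg _) hd))))
    (hasSum_entropyCoeff_mul_pow hd) hasSum_entropyCoeff
  linarith

@[fun_prop] lemma measurable_bitEntropy : Measurable bitEntropy := by
  unfold bitEntropy; fun_prop

lemma SymmetricLaw.lintegral_entropyKernel {a : Measure EReal} (ha : SymmetricLaw a) :
    ∫⁻ y, ENNReal.ofReal (entropyKernel y) ∂a =
      ∫⁻ y, ENNReal.ofReal (bitEntropy (softBit y)) ∂a := by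
  rw [ha.lintegral_eq (by fun_prop)]
  refine lintegral_congr fun y => ?_
  rw [← entropyKernel_symmetrized, ← ENNReal.ofReal_mul (entropyKernel_nonneg _),
    ← ENNReal.ofReal_mul (entropyKernel_nonneg _), ← ENNReal.ofReal_add]
  · exact mul_nonneg (entropyKernel_nonneg _) (by linarith [neg_one_le_softBit y])
  · exact mul_nonneg (entropyKernel_nonneg _) (by linarith [softBit_le_one y])

lemma SymmetricLaw.integrable_entropyKernel {a : Measure EReal} (ha : SymmetricLaw a) :
    Integrable entropyKernel a := by
  have := ha.prob
  refine ⟨by fun_prop, ?_⟩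
  rw [hasFiniteIntegral_iff_ofReal (.of_forall entropyKernel_nonneg), ha.lintegral_entropyKernel]
  calc _ ≤ ∫⁻ y, 1 ∂a := lintegral_mono fun y => by
        simpa using bitEntropy_le_one (abs_softBit_le_one y)
    _ < ∞ := by simp

/-- Symmetrization turns the kernel into `bitEntropy`, whose even power series is integrated term by
term. The constant 1 is rewritten as Σ c_n. -/
lemma SymmetricLaw.hasSum_entropy {a : Measure EReal} (ha : SymmetricLaw a) :
    HasSum (fun n => entropyCoeff n * (1 - softMoment a n)) (entropy a) := by
  have := ha.prob
  have h1 : entropy a = ∫ y, bitEntropy (softBit y) ∂a := by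
    rw [entropy, integral_eq_lintegral_of_nonneg_ae (.of_forall entropyKernel_nonneg)
      (by fun_prop), ha.lintegral_entropyKernel, ← integral_eq_lintegral_of_nonneg_ae
      (.of_forall fun y => bitEntropy_nonneg (abs_softBit_le_one y))
      (measurable_bitEntropy.comp measurable_softBit).aestronglyMeasurable]
  have hint : ∀ n, Integrable (fun y => entropyCoeff n * softBit y ^ (2 * n + 2)) a :=
    fun n => (integrable_softBit_pow a _).const_mul _
  have h2 : HasSum (fun n => entropyCoeff n * softMoment a n)
      (∫ y, (1 - bitEntropy (softBit y)) ∂a) := by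
    have e : ∀ y, 1 - bitEntropy (softBit y) =
        ∑' n, entropyCoeff n * softBit y ^ (2 * n + 2) :=
      fun y => (hasSum_entropyCoeff_mul_pow (abs_softBit_le_one y)).tsum_eq.symm
    simp_rw [e]
    have := hasSum_integral_of_summable_integral_norm hint ?_
    · simpa only [integral_const_mul, softMoment] using this
    · refine summable_entropyCoeff.of_nonneg_of_le (fun n => integral_nonneg fun y => norm_nonneg _)
        fun n => ?_
      have hb : ∀ y, ‖entropyCoeff n * softBit y ^ (2 * n + 2)‖ ≤ entropyCoeff n := by
        intro y
        rw [norm_mul, Real.norm_of_nonneg (entropyCoeff_nonneg n)]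
        exact mul_le_of_le_one_right (entropyCoeff_nonneg n) (abs_softBit_pow_le_one y _)
      have := integral_mono (hint n).norm (integrable_const (entropyCoeff n)) hb
      simpa using this
  have hi : Integrable (fun y => bitEntropy (softBit y)) a := by
    refine Integrable.of_bound (measurable_bitEntropy.comp
      measurable_softBit).aestronglyMeasurable 1 (.of_forall fun y => ?_)
    rw [Real.norm_of_nonneg (bitEntropy_nonneg (abs_softBit_le_one y))]
    exact bitEntropy_le_one (abs_softBit_le_one y)
  rw [integral_sub (integrable_const _) hi, ← h1] at h2
  have h3 := hasSum_entropyCoeff.sub h2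
  simp only [integral_const, probReal_univ, smul_eq_mul, mul_one, sub_sub_cancel] at h3
  exact h3.congr_fun fun n => by ring

lemma SymmetricLaw.entropy_varConv {a b : Measure EReal} (ha : SymmetricLaw a)
    (hb : SymmetricLaw b) :
    entropy (CoupledDE.varConv a b) =
      entropy a + entropy b - entropy (CoupledDE.checkConv a b) := by
  have := ha.prob
  have := hb.prob
  have hK := (ha.checkConv hb).integrable_entropyKernel
  rw [checkConv_eq, integrable_map_measure (by fun_prop) (by fun_prop)] at hK
  rw [entropy, CoupledDE.varConv, Measure.conv, integral_map (by fun_prop) (by fun_prop),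
    entropy, entropy, entropy, checkConv_eq, integral_map (by fun_prop) (by fun_prop)]
  have ia := ha.integrable_entropyKernel.comp_fst b
  have ib := hb.integrable_entropyKernel.comp_snd a
  have fa : ∫ y, entropyKernel y ∂a = ∫ p, entropyKernel p.1 ∂(a.prod b) := by
    rw [integral_fun_fst]; simp
  have fb : ∫ y, entropyKernel y ∂b = ∫ p, entropyKernel p.2 ∂(a.prod b) := by
    rw [integral_fun_snd]; simp
  rw [fa, fb, ← integral_add ia ib]
  refine Eq.trans ?_ (integral_sub (ia.add ib) hK)
  refine integral_congr_ae ?_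
  filter_upwards [Measure.quasiMeasurePreserving_fst.ae ha.ae_ne_bot,
    Measure.quasiMeasurePreserving_snd.ae hb.ae_ne_bot] with p h1 h2
  exact entropyKernel_add h1 h2

lemma SymmetricLaw.hasSum_entropy_checkConv {a b : Measure EReal} (ha : SymmetricLaw a)
    (hb : SymmetricLaw b) :
    HasSum (fun n => entropyCoeff n * (1 - softMoment a n * softMoment b n))
      (entropy (CoupledDE.checkConv a b)) := by
  have := ha.prob
  have := hb.prob
  simpa only [softMoment_checkConv] using (ha.checkConv hb).hasSum_entropy

/-- Duality with multiplicativity of the moments under ⊠: 1 - m + 1 - m' - (1 - mm') = (1 - m)(1 -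
m'). This bilinear form underlies all later comparisons. -/
lemma SymmetricLaw.hasSum_entropy_varConv {a b : Measure EReal} (ha : SymmetricLaw a)
    (hb : SymmetricLaw b) :
    HasSum (fun n => entropyCoeff n * ((1 - softMoment a n) * (1 - softMoment b n)))
      (entropy (CoupledDE.varConv a b)) := by
  rw [ha.entropy_varConv hb]
  exact ((ha.hasSum_entropy.add hb.hasSum_entropy).sub (ha.hasSum_entropy_checkConv hb)).congr_fun
    fun n => by ring

lemma SymmetricLaw.entropy_mem_Icc {a : Measure EReal} (ha : SymmetricLaw a) :
    entropy a ∈ Icc (0 : ℝ) 1 := by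
  have := ha.prob
  constructor
  · exact ha.hasSum_entropy.nonneg fun n =>
      mul_nonneg (entropyCoeff_nonneg n) (sub_nonneg.2 (softMoment_le_one a n))
  · exact hasSum_le (fun n => mul_le_of_le_one_right (entropyCoeff_nonneg n)
      (by linarith [softMoment_nonneg a n])) ha.hasSum_entropy hasSum_entropyCoeff

lemma SymmetricLaw.entropy_congr {a b : Measure EReal} (ha : SymmetricLaw a)
    (hb : SymmetricLaw b) (h : ∀ n, softMoment a n = softMoment b n) : entropy a = entropy b :=
  ha.hasSum_entropy.unique (by simpa only [h] using hb.hasSum_entropy)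

/-! ### Degradation decreases the even moments -/

/-- Symmetry makes φ (1 - d) integrate to the same value as its negative. In particular, odd moments
of the soft bit equal the next even ones. -/
lemma SymmetricLaw.integral_odd {a : Measure EReal} (ha : SymmetricLaw a) {φ : EReal → ℝ}
    (hφ : Measurable φ) {C : ℝ} (hC : ∀ y, |φ y| ≤ C) (hodd : ∀ y, φ (-y) = -φ y) :
    ∫ y, φ y ∂a = ∫ y, φ y * softBit y ∂a := by
  have := ha.prob
  have hs : Integrable softBit a := by simpa using integrable_softBit_pow a 1
  have hi : Integrable φ a := Integrable.of_bound (by fun_prop) C (.of_forall hC)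
  have his : Integrable (fun y => φ y * softBit y) a := by
    refine hi.mul_bdd (c := 1) (by fun_prop) (.of_forall fun y => ?_)
    exact abs_softBit_le_one y
  -- Symmetry is stated for nonnegative functions, hence the shift by the bound `C`; its
  -- contribution cancels.
  have h := ha.symm (fun y => ENNReal.ofReal (φ y + C)) (by fun_prop)
  have conv : ∀ ψ : EReal → ℝ, Measurable ψ → (∀ y, 0 ≤ ψ y + C) →
      (∫⁻ y, ENNReal.ofReal (ψ y + C) * ENNReal.ofReal (1 - softBit y) ∂a).toReal =
      ∫ y, (ψ y + C) * (1 - softBit y) ∂a := by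
    intro ψ hψ hpos
    rw [integral_eq_lintegral_of_nonneg_ae
      (.of_forall fun y => mul_nonneg (hpos y) (sub_nonneg.2 (softBit_le_one y))) (by fun_prop)]
    simp_rw [ENNReal.ofReal_mul (hpos _)]
  have hp : ∀ y, 0 ≤ φ y + C := fun y => by linarith [(abs_le.1 (hC y)).1]
  have h2 := congrArg ENNReal.toReal h
  rw [conv (fun y => φ (-y)) (hφ.comp measurable_neg) (fun y => hp _), conv φ hφ hp] at h2
  simp_rw [hodd] at h2
  have ic : Integrable (fun y => C * (1 - softBit y)) a := ((integrable_const _).sub hs).const_mul C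
  have e1 : ∀ y, (-φ y + C) * (1 - softBit y) = C * (1 - softBit y) - (φ y - φ y * softBit y) :=
    fun y => by ring
  have e2 : ∀ y, (φ y + C) * (1 - softBit y) = C * (1 - softBit y) + (φ y - φ y * softBit y) :=
    fun y => by ring
  simp_rw [e1, e2] at h2
  have hd : Integrable (fun y => φ y - φ y * softBit y) a := hi.sub his
  rw [integral_sub ic hd, integral_add ic hd, integral_sub hi his] at h2
  linarith

/-- Weighted AM-GM with exponents 2n+1 and 1, obtained from Bernoulli's inequality for |t / x|
multiplied by x^(2n+2). -/
lemma pow_mul_le_weighted (x t : ℝ) (n : ℕ) :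
    x ^ (2 * n + 1) * t ≤
      (2 * n + 1) / (2 * n + 2) * x ^ (2 * n + 2) + 1 / (2 * n + 2) * t ^ (2 * n + 2) := by
  have hN : (0 : ℝ) < 2 * n + 2 := by positivity
  rcases eq_or_ne x 0 with rfl | hx
  · rw [zero_pow (by omega), zero_pow (by omega)]
    have := (even_two_mul_add_two n).pow_nonneg t
    have : 0 ≤ 1 / (2 * (n : ℝ) + 2) * t ^ (2 * n + 2) := by positivity
    linarith
  have hxpos : 0 < x ^ (2 * n + 2) := (even_two_mul_add_two n).pow_pos hx
  have h := one_add_mul_sub_le_pow (a := |t / x|) (by linarith [abs_nonneg (t / x)]) (2 * n + 2)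
  rw [(even_two_mul_add_two n).pow_abs, div_pow] at h
  have h2 := mul_le_mul_of_nonneg_right h hxpos.le
  rw [div_mul_cancel₀ _ hxpos.ne'] at h2
  have h3 : x ^ (2 * n + 1) * t ≤ |t / x| * x ^ (2 * n + 2) := by
    calc x ^ (2 * n + 1) * t = t / x * x ^ (2 * n + 2) := by rw [pow_succ' x (2 * n + 1)]; field_simp
      _ ≤ _ := by gcongr; exact le_abs_self _
  push_cast at h2
  have e : (2 * n + 1) / (2 * n + 2) * x ^ (2 * n + 2) + 1 / (2 * n + 2) * t ^ (2 * n + 2) =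
    ((2 * n + 1) * x ^ (2 * n + 2) + t ^ (2 * n + 2)) / (2 * (n : ℝ) + 2) := by field_simp
  rw [e, le_div_iff₀ hN]
  nlinarith

lemma integral_bind_kernel (a : Measure EReal) [IsProbabilityMeasure a] (κ : Kernel EReal EReal)
    [IsMarkovKernel κ] {f : EReal → ℝ} (hf : Measurable f) {C : ℝ} (hC : ∀ y, |f y| ≤ C) :
    ∫ z, f z ∂(a.bind κ) = ∫ y, ∫ z, f z ∂κ y ∂a := by
  rw [Measure.comp_eq_comp_const_apply, Kernel.integral_comp, Kernel.const_apply]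
  exact Integrable.of_bound (by fun_prop) C (.of_forall hC)

/-- The even moment of `b` equals an odd one, which under reflection changes sign; subtracting the
two channel equations thus expresses 2 m_n(b) as the `a`-integral of an odd function `D`. Symmetry
of `a` inserts a factor d(y), and weighted AM-GM inside the kernel bounds the result by
2(2n+1)/(2n+2) · m_n(b) + 2/(2n+2) · m_n(a). Absorbing the first term leaves the claim. -/
lemma Degraded.softMoment_le {a b : Measure EReal} (ha : SymmetricLaw a) (hb : SymmetricLaw b)
    (h : Degraded a b) (n : ℕ) : softMoment b n ≤ softMoment a n := by
  have := ha.prob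
  have := hb.prob
  obtain ⟨κ, hκ, h1, h2⟩ := h
  have hN : (0 : ℝ) < 2 * n + 2 := by positivity
  have avg_bound : ∀ m y, |∫ z, softBit z ^ m ∂κ y| ≤ 1 := fun m y => by
    have := norm_integral_le_of_norm_le_const (μ := κ y) (f := fun z => softBit z ^ m) (C := 1)
      (.of_forall fun z => abs_softBit_pow_le_one z m)
    simpa using this
  have avg_meas : ∀ m, Measurable fun y => ∫ z, softBit z ^ m ∂κ y := fun m =>
    ((measurable_softBit.pow_const m).stronglyMeasurable.integral_kernel).measurable
  have avg_int : ∀ m, Integrable (fun y => ∫ z, softBit z ^ m ∂κ y) a := fun m =>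
    Integrable.of_bound (avg_meas m).aestronglyMeasurable 1 (.of_forall (avg_bound m))
  have avg_int' : ∀ m, Integrable (fun y => ∫ z, softBit z ^ m ∂κ (-y)) a := fun m =>
    Integrable.of_bound ((avg_meas m).comp measurable_neg).aestronglyMeasurable 1
      (.of_forall fun y => avg_bound m (-y))
  have pos : ∀ m, ∫ z, softBit z ^ m ∂b = ∫ y, ∫ z, softBit z ^ m ∂κ y ∂a := fun m => by
    rw [← h1, integral_bind_kernel a κ (by fun_prop) (abs_softBit_pow_le_one · m)]
  have neg : ∀ m, ∫ z, (-softBit z) ^ m ∂b = ∫ y, ∫ z, softBit z ^ m ∂κ (-y) ∂a := fun m => by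
    have : IsProbabilityMeasure (a.map fun y => -y) :=
      Measure.isProbabilityMeasure_map (by fun_prop)
    have e := congrArg (fun μ : Measure EReal => ∫ z, softBit z ^ m ∂μ) h2
    rw [integral_bind_kernel _ κ (by fun_prop) (abs_softBit_pow_le_one · m),
      integral_map (by fun_prop) (avg_meas m).aestronglyMeasurable,
      integral_map (by fun_prop) (by fun_prop)] at e
    simpa using e.symm
  have odd1 : ∫ z, softBit z ^ (2 * n + 1) ∂b = softMoment b n := by
    rw [hb.integral_odd (φ := fun z => softBit z ^ (2 * n + 1)) (by fun_prop)
      (abs_softBit_pow_le_one · _) (fun y => by rw [softBit_neg, Odd.neg_pow ⟨n, rfl⟩])]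
    rfl
  have even1 : ∀ z, (-softBit z) ^ (2 * n + 2) = softBit z ^ (2 * n + 2) :=
    fun z => (even_two_mul_add_two n).neg_pow _
  have odd2 : ∀ z, (-softBit z) ^ (2 * n + 1) = -softBit z ^ (2 * n + 1) :=
    fun z => Odd.neg_pow ⟨n, rfl⟩ _
  have p1 := pos (2 * n + 1)
  have p2 := pos (2 * n + 2)
  have n1 := neg (2 * n + 1)
  have n2 := neg (2 * n + 2)
  simp_rw [odd2, integral_neg] at n1
  simp_rw [even1] at n2
  -- Twice the odd part of the kernel average of d^(2n+1). Oddness is what allows `integral_odd` to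
  -- be applied to `a`.
  set D : EReal → ℝ := fun y =>
    (∫ z, softBit z ^ (2 * n + 1) ∂κ y) - ∫ z, softBit z ^ (2 * n + 1) ∂κ (-y)
  have hD : ∫ y, D y ∂a = 2 * softMoment b n := by
    rw [integral_sub (avg_int _) (avg_int' _), ← p1, ← n1, odd1]; ring
  have hDm : Measurable D := (avg_meas _).sub ((avg_meas _).comp measurable_neg)
  have hD2 := ha.integral_odd hDm (C := 2) (fun y => (abs_sub _ _).trans (by
    linarith [avg_bound (2 * n + 1) y, avg_bound (2 * n + 1) (-y)])) (fun y => by simp [D])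
  have young : ∀ y t, (∫ z, softBit z ^ (2 * n + 1) ∂κ y) * t ≤
      (2 * n + 1) / (2 * n + 2) * (∫ z, softBit z ^ (2 * n + 2) ∂κ y) +
        1 / (2 * n + 2) * t ^ (2 * n + 2) := by
    intro y t
    have := integral_mono (μ := κ y) ((integrable_softBit_pow (κ y) (2 * n + 1)).mul_const t)
      (((integrable_softBit_pow (κ y) (2 * n + 2)).const_mul ((2 * n + 1) / (2 * n + 2))).add
        (integrable_const (1 / (2 * n + 2) * t ^ (2 * n + 2))))
      fun z => pow_mul_le_weighted (softBit z) t n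
    rw [integral_mul_const] at this
    refine this.trans_eq ?_
    simp only [Pi.add_apply]
    rw [integral_add ((integrable_softBit_pow (κ y) (2 * n + 2)).const_mul _)
      (integrable_const _), integral_const_mul]
    simp
  have bound : ∀ y, D y * softBit y ≤ (2 * n + 1) / (2 * n + 2) *
      ((∫ z, softBit z ^ (2 * n + 2) ∂κ y) + ∫ z, softBit z ^ (2 * n + 2) ∂κ (-y)) +
      2 / (2 * n + 2) * softBit y ^ (2 * n + 2) := by
    intro y
    have i1 := young y (softBit y)
    have i2 := young (-y) (-softBit y)
    rw [even1] at i2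
    have : D y * softBit y = (∫ z, softBit z ^ (2 * n + 1) ∂κ y) * softBit y +
      (∫ z, softBit z ^ (2 * n + 1) ∂κ (-y)) * (-softBit y) := by simp only [D]; ring
    rw [this]
    refine (add_le_add i1 i2).trans_eq ?_
    ring
  have ileft : Integrable (fun y => D y * softBit y) a :=
    ((avg_int _).sub (avg_int' _)).mul_bdd (c := 1) (by fun_prop) (.of_forall abs_softBit_le_one)
  have iS : Integrable (fun y => (∫ z, softBit z ^ (2 * n + 2) ∂κ y) +
      ∫ z, softBit z ^ (2 * n + 2) ∂κ (-y)) a := (avg_int _).add (avg_int' _)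
  have iA := iS.const_mul ((2 * n + 1) / (2 * n + 2) : ℝ)
  have iB := (integrable_softBit_pow a (2 * n + 2)).const_mul (2 / (2 * n + 2) : ℝ)
  have total := integral_mono ileft (iA.add iB) bound
  rw [← hD2, hD] at total
  simp only [Pi.add_apply] at total
  rw [integral_add iA iB, integral_const_mul, integral_const_mul,
    integral_add (avg_int _) (avg_int' _), ← p2, ← n2] at total
  change 2 * softMoment b n ≤ (2 * n + 1) / (2 * n + 2) * (softMoment b n + softMoment b n) +
    2 / (2 * n + 2) * softMoment a n at total
  rw [← two_mul] at total
  have e : (2 * n + 1) / (2 * n + 2) * (2 * softMoment b n) + 2 / (2 * n + 2) * softMoment a n =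
    ((2 * n + 1) * (2 * softMoment b n) + 2 * softMoment a n) / (2 * (n : ℝ) + 2) := by field_simp
  rw [e, le_div_iff₀ hN] at total
  linarith

/-! ### Moments and the Wasserstein distance -/

lemma absD_restrict (a : Measure EReal) : (absD a).restrict (Icc 0 1) = absD a := by
  refine Measure.restrict_eq_self_of_ae_mem ?_
  have h : ∀ᵐ y ∂a, |softBit y| ∈ Icc (0 : ℝ) 1 :=
    .of_forall fun y => ⟨abs_nonneg _, abs_softBit_le_one y⟩
  exact (ae_map_iff (p := fun u => u ∈ Icc (0 : ℝ) 1) (by fun_prop) measurableSet_Icc).2 h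

/-- Without boundedness the real supremum would have its default value and bound nothing.
Subtracting f 0 from a 1-Lipschitz f on [0, 1] leaves values of modulus at most 1. -/
lemma bddAbove_wasserstein (a b : Measure EReal) [IsProbabilityMeasure a]
    [IsProbabilityMeasure b] :
    BddAbove {t : ℝ | ∃ f : ℝ → ℝ, LipschitzOnWith 1 f (Icc 0 1) ∧
      t = |(∫ u in Icc (0 : ℝ) 1, f u ∂(absD a)) - ∫ u in Icc (0 : ℝ) 1, f u ∂(absD b)|} := by
  refine ⟨2, ?_⟩
  rintro t ⟨f, hf, rfl⟩
  have main : ∀ c : Measure EReal, IsProbabilityMeasure c →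
      |(∫ u in Icc (0 : ℝ) 1, f u ∂(absD c)) - f 0| ≤ 1 := by
    intro c hc
    have hp : IsProbabilityMeasure (absD c) := Measure.isProbabilityMeasure_map (by fun_prop)
    have hfull := absD_restrict c
    have hb : ∀ u ∈ Icc (0 : ℝ) 1, ‖f u - f 0‖ ≤ 1 := fun u hu => by
      have := hf.dist_le_mul u hu 0 (by simp)
      rw [Real.dist_eq, Real.dist_eq] at this
      rw [Real.norm_eq_abs]
      refine this.trans ?_
      simpa [abs_of_nonneg hu.1] using hu.2
    have hcont : ContinuousOn f (Icc 0 1) := hf.continuousOn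
    have hi : IntegrableOn f (Icc 0 1) (absD c) := hcont.integrableOn_Icc
    have e : (∫ u in Icc (0 : ℝ) 1, f u ∂(absD c)) - f 0 =
        ∫ u in Icc (0 : ℝ) 1, (f u - f 0) ∂(absD c) := by
      rw [integral_sub hi (integrable_const _), integral_const, hfull]
      simp
    rw [e, ← Real.norm_eq_abs]
    have := norm_setIntegral_le_of_norm_le_const (μ := absD c) (measure_lt_top _ _) hb
    refine this.trans ?_
    rw [one_mul]
    exact measureReal_le_one
  have h1 := abs_le.1 (main a inferInstance)
  have h2 := abs_le.1 (main b inferInstance)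
  rw [abs_le]
  constructor <;> linarith [h1.1, h1.2, h2.1, h2.2]

lemma abs_softMoment_sub_le (a b : Measure EReal) [IsProbabilityMeasure a]
    [IsProbabilityMeasure b] (n : ℕ) :
    |softMoment a n - softMoment b n| ≤ (2 * n + 2) * wasserstein a b := by
  have hN : (0 : ℝ) < 2 * n + 2 := by positivity
  -- The power normalized by the maximum of its derivative on [0, 1], hence an admissible test
  -- function.
  let f : ℝ → ℝ := fun u => u ^ (2 * n + 2) / (2 * n + 2)
  have hf : LipschitzOnWith 1 f (Icc 0 1) := by
    refine LipschitzOnWith.of_dist_le_mul fun u hu v hv => ?_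
    rw [Real.dist_eq, Real.dist_eq, NNReal.coe_one, one_mul]
    have h := abs_pow_sub_pow_le u v (2 * n + 2)
    have e : f u - f v = (u ^ (2 * n + 2) - v ^ (2 * n + 2)) / (2 * n + 2) := by
      simp only [f]; ring
    rw [e, abs_div, abs_of_pos hN, div_le_iff₀ hN]
    refine h.trans ?_
    push_cast
    refine mul_le_of_le_one_right (by positivity) (pow_le_one₀ (by positivity) ?_)
    rw [abs_of_nonneg hu.1, abs_of_nonneg hv.1]
    exact max_le hu.2 hv.2
  have hint : ∀ c : Measure EReal, IsProbabilityMeasure c →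
      ∫ u in Icc (0 : ℝ) 1, f u ∂(absD c) = softMoment c n / (2 * n + 2) := by
    intro c hc
    have hfull := absD_restrict c
    rw [hfull, absD, integral_map (by fun_prop) (by fun_prop), softMoment, ← integral_div]
    simp only [f, (even_two_mul_add_two n).pow_abs]
  have h := le_csSup (bddAbove_wasserstein a b) ⟨f, hf, rfl⟩
  rw [hint a inferInstance, hint b inferInstance, ← sub_div, abs_div, abs_of_pos hN,
    div_le_iff₀ hN] at h
  rw [mul_comm]
  exact h

/-- The bound on the difference of the `n`-th even moments of two laws at Wasserstein distance at
most `δ`. -/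
noncomputable def momentGap (δ : ℝ) (n : ℕ) : ℝ := min 1 ((2 * n + 2) * δ)

lemma momentGap_nonneg {δ : ℝ} (hδ : 0 ≤ δ) (n : ℕ) : 0 ≤ momentGap δ n :=
  le_min zero_le_one (by positivity)

lemma momentGap_le_one (δ : ℝ) (n : ℕ) : momentGap δ n ≤ 1 := min_le_left _ _

lemma abs_softMoment_sub_le_one (a b : Measure EReal) [IsProbabilityMeasure a]
    [IsProbabilityMeasure b] (n : ℕ) : |softMoment a n - softMoment b n| ≤ 1 := by
  have h1 := softMoment_nonneg a n
  have h2 := softMoment_nonneg b n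
  have h3 := softMoment_le_one a n
  have h4 := softMoment_le_one b n
  rw [abs_le]; constructor <;> linarith

lemma abs_softMoment_sub_le_momentGap {a b : Measure EReal} [IsProbabilityMeasure a]
    [IsProbabilityMeasure b] {δ : ℝ} (h : wasserstein a b ≤ δ) (n : ℕ) :
    |softMoment a n - softMoment b n| ≤ momentGap δ n :=
  le_min (abs_softMoment_sub_le_one a b n) ((abs_softMoment_sub_le a b n).trans (by gcongr))

lemma summable_entropyCoeff_mul {ε : ℕ → ℝ} (h1 : ∀ n, |ε n| ≤ 1) :
    Summable fun n => entropyCoeff n * ε n :=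
  summable_entropyCoeff.of_norm_bounded fun n => by
    rw [norm_mul, Real.norm_of_nonneg (entropyCoeff_nonneg n)]
    exact mul_le_of_le_one_right (entropyCoeff_nonneg n) (h1 n)

/-- The cut-off satisfies min(1, (2n+2)δ) ≤ 2 √((n+1)δ), so the terms are O(n^(-3/2)) √δ. They are
dominated by a constant multiple of the telescoping differences of 1/√(n+1), whose sum is at most 1.
-/
lemma tsum_entropyCoeff_mul_momentGap_le {δ : ℝ} (hδ : 0 ≤ δ) :
    ∑' n, entropyCoeff n * momentGap δ n ≤ 4 / Real.log 2 * √δ := by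
  have hl := log_two_pos
  have term : ∀ n, entropyCoeff n * momentGap δ n ≤
      4 / Real.log 2 * √δ * (1 / √((n : ℝ) + 1) - 1 / √((n : ℝ) + 1 + 1)) := by
    intro n
    obtain ⟨A, hA⟩ : ∃ A, A = √((n : ℝ) + 1) := ⟨_, rfl⟩
    obtain ⟨B, hB⟩ : ∃ B, B = √((n : ℝ) + 1 + 1) := ⟨_, rfl⟩
    have hA1 : 1 ≤ A := by
      rw [hA]; exact Real.one_le_sqrt.2 (by linarith [(n.cast_nonneg : (0 : ℝ) ≤ n)])
    have hA2 : A ^ 2 = n + 1 := by rw [hA]; exact Real.sq_sqrt (by positivity)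
    have hB2 : B ^ 2 = n + 1 + 1 := by rw [hB]; exact Real.sq_sqrt (by positivity)
    have hAB : A ≤ B := by rw [hA, hB]; exact Real.sqrt_le_sqrt (by linarith)
    have hB0 : 0 < B := by linarith
    have hA0 : 0 < A := by linarith
    -- With q = 2A√δ the linear bound equals q²/2, so min(1, q²/2) ≤ q in either case.
    have gap : momentGap δ n ≤ 2 * A * √δ := by
      rcases le_total 1 (2 * A * √δ) with h | h
      · exact (momentGap_le_one δ n).trans h
      · refine (min_le_right _ _).trans ?_
        have : (2 * (n : ℝ) + 2) * δ = (2 * A * √δ) * (A * √δ) := by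
          rw [show (2 * A * √δ) * (A * √δ) = 2 * A ^ 2 * (√δ * √δ) by ring,
            Real.mul_self_sqrt hδ, hA2]; ring
        rw [this]
        have h0 : 0 ≤ A * √δ := by positivity
        nlinarith
    rw [← hA, ← hB]
    have key : (1 / (2 * A ^ 2 * (2 * A ^ 2 - 1))) * (2 * A) ≤ 4 * (1 / A - 1 / B) := by
      have hB3 : B ≤ 2 * A := by nlinarith
      have e : 1 / A - 1 / B = 1 / (A * B * (A + B)) := by
        have : (B - A) * (A + B) = 1 := by nlinarith
        field_simp
        nlinarith
      have e2 : (1 / (2 * A ^ 2 * (2 * A ^ 2 - 1))) * (2 * A) = 1 / (A * (2 * A ^ 2 - 1)) := by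
        have : 2 * A ^ 2 - 1 ≠ 0 := by nlinarith
        field_simp
      rw [e, e2, mul_one_div, div_le_div_iff₀ (by nlinarith) (by positivity)]
      have hBsq : B ^ 2 = A ^ 2 + 1 := by rw [hB2, hA2]
      have : B * (A + B) ≤ 4 * (2 * A ^ 2 - 1) := by nlinarith
      nlinarith
    have hc : entropyCoeff n = 1 / (2 * A ^ 2 * (2 * A ^ 2 - 1)) / Real.log 2 := by
      rw [entropyCoeff, div_div, hA2]; ring_nf
    calc entropyCoeff n * momentGap δ n ≤ entropyCoeff n * (2 * A * √δ) := by
          gcongr; exact entropyCoeff_nonneg n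
      _ = (1 / (2 * A ^ 2 * (2 * A ^ 2 - 1))) * (2 * A) * (√δ / Real.log 2) := by
          rw [hc]; ring
      _ ≤ 4 * (1 / A - 1 / B) * (√δ / Real.log 2) := by gcongr
      _ = _ := by ring
  refine Real.tsum_le_of_sum_range_le
    (fun n => mul_nonneg (entropyCoeff_nonneg n) (momentGap_nonneg hδ n)) fun N => ?_
  refine (Finset.sum_le_sum fun n _ => term n).trans ?_
  rw [← Finset.mul_sum]
  have tel : ∀ N : ℕ, ∑ n ∈ Finset.range N, (1 / √((n : ℝ) + 1) - 1 / √((n : ℝ) + 1 + 1)) =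
      1 - 1 / √((N : ℝ) + 1) := by
    intro N
    induction N with
    | zero => simp
    | succ N ih => rw [Finset.sum_range_succ, ih]; push_cast; ring
  rw [tel]
  refine mul_le_of_le_one_right (by positivity) ?_
  have : 0 ≤ 1 / √((N : ℝ) + 1) := by positivity
  linarith

/-! ### Polynomial functions on a set -/

/-- The function agrees with a polynomial on `S`. -/
def PolynomialOn (S : Set ℝ) (f : ℝ → ℝ) : Prop :=
  ∃ P : Polynomial ℝ, ∀ s ∈ S, f s = P.eval s

/-- The function agrees on `S × S` with a polynomial in two variables. -/
def BipolynomialOn (S : Set ℝ) (f : ℝ → ℝ → ℝ) : Prop :=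
  ∃ (ι : Type) (_ : Fintype ι) (P Q : ι → Polynomial ℝ),
    ∀ s ∈ S, ∀ t ∈ S, f s t = ∑ i, (P i).eval s * (Q i).eval t

section Polynomial

variable {S : Set ℝ} {f g : ℝ → ℝ} {F G : ℝ → ℝ → ℝ}

lemma PolynomialOn.congr (hf : PolynomialOn S f) (h : ∀ s ∈ S, g s = f s) : PolynomialOn S g :=
  let ⟨P, hP⟩ := hf
  ⟨P, fun s hs => (h s hs).trans (hP s hs)⟩

lemma polynomialOn_const (c : ℝ) : PolynomialOn S fun _ => c :=
  ⟨Polynomial.C c, fun s _ => by simp⟩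

lemma PolynomialOn.add (hf : PolynomialOn S f) (hg : PolynomialOn S g) :
    PolynomialOn S fun s => f s + g s :=
  let ⟨P, hP⟩ := hf
  let ⟨Q, hQ⟩ := hg
  ⟨P + Q, fun s hs => by beta_reduce; rw [hP s hs, hQ s hs, Polynomial.eval_add]⟩

lemma PolynomialOn.const_mul (c : ℝ) (hf : PolynomialOn S f) : PolynomialOn S fun s => c * f s :=
  let ⟨P, hP⟩ := hf
  ⟨Polynomial.C c * P, fun s hs => by beta_reduce; rw [hP s hs]; simp⟩

lemma PolynomialOn.sub (hf : PolynomialOn S f) (hg : PolynomialOn S g) :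
    PolynomialOn S fun s => f s - g s :=
  (hf.add (hg.const_mul (-1))).congr fun s _ => by ring

lemma PolynomialOn.sum {κ : Type*} {A : Finset κ} {f : κ → ℝ → ℝ}
    (hf : ∀ k ∈ A, PolynomialOn S (f k)) : PolynomialOn S fun s => ∑ k ∈ A, f k s := by
  classical
  induction A using Finset.induction_on with
  | empty => exact (polynomialOn_const 0).congr fun s _ => by simp
  | insert k A hk ih =>
    exact ((hf k (by simp)).add (ih fun j hj => hf j (by simp [hj]))).congr fun s _ => by
      rw [Finset.sum_insert hk]

lemma PolynomialOn.differentiableAt (hf : PolynomialOn S f) {s : ℝ} (hs : S ∈ nhds s) :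
    DifferentiableAt ℝ f s := by
  obtain ⟨P, hP⟩ := hf
  exact P.differentiableAt.congr_of_eventuallyEq (Filter.eventuallyEq_of_mem hs hP)

lemma BipolynomialOn.congr (hF : BipolynomialOn S F) (h : ∀ s ∈ S, ∀ t ∈ S, G s t = F s t) :
    BipolynomialOn S G :=
  let ⟨ι, i, P, Q, hP⟩ := hF
  ⟨ι, i, P, Q, fun s hs t ht => (h s hs t ht).trans (hP s hs t ht)⟩

lemma BipolynomialOn.add (hF : BipolynomialOn S F) (hG : BipolynomialOn S G) :
    BipolynomialOn S fun s t => F s t + G s t :=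
  let ⟨ι, _, P, Q, hP⟩ := hF
  let ⟨κ, _, P', Q', hQ⟩ := hG
  ⟨ι ⊕ κ, inferInstance, Sum.elim P P', Sum.elim Q Q', fun s hs t ht => by
    beta_reduce; rw [hP s hs t ht, hQ s hs t ht]; simp⟩

lemma BipolynomialOn.const_mul (c : ℝ) (hF : BipolynomialOn S F) :
    BipolynomialOn S fun s t => c * F s t :=
  let ⟨ι, i, P, Q, hP⟩ := hF
  ⟨ι, i, fun i => Polynomial.C c * P i, Q, fun s hs t ht => by
    beta_reduce; rw [hP s hs t ht, Finset.mul_sum]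
    simp [mul_assoc]⟩

lemma BipolynomialOn.sub (hF : BipolynomialOn S F) (hG : BipolynomialOn S G) :
    BipolynomialOn S fun s t => F s t - G s t :=
  (hF.add (hG.const_mul (-1))).congr fun s _ t _ => by ring

lemma PolynomialOn.bipolynomialOn_left (hf : PolynomialOn S f) :
    BipolynomialOn S fun s _ => f s :=
  let ⟨P, hP⟩ := hf
  ⟨Unit, inferInstance, fun _ => P, fun _ => 1, fun s hs t _ => by simp [hP s hs]⟩

lemma PolynomialOn.bipolynomialOn_right (hf : PolynomialOn S f) :
    BipolynomialOn S fun _ t => f t :=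
  let ⟨P, hP⟩ := hf
  ⟨Unit, inferInstance, fun _ => 1, fun _ => P, fun s _ t ht => by simp [hP t ht]⟩

lemma BipolynomialOn.left (hF : BipolynomialOn S F) {t : ℝ} (ht : t ∈ S) :
    PolynomialOn S fun s => F s t :=
  let ⟨_, _, P, Q, hP⟩ := hF
  ⟨∑ i, P i * Polynomial.C ((Q i).eval t), fun s hs => by
    beta_reduce; rw [hP s hs t ht, Polynomial.eval_finsetSum]; simp⟩

lemma BipolynomialOn.right (hF : BipolynomialOn S F) {s : ℝ} (hs : s ∈ S) :
    PolynomialOn S fun t => F s t :=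
  let ⟨_, _, P, Q, hP⟩ := hF
  ⟨∑ i, Polynomial.C ((P i).eval s) * Q i, fun t ht => by
    beta_reduce; rw [hP s hs t ht, Polynomial.eval_finsetSum]; simp⟩

lemma BipolynomialOn.diag (hF : BipolynomialOn S F) : PolynomialOn S fun s => F s s :=
  let ⟨_, _, P, Q, hP⟩ := hF
  ⟨∑ i, P i * Q i, fun s hs => by
    beta_reduce; rw [hP s hs s hs, Polynomial.eval_finsetSum]; simp⟩

lemma BipolynomialOn.deriv_left (hF : BipolynomialOn S F) :
    PolynomialOn (interior S) fun s => deriv (fun u => F u s) s := by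
  obtain ⟨ι, _, P, Q, hP⟩ := hF
  refine ⟨∑ i, (P i).derivative * Q i, fun s hs => ?_⟩
  have h : (fun u => F u s) =ᶠ[nhds s] fun u => ∑ i, (P i).eval u * (Q i).eval s :=
    Filter.eventuallyEq_of_mem (mem_interior_iff_mem_nhds.1 hs)
      fun u hu => hP u hu s (interior_subset hs)
  beta_reduce
  rw [h.deriv_eq, deriv_fun_sum fun i _ => (P i).differentiableAt.mul_const _,
    Polynomial.eval_finsetSum]
  refine Finset.sum_congr rfl fun i _ => ?_
  rw [deriv_mul_const (P i).differentiableAt, Polynomial.deriv, Polynomial.eval_mul]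

lemma BipolynomialOn.hasDerivAt_diag (hF : BipolynomialOn S F) {s : ℝ} (hs : S ∈ nhds s) :
    HasDerivAt (fun u => F u u) (deriv (fun u => F u s) s + deriv (fun u => F s u) s) s := by
  obtain ⟨ι, _, P, Q, hP⟩ := hF
  have hsS := mem_of_mem_nhds hs
  have h1 : (fun u => F u s) =ᶠ[nhds s] fun u => ∑ i, (P i).eval u * (Q i).eval s :=
    Filter.eventuallyEq_of_mem hs fun u hu => hP u hu s hsS
  have h2 : (fun u => F s u) =ᶠ[nhds s] fun u => ∑ i, (P i).eval s * (Q i).eval u :=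
    Filter.eventuallyEq_of_mem hs fun u hu => hP s hsS u hu
  have h3 : (fun u => F u u) =ᶠ[nhds s] fun u => ∑ i, (P i).eval u * (Q i).eval u :=
    Filter.eventuallyEq_of_mem hs fun u hu => hP u hu u hu
  have d1 := (HasDerivAt.fun_sum (u := Finset.univ) fun i _ =>
    ((P i).hasDerivAt s).mul_const ((Q i).eval s)).congr_of_eventuallyEq h1
  have d2 := (HasDerivAt.fun_sum (u := Finset.univ) fun i _ =>
    ((Q i).hasDerivAt s).const_mul ((P i).eval s)).congr_of_eventuallyEq h2
  have d3 := (HasDerivAt.fun_sum (u := Finset.univ) fun i _ =>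
    ((P i).hasDerivAt s).mul ((Q i).hasDerivAt s)).congr_of_eventuallyEq h3
  rw [d1.deriv, d2.deriv, ← Finset.sum_add_distrib]
  exact d3

end Polynomial

/-! ### Polynomial mixtures of measures -/

/-- On `S` the family is a mixture of finitely many fixed laws, with weights that are polynomials
in the parameter. -/
def PolynomialMixture (S : Set ℝ) (a : ℝ → Measure EReal) : Prop :=
  ∃ (ι : Type) (_ : Fintype ι) (p : ι → Polynomial ℝ) (ν : ι → Measure EReal),
    (∀ i, IsProbabilityMeasure (ν i)) ∧ (∀ i, ∀ s ∈ S, 0 ≤ (p i).eval s) ∧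
      ∀ s ∈ S, a s = ∑ i, ENNReal.ofReal ((p i).eval s) • ν i

section Mixture

variable {S : Set ℝ} {a b : ℝ → Measure EReal}

lemma PolynomialMixture.congr (ha : PolynomialMixture S a) (h : ∀ s ∈ S, b s = a s) :
    PolynomialMixture S b :=
  let ⟨ι, i, p, ν, h1, h2, h3⟩ := ha
  ⟨ι, i, p, ν, h1, h2, fun s hs => (h s hs).trans (h3 s hs)⟩

lemma polynomialMixture_const (a : Measure EReal) [IsProbabilityMeasure a] :
    PolynomialMixture S fun _ => a :=
  ⟨Unit, inferInstance, fun _ => 1, fun _ => a, fun _ => inferInstance, fun _ s _ => by simp,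
    fun s _ => by simp⟩

lemma polynomialMixture_zero : PolynomialMixture S fun _ => 0 :=
  ⟨Empty, inferInstance, fun _ => 1, fun _ => 0, fun i => i.elim, fun i => i.elim,
    fun s _ => by simp⟩

lemma PolynomialMixture.add (ha : PolynomialMixture S a) (hb : PolynomialMixture S b) :
    PolynomialMixture S fun s => a s + b s :=
  let ⟨ι, _, p, ν, h1, h2, h3⟩ := ha
  let ⟨κ, _, q, μ, k1, k2, k3⟩ := hb
  ⟨ι ⊕ κ, inferInstance, Sum.elim p q, Sum.elim ν μ, Sum.rec h1 k1, Sum.rec h2 k2,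
    fun s hs => by beta_reduce; rw [h3 s hs, k3 s hs]; simp⟩

lemma PolynomialMixture.smul {c : ℝ≥0∞} (hc : c ≠ ∞) (ha : PolynomialMixture S a) :
    PolynomialMixture S fun s => c • a s :=
  let ⟨ι, i, p, ν, h1, h2, h3⟩ := ha
  ⟨ι, i, fun i => Polynomial.C c.toReal * p i, ν, h1,
    fun i s hs => by
      rw [Polynomial.eval_mul, Polynomial.eval_C]
      exact mul_nonneg ENNReal.toReal_nonneg (h2 i s hs),
    fun s hs => by
      beta_reduce; rw [h3 s hs, Finset.smul_sum]
      refine Finset.sum_congr rfl fun i _ => ?_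
      rw [Polynomial.eval_mul, Polynomial.eval_C, ENNReal.ofReal_mul ENNReal.toReal_nonneg,
        ENNReal.ofReal_toReal hc, smul_smul]⟩

lemma PolynomialMixture.sum {κ : Type*} {A : Finset κ} {a : κ → ℝ → Measure EReal}
    (ha : ∀ k ∈ A, PolynomialMixture S (a k)) : PolynomialMixture S fun s => ∑ k ∈ A, a k s := by
  classical
  induction A using Finset.induction_on with
  | empty => exact polynomialMixture_zero.congr fun s _ => by simp
  | insert k A hk ih =>
    exact ((ha k (by simp)).add (ih fun j hj => ha j (by simp [hj]))).congr fun s _ => by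
      rw [Finset.sum_insert hk]

lemma PolynomialMixture.average {w : ℕ} (hw : 1 ≤ w) {a : ℕ → ℝ → Measure EReal}
    (ha : ∀ k < w, PolynomialMixture S (a k)) :
    PolynomialMixture S fun s => average w fun k => a k s :=
  (PolynomialMixture.sum fun k hk => ha k (Finset.mem_range.1 hk)).smul
    (ENNReal.inv_ne_top.2 (by simp; omega))

lemma PolynomialMixture.map_prod {φ : EReal × EReal → EReal} (hφ : Measurable φ)
    (ha : PolynomialMixture S a) (hb : PolynomialMixture S b) :
    PolynomialMixture S fun s => ((a s).prod (b s)).map φ := by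
  obtain ⟨ι, _, p, ν, h1, h2, h3⟩ := ha
  obtain ⟨κ, _, q, μ, k1, k2, k3⟩ := hb
  refine ⟨ι × κ, inferInstance, fun i => p i.1 * q i.2, fun i => ((ν i.1).prod (μ i.2)).map φ,
    fun i => Measure.isProbabilityMeasure_map hφ.aemeasurable,
    fun i s hs => ?_, fun s hs => ?_⟩
  · rw [Polynomial.eval_mul]
    exact mul_nonneg (h2 _ s hs) (k2 _ s hs)
  · beta_reduce
    rw [h3 s hs, k3 s hs, ← Measure.sum_fintype, ← Measure.sum_fintype, Measure.prod_sum,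
      Measure.map_sum hφ.aemeasurable, Measure.sum_fintype]
    refine Finset.sum_congr rfl fun i _ => ?_
    rw [Measure.prod_smul_left, Measure.prod_smul_right, Measure.map_smul, Measure.map_smul,
      smul_smul, Polynomial.eval_mul, ENNReal.ofReal_mul (h2 _ s hs)]

lemma PolynomialMixture.of_affine {p q : ℝ} (hpq : p < q) [IsProbabilityMeasure (a p)]
    [IsProbabilityMeasure (a q)]
    (h : ∀ u ∈ Icc (0 : ℝ) 1, a ((1 - u) * p + u * q) =
      ENNReal.ofReal (1 - u) • a p + ENNReal.ofReal u • a q) :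
    PolynomialMixture (Icc p q) a := by
  have hd : 0 < q - p := sub_pos.2 hpq
  refine ⟨Bool, inferInstance,
    fun i => if i then Polynomial.C (q - p)⁻¹ * (Polynomial.X - Polynomial.C p)
      else Polynomial.C (q - p)⁻¹ * (Polynomial.C q - Polynomial.X),
    fun i => if i then a q else a p, ?_, ?_, ?_⟩
  · rintro (_ | _) <;> simpa
  · rintro (_ | _) s hs
    · simpa using mul_nonneg (inv_pos.2 hd).le (sub_nonneg.2 hs.2)
    · simpa using mul_nonneg (inv_pos.2 hd).le (sub_nonneg.2 hs.1)
  · intro s hs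
    have h1 := h ((s - p) / (q - p)) ⟨div_nonneg (sub_nonneg.2 hs.1) hd.le,
      (div_le_one hd).2 (by linarith [hs.2])⟩
    have e1 : 1 - (s - p) / (q - p) = (q - p)⁻¹ * (q - s) := by field_simp; ring
    have e2 : (s - p) / (q - p) = (q - p)⁻¹ * (s - p) := by field_simp
    have e3 : (1 - (s - p) / (q - p)) * p + (s - p) / (q - p) * q = s := by field_simp; ring
    rw [e3, e1, e2] at h1
    rw [h1, Fintype.sum_bool, add_comm]
    simp

/-- Moments are linear in the law, so the polynomial weights are the same for every n. A series over
n of moments is therefore a polynomial again, with no differentiation under an infinite sum. -/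
lemma PolynomialMixture.exists_softMoment (ha : PolynomialMixture S a) :
    ∃ (ι : Type) (_ : Fintype ι) (p : ι → Polynomial ℝ) (m : ι → ℕ → ℝ),
      (∀ i n, |m i n| ≤ 1) ∧ ∀ s ∈ S, ∀ n, softMoment (a s) n = ∑ i, (p i).eval s * m i n := by
  obtain ⟨ι, _, p, ν, h1, h2, h3⟩ := ha
  refine ⟨ι, inferInstance, p, fun i => softMoment (ν i), fun i n => ?_, fun s hs n => ?_⟩
  · rw [abs_of_nonneg (softMoment_nonneg _ _)]
    exact softMoment_le_one _ _
  · rw [softMoment, h3 s hs, integral_finsetSum_measure fun i _ =>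
      (integrable_softBit_pow (ν i) _).smul_measure ENNReal.ofReal_ne_top]
    refine Finset.sum_congr rfl fun i _ => ?_
    rw [integral_smul_measure, ENNReal.toReal_ofReal (h2 i s hs), smul_eq_mul]
    rfl

/-- A weighted sum of the even moments. -/
noncomputable def weightedMoment (ε : ℕ → ℝ) (a : Measure EReal) : ℝ :=
  ∑' n, entropyCoeff n * (ε n * softMoment a n)

lemma PolynomialMixture.weightedMoment (ha : PolynomialMixture S a) {ε : ℕ → ℝ}
    (hε : ∀ n, |ε n| ≤ 1) : PolynomialOn S fun s => weightedMoment ε (a s) := by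
  obtain ⟨ι, _, p, m, h1, h2⟩ := ha.exists_softMoment
  refine ⟨∑ i, p i * Polynomial.C (∑' n, entropyCoeff n * (ε n * m i n)), fun s hs => ?_⟩
  have e : ∀ n, entropyCoeff n * (ε n * softMoment (a s) n) =
      ∑ i, (p i).eval s * (entropyCoeff n * (ε n * m i n)) := fun n => by
    rw [h2 s hs n, Finset.mul_sum, Finset.mul_sum]
    exact Finset.sum_congr rfl fun i _ => by ring
  have hs : ∀ i, Summable fun n => entropyCoeff n * (ε n * m i n) := fun i =>
    summable_entropyCoeff_mul fun n => by
      rw [abs_mul]; exact mul_le_one₀ (hε n) (abs_nonneg _) (h1 i n)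
  simp_rw [CoupledDE.weightedMoment, e]
  rw [Summable.tsum_finsetSum fun i _ => (hs i).mul_left _, Polynomial.eval_finsetSum]
  simp_rw [tsum_mul_left, Polynomial.eval_mul, Polynomial.eval_C]

lemma PolynomialMixture.crossMoment (ha : PolynomialMixture S a) (hb : PolynomialMixture S b) :
    BipolynomialOn S fun s t =>
      ∑' n, entropyCoeff n * (softMoment (a s) n * softMoment (b t) n) := by
  obtain ⟨ι, _, p, m, h1, h2⟩ := ha.exists_softMoment
  obtain ⟨κ, _, q, m', k1, k2⟩ := hb.exists_softMoment
  refine ⟨ι × κ, inferInstance, fun i => p i.1 *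
    Polynomial.C (∑' n, entropyCoeff n * (m i.1 n * m' i.2 n)), fun i => q i.2,
    fun s hs t ht => ?_⟩
  have e : ∀ n, entropyCoeff n * (softMoment (a s) n * softMoment (b t) n) =
      ∑ i : ι × κ, ((p i.1).eval s * (q i.2).eval t) * (entropyCoeff n * (m i.1 n * m' i.2 n)) :=
    fun n => by
      rw [h2 s hs n, k2 t ht n, Finset.sum_mul_sum, ← Finset.sum_product', Finset.mul_sum]
      exact Finset.sum_congr rfl fun i _ => by ring
  have hs : ∀ i : ι × κ, Summable fun n => entropyCoeff n * (m i.1 n * m' i.2 n) := fun i =>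
    summable_entropyCoeff_mul fun n => by
      rw [abs_mul]; exact mul_le_one₀ (h1 _ n) (abs_nonneg _) (k1 _ n)
  simp_rw [e]
  rw [Summable.tsum_finsetSum fun i _ => (hs i).mul_left _]
  simp_rw [tsum_mul_left, Polynomial.eval_mul, Polynomial.eval_C]
  exact Finset.sum_congr rfl fun i _ => by ring

end Mixture

/-! ### Smooth families of symmetric laws -/

/-- A family of symmetric laws which on `S` is a polynomial mixture. -/
structure SmoothFamily (S : Set ℝ) (a : ℝ → Measure EReal) : Prop where
  mixture : PolynomialMixture S a
  symmetricLaw : ∀ s ∈ S, SymmetricLaw (a s)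

section Smooth

variable {S : Set ℝ} {a b : ℝ → Measure EReal}

lemma SymmetricLaw.smoothFamily_const {a : Measure EReal} (ha : SymmetricLaw a) :
    SmoothFamily S fun _ => a :=
  have := ha.prob
  ⟨polynomialMixture_const a, fun _ _ => ha⟩

lemma SmoothFamily.varConv (ha : SmoothFamily S a) (hb : SmoothFamily S b) :
    SmoothFamily S fun s => varConv (a s) (b s) :=
  ⟨ha.mixture.map_prod (φ := fun p => p.1 + p.2) (measurable_fst.add measurable_snd) hb.mixture,
    fun s hs => (ha.symmetricLaw s hs).varConv (hb.symmetricLaw s hs)⟩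

lemma SmoothFamily.checkConv (ha : SmoothFamily S a) (hb : SmoothFamily S b) :
    SmoothFamily S fun s => checkConv (a s) (b s) :=
  ⟨ha.mixture.map_prod measurable_boxPlus hb.mixture,
    fun s hs => (ha.symmetricLaw s hs).checkConv (hb.symmetricLaw s hs)⟩

lemma SmoothFamily.varPow (ha : SmoothFamily S a) (n : ℕ) :
    SmoothFamily S fun s => varPow (a s) n := by
  induction n with
  | zero => exact symmetricLaw_dirac_zero.smoothFamily_const
  | succ n ih => exact ih.varConv ha

lemma SmoothFamily.checkPow (ha : SmoothFamily S a) (n : ℕ) :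
    SmoothFamily S fun s => checkPow (a s) n := by
  induction n with
  | zero => exact symmetricLaw_deltaTop.smoothFamily_const
  | succ n ih => exact ih.checkConv ha

lemma SmoothFamily.average {w : ℕ} (hw : 1 ≤ w) {a : ℕ → ℝ → Measure EReal}
    (ha : ∀ k < w, SmoothFamily S (a k)) : SmoothFamily S fun s => average w fun k => a k s :=
  ⟨.average hw fun k hk => (ha k hk).mixture,
    fun s hs => .average hw fun k hk => (ha k hk).symmetricLaw s hs⟩

lemma SymmetricLaw.summable_moment_mul {a b : Measure EReal} (ha : SymmetricLaw a)
    (hb : SymmetricLaw b) :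
    Summable fun n => entropyCoeff n * (softMoment a n * softMoment b n) := by
  have := ha.prob
  have := hb.prob
  refine summable_entropyCoeff_mul fun n => ?_
  rw [abs_of_nonneg (mul_nonneg (softMoment_nonneg _ _) (softMoment_nonneg _ _))]
  exact mul_le_one₀ (softMoment_le_one _ _) (softMoment_nonneg _ _) (softMoment_le_one _ _)

lemma SmoothFamily.bipolynomialOn_checkConv (ha : SmoothFamily S a) (hb : SmoothFamily S b) :
    BipolynomialOn S fun s t => entropy (CoupledDE.checkConv (a s) (b t)) := by
  refine ((polynomialOn_const 1).bipolynomialOn_left.sub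
    (ha.mixture.crossMoment hb.mixture)).congr fun s hs t ht => ?_
  have h := ((ha.symmetricLaw s hs).summable_moment_mul (hb.symmetricLaw t ht)).hasSum
  refine ((ha.symmetricLaw s hs).hasSum_entropy_checkConv (hb.symmetricLaw t ht)).unique ?_
  exact (hasSum_entropyCoeff.sub h).congr_fun fun n => by ring

/-- Reduced to the two-variable case by checking against Δ_{+∞}, whose moments are all 1. -/
lemma SmoothFamily.polynomialOn_entropy (ha : SmoothFamily S a) :
    PolynomialOn S fun s => entropy (a s) := by
  refine (ha.bipolynomialOn_checkConv (symmetricLaw_deltaTop.smoothFamily_const)).diag.congr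
    fun s hs => ?_
  have h := ha.symmetricLaw s hs
  have := h.prob
  have := symmetricLaw_deltaTop.prob
  refine h.entropy_congr (h.checkConv symmetricLaw_deltaTop) fun n => ?_
  rw [softMoment_checkConv, softMoment_deltaTop, mul_one]

lemma SmoothFamily.bipolynomialOn_varConv (ha : SmoothFamily S a) (hb : SmoothFamily S b) :
    BipolynomialOn S fun s t => entropy (CoupledDE.varConv (a s) (b t)) :=
  ((ha.polynomialOn_entropy.bipolynomialOn_left.add
    hb.polynomialOn_entropy.bipolynomialOn_right).sub
    (ha.bipolynomialOn_checkConv hb)).congr fun s hs t ht =>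
      (ha.symmetricLaw s hs).entropy_varConv (hb.symmetricLaw t ht)

lemma checkConv_comm (a b : Measure EReal) [SFinite a] [SFinite b] :
    checkConv a b = checkConv b a := by
  refine Measure.ext_of_lintegral _ fun f hf => ?_
  rw [lintegral_checkConv _ _ hf, lintegral_checkConv _ _ hf,
    lintegral_lintegral_swap (f := fun y z => f (boxPlus y z))
      (hf.comp measurable_boxPlus).aemeasurable]
  refine lintegral_congr fun z => lintegral_congr fun y => ?_
  rw [boxPlus_comm]

lemma checkConv_assoc (a b c : Measure EReal) [IsProbabilityMeasure a] [IsProbabilityMeasure b]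
    [IsProbabilityMeasure c] :
    checkConv (checkConv a b) c = checkConv a (checkConv b c) := by
  have := isProbabilityMeasure_checkConv b c
  refine Measure.ext_of_lintegral _ fun f hf => ?_
  have hf2 : Measurable fun p : EReal × EReal => f (boxPlus p.1 p.2) := hf.comp measurable_boxPlus
  rw [lintegral_checkConv _ _ hf, lintegral_checkConv _ _ hf,
    lintegral_checkConv _ _ hf2.lintegral_prod_right']
  refine lintegral_congr fun x => ?_
  rw [lintegral_checkConv b c (f := fun z => f (boxPlus x z)) (hf2.comp measurable_prodMk_left)]
  simp_rw [boxPlus_assoc]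

/-- The abstract product rule: the derivative of `Z ∗ y ^ n` for a commutative convolution. -/
lemma hasDerivAt_entropy_pow {op : Measure EReal → Measure EReal → Measure EReal}
    {pw : Measure EReal → ℕ → Measure EReal} {e : Measure EReal} (he : SymmetricLaw e)
    (pw_zero : ∀ y, pw y 0 = e) (pw_succ : ∀ y n, pw y (n + 1) = op (pw y n) y)
    (op_comm : ∀ a b, SymmetricLaw a → SymmetricLaw b → op a b = op b a)
    (op_assoc : ∀ a b c, SymmetricLaw a → SymmetricLaw b → SymmetricLaw c →
      op (op a b) c = op a (op b c))
    (op_smooth : ∀ a b, SmoothFamily S a → SmoothFamily S b →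
      SmoothFamily S fun s => op (a s) (b s))
    (op_bipolynomial : ∀ a b, SmoothFamily S a → SmoothFamily S b →
      BipolynomialOn S fun s t => entropy (op (a s) (b t)))
    {y : ℝ → Measure EReal} (hy : SmoothFamily S y) {s : ℝ} (hs : S ∈ nhds s) (k : ℕ) :
    ∀ Z : ℝ → Measure EReal, SmoothFamily S Z →
      HasDerivAt (fun u => entropy (op (Z u) (pw (y u) (k + 1))))
        (deriv (fun u => entropy (op (Z u) (pw (y s) (k + 1)))) s +
          (k + 1) * deriv (fun u => entropy (op (op (Z s) (pw (y s) k)) (y u))) s) s := by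
  have hsS := mem_of_mem_nhds hs
  have hys := hy.symmetricLaw s hsS
  have op_symm : ∀ a b, SymmetricLaw a → SymmetricLaw b → SymmetricLaw (op a b) :=
    fun a b ha hb => (op_smooth _ _ ha.smoothFamily_const hb.smoothFamily_const).symmetricLaw s hsS
  have pw_symm : ∀ k, SymmetricLaw (pw (y s) k) := by
    intro k
    induction k with
    | zero => rw [pw_zero]; exact he
    | succ k ih => rw [pw_succ]; exact op_symm _ _ ih hys
  induction k with
  | zero =>
    intro Z hZ
    have hZs := hZ.symmetricLaw s hsS
    have h := (op_bipolynomial Z (fun u => op e (y u)) hZ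
      (op_smooth _ _ he.smoothFamily_const hy)).hasDerivAt_diag hs
    simp only [pw_succ, pw_zero, Nat.cast_zero, zero_add, one_mul]
    convert! h using 2
    refine Filter.EventuallyEq.deriv_eq (Filter.eventuallyEq_of_mem hs fun u hu => ?_)
    simp only [op_assoc _ _ _ hZs he (hy.symmetricLaw u hu)]
  | succ k ih =>
    intro Z hZ
    have hZs := hZ.symmetricLaw s hsS
    have hW := pw_symm (k + 1)
    -- One factor y(u) is moved into the free family, which is why the induction quantifies over
    -- `Z`. The two-variable diagonal rule then separates the derivative of that factor from the
    -- derivative of Z.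
    have h := ih (fun u => op (Z u) (y u)) (op_smooth _ _ hZ hy)
    have hd := (op_bipolynomial Z (fun u => op (y u) (pw (y s) (k + 1))) hZ
      (op_smooth _ _ hy hW.smoothFamily_const)).hasDerivAt_diag hs
    have pw_symm' : ∀ u ∈ S, ∀ k, SymmetricLaw (pw (y u) k) := by
      intro u hu k
      induction k with
      | zero => rw [pw_zero]; exact he
      | succ k ih => rw [pw_succ]; exact op_symm _ _ ih (hy.symmetricLaw u hu)
    have e1 : (fun u => entropy (op (Z u) (pw (y u) (k + 1 + 1)))) =ᶠ[nhds s]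
        fun u => entropy (op (op (Z u) (y u)) (pw (y u) (k + 1))) :=
      Filter.eventuallyEq_of_mem hs fun u hu => by
        have hyu := hy.symmetricLaw u hu
        rw [pw_succ _ (k + 1), op_comm _ _ (pw_symm' u hu _) hyu,
          op_assoc _ _ _ (hZ.symmetricLaw u hu) hyu (pw_symm' u hu _)]
    have e2 : (fun u => entropy (op (op (Z u) (y u)) (pw (y s) (k + 1)))) =ᶠ[nhds s]
        fun u => entropy (op (Z u) (op (y u) (pw (y s) (k + 1)))) :=
      Filter.eventuallyEq_of_mem hs fun u hu => by
        simp only [op_assoc _ _ _ (hZ.symmetricLaw u hu) (hy.symmetricLaw u hu) hW]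
    have e3 : (fun u => entropy (op (Z s) (op (y u) (pw (y s) (k + 1))))) =ᶠ[nhds s]
        fun u => entropy (op (op (Z s) (pw (y s) (k + 1))) (y u)) :=
      Filter.eventuallyEq_of_mem hs fun u hu => by
        rw [op_comm _ _ (hy.symmetricLaw u hu) hW, op_assoc _ _ _ hZs hW (hy.symmetricLaw u hu)]
    have e4 : op (op (Z s) (y s)) (pw (y s) k) = op (Z s) (pw (y s) (k + 1)) := by
      rw [op_assoc _ _ _ hZs hys (pw_symm k), op_comm _ _ hys (pw_symm k), ← pw_succ]
    refine HasDerivAt.congr_of_eventuallyEq ?_ e1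
    convert! h using 1
    rw [e2.deriv_eq, hd.deriv, e3.deriv_eq, e4, op_comm _ _ hys hW, ← pw_succ]
    push_cast; ring

lemma SmoothFamily.hasDerivAt_entropy_varPow (ha : SmoothFamily S a) (hb : SmoothFamily S b)
    {s : ℝ} (hs : S ∈ nhds s) (k : ℕ) :
    HasDerivAt (fun u => entropy (CoupledDE.varConv (a u) (CoupledDE.varPow (b u) (k + 1))))
      (deriv (fun u => entropy (CoupledDE.varConv (a u) (CoupledDE.varPow (b s) (k + 1)))) s +
        (k + 1) * deriv (fun u => entropy (CoupledDE.varConv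
          (CoupledDE.varConv (a s) (CoupledDE.varPow (b s) k)) (b u))) s) s :=
  hasDerivAt_entropy_pow symmetricLaw_dirac_zero (fun _ => rfl) (fun _ _ => rfl)
    (fun a b ha hb => by
      have := ha.prob
      have := hb.prob
      exact Measure.conv_comm a b)
    (fun a b c ha hb hc => by
      have := ha.prob
      have := hb.prob
      have := hc.prob
      exact Measure.conv_assoc a b c)
    (fun _ _ ha hb => ha.varConv hb) (fun _ _ ha hb => ha.bipolynomialOn_varConv hb) hb hs k a ha

lemma SmoothFamily.hasDerivAt_entropy_checkPow (ha : SmoothFamily S a) {s : ℝ} (hs : S ∈ nhds s)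
    (k : ℕ) :
    HasDerivAt (fun u => entropy (CoupledDE.checkPow (a u) (k + 1)))
      ((k + 1) * deriv (fun u => entropy (CoupledDE.checkConv (a u) (CoupledDE.checkPow (a s) k)))
        s) s := by
  have hΔ := symmetricLaw_deltaTop
  have unit : ∀ {c : Measure EReal}, SymmetricLaw c → ∀ n,
      softMoment (CoupledDE.checkConv deltaTop c) n = softMoment c n := fun {c} hc n => by
    have := hc.prob
    have := hΔ.prob
    rw [softMoment_checkConv, softMoment_deltaTop, one_mul]
  have h := hasDerivAt_entropy_pow (S := S) (op := CoupledDE.checkConv) symmetricLaw_deltaTop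
    (pw := CoupledDE.checkPow)
    (fun _ => rfl) (fun _ _ => rfl)
    (fun a b ha hb => by
      have := ha.prob
      have := hb.prob
      exact checkConv_comm a b)
    (fun a b c ha hb hc => by
      have := ha.prob
      have := hb.prob
      have := hc.prob
      exact checkConv_assoc a b c)
    (fun _ _ ha hb => ha.checkConv hb) (fun _ _ ha hb => ha.bipolynomialOn_checkConv hb) ha hs k
    (fun _ => deltaTop) hΔ.smoothFamily_const
  rw [deriv_const, zero_add] at h
  have hsS := mem_of_mem_nhds hs
  have hP := (ha.symmetricLaw s hsS).checkPow k
  have e1 : (fun u => entropy (CoupledDE.checkPow (a u) (k + 1))) =ᶠ[nhds s]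
      fun u => entropy (CoupledDE.checkConv deltaTop (CoupledDE.checkPow (a u) (k + 1))) :=
    Filter.eventuallyEq_of_mem hs fun u hu => by
      have := (ha.symmetricLaw u hu).checkPow (k + 1)
      exact this.entropy_congr (hΔ.checkConv this) fun n => (unit this n).symm
  have e2 : (fun u => entropy (CoupledDE.checkConv (CoupledDE.checkConv deltaTop
      (CoupledDE.checkPow (a s) k)) (a u))) =ᶠ[nhds s]
      fun u => entropy (CoupledDE.checkConv (a u) (CoupledDE.checkPow (a s) k)) :=
    Filter.eventuallyEq_of_mem hs fun u hu => by
      have hu := ha.symmetricLaw u hu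
      have := hu.prob
      have := hΔ.prob
      have := hP.prob
      have := (hΔ.checkConv hP).prob
      refine ((hΔ.checkConv hP).checkConv hu).entropy_congr (hu.checkConv hP) fun n => ?_
      rw [softMoment_checkConv, unit hP, softMoment_checkConv, mul_comm]
  rw [e2.deriv_eq] at h
  exact h.congr_of_eventuallyEq e1

end Smooth

/-! ### The Bethe functional of the coupled system -/

/-- The density entering the check nodes at position `m`. -/
noncomputable def checkInput (w : ℕ) (x : ℤ → Measure EReal) (m : ℤ) : Measure EReal :=
  average w fun k => x (m - (k : ℤ))

lemma checkMessage_eq (r w : ℕ) (x : ℤ → Measure EReal) (i : ℤ) :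
    checkMessage r w x i = average w fun j => checkPow (checkInput w x (i + (j : ℤ))) (r - 1) := rfl

/-- The contribution `H(X) - H(X ^ {⊠ r}) / r` of a check node. -/
noncomputable def checkTerm (r : ℕ) (a : Measure EReal) : ℝ :=
  entropy a - entropy (checkPow a r) / r

/-- The Bethe functional of the channel `c` and the constellation `x`. -/
noncomputable def bethe (l r L w : ℕ) (c : Measure EReal) (x : ℤ → Measure EReal) : ℝ :=
  ∑ i ∈ Finset.Icc (-(L : ℤ)) L, (entropy (varConv c (gHat l r w x i)) -
    l * entropy (varConv (x i) (checkMessage r w x i))) +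
  l * ∑ m ∈ Finset.Icc (-(L : ℤ)) (L + w - 1), checkTerm r (checkInput w x m)

lemma softMoment_average {w : ℕ} {a : ℕ → Measure EReal}
    (ha : ∀ k < w, IsProbabilityMeasure (a k)) (n : ℕ) :
    softMoment (average w a) n = (w : ℝ)⁻¹ * ∑ k ∈ Finset.range w, softMoment (a k) n := by
  rw [softMoment, average, integral_smul_measure, integral_finsetSum_measure fun k hk => by
    have := ha k (Finset.mem_range.1 hk)
    exact integrable_softBit_pow (a k) _]
  simp [softMoment]

lemma softMoment_checkPow {a : Measure EReal} (ha : SymmetricLaw a) (k n : ℕ) :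
    softMoment (checkPow a k) n = softMoment a n ^ k := by
  induction k with
  | zero => rw [pow_zero]; exact softMoment_deltaTop n
  | succ k ih =>
    have := ha.prob
    have := (ha.checkPow k).prob
    rw [pow_succ, ← ih]
    exact softMoment_checkConv _ _ _

section System

variable {r w : ℕ} {x : ℤ → Measure EReal}

lemma symmetricLaw_checkInput (hw : 1 ≤ w) (hx : ∀ i, SymmetricLaw (x i)) (m : ℤ) :
    SymmetricLaw (checkInput w x m) :=
  .average hw fun _ _ => hx _

lemma softMoment_checkInput (hx : ∀ i, SymmetricLaw (x i)) (m : ℤ) (n : ℕ) :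
    softMoment (checkInput w x m) n =
      (w : ℝ)⁻¹ * ∑ k ∈ Finset.range w, softMoment (x (m - (k : ℤ))) n :=
  softMoment_average (fun _ _ => (hx _).prob) n

lemma softMoment_checkMessage (hw : 1 ≤ w) (hx : ∀ i, SymmetricLaw (x i)) (i : ℤ) (n : ℕ) :
    softMoment (checkMessage r w x i) n =
      (w : ℝ)⁻¹ * ∑ j ∈ Finset.range w, softMoment (checkInput w x (i + (j : ℤ))) n ^ (r - 1) := by
  rw [checkMessage_eq, softMoment_average fun _ _ =>
    ((symmetricLaw_checkInput hw hx _).checkPow _).prob]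
  simp_rw [softMoment_checkPow (symmetricLaw_checkInput hw hx _)]

lemma softMoment_checkMessage_mono (hw : 1 ≤ w) {x' : ℤ → Measure EReal}
    (hx : ∀ i, SymmetricLaw (x i)) (hx' : ∀ i, SymmetricLaw (x' i)) (n : ℕ)
    (h : ∀ i, softMoment (x' i) n ≤ softMoment (x i) n) (i : ℤ) :
    softMoment (checkMessage r w x' i) n ≤ softMoment (checkMessage r w x i) n := by
  rw [softMoment_checkMessage hw hx, softMoment_checkMessage hw hx']
  refine mul_le_mul_of_nonneg_left (Finset.sum_le_sum fun j _ => ?_) (by positivity)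
  refine pow_le_pow_left₀ (softMoment_nonneg _ _) ?_ _
  rw [softMoment_checkInput hx, softMoment_checkInput hx']
  exact mul_le_mul_of_nonneg_left (Finset.sum_le_sum fun k _ => h _) (by positivity)

end System

/-- Forward and backward window averages are adjoint. Because α is supported in [-L, L], only the
check positions -L, …, L + w - 1 contribute. -/
lemma sum_mul_window (L w : ℕ) (α β : ℤ → ℝ) (hα : ∀ i, i ∉ Icc (-(L : ℤ)) L → α i = 0) :
    ∑ i ∈ Finset.Icc (-(L : ℤ)) L, α i * ((w : ℝ)⁻¹ * ∑ j ∈ Finset.range w, β (i + (j : ℤ))) =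
      ∑ m ∈ Finset.Icc (-(L : ℤ)) (L + w - 1),
        ((w : ℝ)⁻¹ * ∑ k ∈ Finset.range w, α (m - (k : ℤ))) * β m := by
  have e1 : ∀ i, α i * ((w : ℝ)⁻¹ * ∑ j ∈ Finset.range w, β (i + (j : ℤ))) =
      ∑ j ∈ Finset.range w, (w : ℝ)⁻¹ * (α i * β (i + (j : ℤ))) := fun i => by
    rw [Finset.mul_sum, Finset.mul_sum]
    exact Finset.sum_congr rfl fun j _ => by ring
  have e2 : ∀ m, ((w : ℝ)⁻¹ * ∑ k ∈ Finset.range w, α (m - (k : ℤ))) * β m =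
      ∑ j ∈ Finset.range w, (w : ℝ)⁻¹ * (α (m - (j : ℤ)) * β m) := fun i => by
    rw [Finset.mul_sum, Finset.sum_mul]
    exact Finset.sum_congr rfl fun j _ => by ring
  simp_rw [e1, e2]
  rw [Finset.sum_comm, Finset.sum_comm (s := Finset.Icc (-(L : ℤ)) (L + w - 1))]
  refine Finset.sum_congr rfl fun j hj => ?_
  have hj := Finset.mem_range.1 hj
  rw [← Finset.mul_sum, ← Finset.mul_sum]
  congr 1
  refine Finset.sum_bij_ne_zero (fun i _ _ => i + (j : ℤ)) ?_ ?_ ?_ ?_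
  · intro i hi _
    rw [Finset.mem_Icc] at hi ⊢
    omega
  · intro i _ _ i' _ _ h
    simpa using h
  · intro m _ hm
    refine ⟨m - j, ?_, ?_, by ring⟩
    · by_contra hmem
      rw [Finset.mem_Icc] at hmem
      exact hm (by rw [hα _ (by simpa [mem_Icc] using hmem), zero_mul])
    · simpa using hm
  · intro i _ _
    rw [add_sub_cancel_right]

/-- Both sides count the same edges, once from the variable nodes and once from the check nodes.
Coefficient by coefficient in the moment series this is adjointness of the window averages, applied
to 1 - m_n(x_i); this vanishes outside [-L, L], where x_i = Δ_{+∞}. Keeping `x` and `x'` separate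
permits differentiation in one of them alone. -/
lemma sum_entropy_exchange {r L w : ℕ} (hw : 1 ≤ w) {x x' : ℤ → Measure EReal}
    (hx : ∀ i, SymmetricLaw (x i)) (hx' : ∀ i, SymmetricLaw (x' i))
    (hout : ∀ i, i ∉ Icc (-(L : ℤ)) L → x i = deltaTop) :
    ∑ i ∈ Finset.Icc (-(L : ℤ)) L, entropy (varConv (x i) (checkMessage r w x' i)) =
      ∑ m ∈ Finset.Icc (-(L : ℤ)) (L + w - 1),
        entropy (varConv (checkInput w x m) (checkPow (checkInput w x' m) (r - 1))) := by
  have hw0 : (w : ℝ) ≠ 0 := by positivity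
  have h1 := hasSum_sum (s := Finset.Icc (-(L : ℤ)) L) fun i _ =>
    (hx i).hasSum_entropy_varConv (SymmetricLaw.checkMessage (r := r) hw hx' i)
  have h2 := hasSum_sum (s := Finset.Icc (-(L : ℤ)) (L + w - 1)) fun m _ =>
    (symmetricLaw_checkInput hw hx m).hasSum_entropy_varConv
      ((symmetricLaw_checkInput hw hx' m).checkPow (r - 1))
  refine h1.unique (h2.congr_fun fun n => ?_)
  rw [← Finset.mul_sum, ← Finset.mul_sum]
  congr 1
  have hs := sum_mul_window L w (fun i => 1 - softMoment (x i) n)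
    (fun m => 1 - softMoment (checkInput w x' m) n ^ (r - 1))
    (fun i hi => by rw [hout i hi, softMoment_deltaTop, sub_self])
  have comp : ∀ f : ℕ → ℝ, (w : ℝ)⁻¹ * ∑ k ∈ Finset.range w, (1 - f k) =
      1 - (w : ℝ)⁻¹ * ∑ k ∈ Finset.range w, f k := fun f => by
    rw [Finset.sum_sub_distrib]; simp [mul_sub, hw0]
  simp_rw [comp] at hs
  simp_rw [softMoment_checkMessage hw hx', softMoment_checkInput hx,
    softMoment_checkPow (symmetricLaw_checkInput hw hx' _)]
  exact hs

section Families

variable {S : Set ℝ} {l r L w : ℕ} {c : ℝ → Measure EReal} {x : ℝ → ℤ → Measure EReal}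

lemma SmoothFamily.checkInput (hw : 1 ≤ w) (hx : ∀ i, SmoothFamily S fun s => x s i) (m : ℤ) :
    SmoothFamily S fun s => checkInput w (x s) m :=
  .average hw fun _ _ => hx _

lemma SmoothFamily.checkMessage (hw : 1 ≤ w) (hx : ∀ i, SmoothFamily S fun s => x s i) (i : ℤ) :
    SmoothFamily S fun s => checkMessage r w (x s) i :=
  .average hw fun _ _ => (SmoothFamily.checkInput hw hx _).checkPow _

lemma SmoothFamily.polynomialOn_bethe (hw : 1 ≤ w) (hc : SmoothFamily S c)
    (hx : ∀ i, SmoothFamily S fun s => x s i) :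
    PolynomialOn S fun s => bethe l r L w (c s) (x s) := by
  have hy := fun i => SmoothFamily.checkMessage (r := r) hw hx i
  have hX := fun m => SmoothFamily.checkInput hw hx m
  refine (PolynomialOn.sum fun i _ => ?_).add (PolynomialOn.const_mul _ (.sum fun m _ => ?_))
  · exact ((hc.bipolynomialOn_varConv ((hy i).varPow l)).diag).sub
      (((hx i).bipolynomialOn_varConv (hy i)).diag.const_mul _)
  · exact ((hX m).polynomialOn_entropy.sub (((hX m).checkPow r).polynomialOn_entropy.const_mul
      (r : ℝ)⁻¹)).congr fun s _ => by rw [checkTerm, div_eq_inv_mul]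

/-- The derivative of the Bethe functional is the GEXIT integrand plus a term that measures by how
much the constellation fails to be a fixed point. -/
lemma hasDerivAt_bethe (hl : 1 ≤ l) (hr : 1 ≤ r) (hw : 1 ≤ w) (hc : SmoothFamily S c)
    (hx : ∀ i, SmoothFamily S fun s => x s i)
    (hout : ∀ s ∈ S, ∀ i, i ∉ Icc (-(L : ℤ)) L → x s i = deltaTop) {s : ℝ} (hs : S ∈ nhds s) :
    HasDerivAt (fun u => bethe l r L w (c u) (x u))
      (∑ i ∈ Finset.Icc (-(L : ℤ)) L, gexit c (fun σ => gHat l r w (x σ) i) s +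
        l * ∑ i ∈ Finset.Icc (-(L : ℤ)) L,
          (deriv (fun u => entropy (varConv (varConv (c s) (g l r w (x s) i))
            (checkMessage r w (x u) i))) s -
          deriv (fun u => entropy (varConv (x s i) (checkMessage r w (x u) i))) s)) s := by
  obtain ⟨l, rfl⟩ : ∃ k, l = k + 1 := ⟨l - 1, by omega⟩
  obtain ⟨r, rfl⟩ : ∃ k, r = k + 1 := ⟨r - 1, by omega⟩
  have hsS := mem_of_mem_nhds hs
  have hxs : ∀ s ∈ S, ∀ i, SymmetricLaw (x s i) := fun s hs i => (hx i).symmetricLaw s hs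
  have hy := fun i => SmoothFamily.checkMessage (r := r + 1) hw hx i
  have hX := fun m => SmoothFamily.checkInput hw hx m
  have hr0 : ((r : ℝ) + 1) ≠ 0 := by positivity
  have dsite : ∀ i, HasDerivAt (fun u => entropy (varConv (c u) (gHat (l + 1) (r + 1) w (x u) i)) -
      ((l + 1 : ℕ) : ℝ) * entropy (varConv (x u i) (checkMessage (r + 1) w (x u) i))) _ s :=
    fun i => (hc.hasDerivAt_entropy_varPow (hy i) hs l).sub
      ((((hx i).bipolynomialOn_varConv (hy i)).hasDerivAt_diag hs).const_mul _)
  have dcheck : ∀ m, HasDerivAt (fun u => checkTerm (r + 1) (checkInput w (x u) m)) _ s :=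
    fun m => ((hX m).polynomialOn_entropy.differentiableAt hs).hasDerivAt.sub
      (((hX m).hasDerivAt_entropy_checkPow hs r).div_const ((r + 1 : ℕ) : ℝ))
  have dtot := (HasDerivAt.fun_sum (u := Finset.Icc (-(L : ℤ)) L) fun i _ => dsite i).add
    ((HasDerivAt.fun_sum (u := Finset.Icc (-(L : ℤ)) (L + w - 1)) fun m _ => dcheck m).const_mul
      ((l + 1 : ℕ) : ℝ))
  refine dtot.congr_deriv ?_
  have dleft : ∀ i, DifferentiableAt ℝ (fun u => entropy (varConv (x u i)
      (checkMessage (r + 1) w (x s) i))) s := fun i =>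
    (((hx i).bipolynomialOn_varConv (hy i)).left hsS).differentiableAt hs
  have dbox : ∀ m, DifferentiableAt ℝ (fun u => entropy (checkConv (checkInput w (x u) m)
      (checkPow (checkInput w (x s) m) r))) s := fun m =>
    (((hX m).bipolynomialOn_checkConv ((hX m).checkPow r)).left hsS).differentiableAt hs
  -- The edge exchange with the messages frozen at s, differentiated in u. After duality, the
  -- right-hand side is exactly the derivative of the check terms.
  have exch : ∑ i ∈ Finset.Icc (-(L : ℤ)) L,
      deriv (fun u => entropy (varConv (x u i) (checkMessage (r + 1) w (x s) i))) s =
      ∑ m ∈ Finset.Icc (-(L : ℤ)) (L + w - 1), (deriv (fun u => entropy (checkInput w (x u) m)) s -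
        deriv (fun u => entropy (checkConv (checkInput w (x u) m)
          (checkPow (checkInput w (x s) m) r))) s) := by
    rw [← deriv_fun_sum fun i _ => dleft i]
    have he : (fun u => ∑ i ∈ Finset.Icc (-(L : ℤ)) L,
        entropy (varConv (x u i) (checkMessage (r + 1) w (x s) i))) =ᶠ[nhds s]
        fun u => ∑ m ∈ Finset.Icc (-(L : ℤ)) (L + w - 1), (entropy (checkInput w (x u) m) +
          entropy (checkPow (checkInput w (x s) m) r) -
          entropy (checkConv (checkInput w (x u) m) (checkPow (checkInput w (x s) m) r))) :=
      Filter.eventuallyEq_of_mem hs fun u hu => by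
        refine (sum_entropy_exchange hw (hxs u hu) (hxs s hsS) (hout u hu)).trans ?_
        exact Finset.sum_congr rfl fun m _ => SymmetricLaw.entropy_varConv
          ((hX m).symmetricLaw u hu) (((hX m).symmetricLaw s hsS).checkPow r)
    exact he.deriv_eq.trans (HasDerivAt.fun_sum fun m _ =>
      (((hX m).polynomialOn_entropy.differentiableAt hs).hasDerivAt.add_const _).sub
        (dbox m).hasDerivAt).deriv
  -- The product rule for the check power yields as many equal terms as the check degree, cancelling
  -- the division by that degree in `checkTerm`.
  have canc : ∀ m, ((r : ℝ) + 1) * deriv (fun u => entropy (checkConv (checkInput w (x u) m)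
      (checkPow (checkInput w (x s) m) r))) s / ((r + 1 : ℕ) : ℝ) =
      deriv (fun u => entropy (checkConv (checkInput w (x u) m)
      (checkPow (checkInput w (x s) m) r))) s := fun m => by
    push_cast; field_simp
  simp_rw [canc]
  rw [← exch, Finset.sum_sub_distrib, Finset.sum_add_distrib, ← Finset.mul_sum, ← Finset.mul_sum,
    Finset.sum_add_distrib, Finset.sum_sub_distrib]
  simp only [gexit, gHat, g, Nat.add_sub_cancel, Nat.cast_add, Nat.cast_one]
  ring

end Families

/-! ### The defect of an approximate fixed point -/

/-- The increments of H(A ⊛ y) - H(B ⊛ y) are Σ c_n (m_n(A) - m_n(B)) Δm_n(y), and all Δm_n(y) have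
the same sign. They are thus bounded by decrements of the weighted moment, a bound whose integral
telescopes. -/
lemma abs_deriv_entropy_sub_le {S : Set ℝ} {A B : Measure EReal} {y : ℝ → Measure EReal}
    (hA : SymmetricLaw A) (hB : SymmetricLaw B) (hy : SmoothFamily S y)
    (hanti : ∀ n, AntitoneOn (fun u => softMoment (y u) n) S) {ε : ℕ → ℝ}
    (hAB : ∀ n, |softMoment A n - softMoment B n| ≤ ε n) (hε : ∀ n, ε n ≤ 1) {s : ℝ}
    (hs : S ∈ nhds s) :
    |deriv (fun u => entropy (varConv A (y u))) s - deriv (fun u => entropy (varConv B (y u))) s| ≤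
      -deriv (fun u => weightedMoment ε (y u)) s := by
  have hε' : ∀ n, |ε n| ≤ 1 := fun n => by
    rw [abs_of_nonneg ((abs_nonneg _).trans (hAB n))]; exact hε n
  have hsS := mem_of_mem_nhds hs
  have dA : DifferentiableAt ℝ (fun u => entropy (varConv A (y u))) s :=
    ((hA.smoothFamily_const.bipolynomialOn_varConv hy).right hsS).differentiableAt hs
  have dB : DifferentiableAt ℝ (fun u => entropy (varConv B (y u))) s :=
    ((hB.smoothFamily_const.bipolynomialOn_varConv hy).right hsS).differentiableAt hs
  have dW : DifferentiableAt ℝ (fun u => weightedMoment ε (y u)) s :=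
    (hy.mixture.weightedMoment hε').differentiableAt hs
  have hW : ∀ u ∈ S, HasSum (fun n => entropyCoeff n * (ε n * softMoment (y u) n))
      (weightedMoment ε (y u)) := fun u hu => by
    refine (summable_entropyCoeff_mul fun n => ?_).hasSum
    have := (hy.symmetricLaw u hu).prob
    rw [abs_mul, abs_of_nonneg (softMoment_nonneg (y u) n)]
    exact mul_le_one₀ (hε' n) (softMoment_nonneg _ _) (softMoment_le_one _ _)
  have gap : ∀ v ∈ S, ∀ u ∈ S, v ≤ u →
      |(entropy (varConv A (y u)) - entropy (varConv B (y u))) -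
        (entropy (varConv A (y v)) - entropy (varConv B (y v)))| ≤
      weightedMoment ε (y v) - weightedMoment ε (y u) := by
    intro v hv u hu hvu
    have h1 := ((hA.hasSum_entropy_varConv (hy.symmetricLaw u hu)).sub
      (hB.hasSum_entropy_varConv (hy.symmetricLaw u hu))).sub
      ((hA.hasSum_entropy_varConv (hy.symmetricLaw v hv)).sub
      (hB.hasSum_entropy_varConv (hy.symmetricLaw v hv)))
    have h2 := (hW v hv).sub (hW u hu)
    have main : ∀ n, |(softMoment A n - softMoment B n) *
        (softMoment (y u) n - softMoment (y v) n)| ≤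
        ε n * (softMoment (y v) n - softMoment (y u) n) := fun n => by
      have hn := hanti n hv hu hvu
      simp only at hn
      rw [abs_mul, abs_of_nonpos (sub_nonpos.2 hn), neg_sub]
      exact mul_le_mul_of_nonneg_right (hAB n) (sub_nonneg.2 hn)
    rw [abs_le]
    constructor
    · refine hasSum_le (fun n => ?_) h2.neg h1
      have := mul_le_mul_of_nonneg_left (abs_le.1 (main n)).1 (entropyCoeff_nonneg n)
      linarith
    · refine hasSum_le (fun n => ?_) h1 h2
      have := mul_le_mul_of_nonneg_left (abs_le.1 (main n)).2 (entropyCoeff_nonneg n)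
      linarith
  -- The increment bound says that the weighted moment plus or minus the entropy difference is
  -- antitone; this gives the derivative bound without differentiating the series.
  have nonpos : ∀ f : ℝ → ℝ, AntitoneOn f S → deriv f s ≤ 0 := fun f hf => by
    rw [← derivWithin_of_mem_nhds hs]; exact hf.derivWithin_nonpos
  have n1 := nonpos (fun u => (entropy (varConv A (y u)) - entropy (varConv B (y u))) +
    weightedMoment ε (y u)) (fun v hv u hu hvu => by
      have := (abs_le.1 (gap v hv u hu hvu)).2
      simp only; linarith)
  have n2 := nonpos (fun u => weightedMoment ε (y u) -
    (entropy (varConv A (y u)) - entropy (varConv B (y u)))) (fun v hv u hu hvu => by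
      have := (abs_le.1 (gap v hv u hu hvu)).1
      simp only; linarith)
  have e1 := ((dA.hasDerivAt.sub dB.hasDerivAt).add dW.hasDerivAt).deriv
  have e2 := (dW.hasDerivAt.sub (dA.hasDerivAt.sub dB.hasDerivAt)).deriv
  rw [abs_le]
  constructor
  · linarith [e2.symm.trans_le n2]
  · linarith [e1.symm.trans_le n1]

/-! ### Integration over the parameter interval -/

lemma intervalIntegrable_of_polynomialOn_Ioo {γ : ℝ → ℝ} {p q : ℝ} (hpq : p ≤ q)
    (hγ : PolynomialOn (Ioo p q) γ) : IntervalIntegrable γ volume p q := by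
  obtain ⟨P, hP⟩ := hγ
  have h : IntervalIntegrable (fun s => P.eval s) volume p q := P.continuous.intervalIntegrable _ _
  rw [intervalIntegrable_iff_integrableOn_Ioo_of_le hpq] at h ⊢
  exact h.congr_fun (fun s hs => (hP s hs).symm) measurableSet_Ioo

/-- The fundamental theorem of calculus on one linear piece. The integrand γ is controlled only on
the open interval, since a two-sided derivative at a node also sees the neighbouring piece. -/
lemma abs_increment_sub_integral_le {F γ Ψ : ℝ → ℝ} {p q : ℝ} (hpq : p < q)
    (hF : PolynomialOn (Icc p q) F) (hΨ : PolynomialOn (Icc p q) Ψ)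
    (hγ : PolynomialOn (Ioo p q) γ)
    (h : ∀ s ∈ Ioo p q, |deriv F s - γ s| ≤ -deriv Ψ s) :
    |F q - F p - ∫ s in p..q, γ s| ≤ Ψ p - Ψ q := by
  obtain ⟨P, hP⟩ := hF
  obtain ⟨Q, hQ⟩ := hΨ
  obtain ⟨R, hR⟩ := hγ
  have hp : p ∈ Icc p q := left_mem_Icc.2 hpq.le
  have hq : q ∈ Icc p q := right_mem_Icc.2 hpq.le
  have ftc : ∀ P : Polynomial ℝ, ∫ s in p..q, P.derivative.eval s = P.eval q - P.eval p :=
    fun P => intervalIntegral.integral_eq_sub_of_hasDerivAt (fun s _ => P.hasDerivAt s)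
      (P.derivative.continuous.intervalIntegrable _ _)
  have hderiv : ∀ (f : ℝ → ℝ) (P : Polynomial ℝ), (∀ s ∈ Icc p q, f s = P.eval s) →
      ∀ s ∈ Ioo p q, deriv f s = P.derivative.eval s := fun f P hf s hs => by
    rw [(Filter.eventuallyEq_of_mem (Icc_mem_nhds hs.1 hs.2) hf).deriv_eq, Polynomial.deriv]
  have hint : ∫ s in p..q, γ s = ∫ s in p..q, R.eval s := by
    rw [intervalIntegral.integral_of_le hpq.le, intervalIntegral.integral_of_le hpq.le,
      integral_Ioc_eq_integral_Ioo, integral_Ioc_eq_integral_Ioo]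
    exact setIntegral_congr_fun measurableSet_Ioo hR
  have cP := P.derivative.continuous.intervalIntegrable (μ := volume) p q
  have cR := R.continuous.intervalIntegrable (μ := volume) p q
  have cQ := Q.derivative.continuous.intervalIntegrable (μ := volume) p q
  rw [hP q hq, hP p hp, hQ q hq, hQ p hp, hint, ← ftc P, ← intervalIntegral.integral_sub cP cR]
  calc |∫ s in p..q, (P.derivative.eval s - R.eval s)|
      ≤ ∫ s in p..q, |P.derivative.eval s - R.eval s| :=
        intervalIntegral.abs_integral_le_integral_abs hpq.le
    _ ≤ ∫ s in p..q, -Q.derivative.eval s := by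
        refine intervalIntegral.integral_mono_on_of_le_Ioo hpq.le (cP.sub cR).abs cQ.neg
          fun s hs => ?_
        have := h s hs
        rwa [hderiv F P hP s hs, hderiv Ψ Q hQ s hs, hR s hs] at this
    _ = _ := by rw [intervalIntegral.integral_neg, ftc]; ring

/-- Strong induction on the number of nodes strictly inside the interval: splitting at one of them
removes it from both halves. -/
lemma interval_induction {P : ℝ → ℝ → Prop} (E : Finset ℝ) {s₀ s₁ : ℝ} (hs : s₀ ≤ s₁)
    (refl : ∀ p, P p p)
    (free : ∀ p q, p < q → Icc p q ⊆ Icc s₀ s₁ → (∀ e ∈ E, e ∉ Ioo p q) → P p q)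
    (trans : ∀ p e q, p ≤ e → e ≤ q → P p e → P e q → P p q) : P s₀ s₁ := by
  classical
  suffices H : ∀ n p q, p ≤ q → Icc p q ⊆ Icc s₀ s₁ → (E.filter (· ∈ Ioo p q)).card = n → P p q from
    H _ s₀ s₁ hs Subset.rfl rfl
  intro n
  induction n using Nat.strong_induction_on with
  | _ n ih =>
    intro p q hpq hsub hn
    rcases hpq.eq_or_lt with rfl | hlt
    · exact refl p
    by_cases hE : ∀ e ∈ E, e ∉ Ioo p q
    · exact free p q hlt hsub hE
    push Not at hE
    obtain ⟨e, he, hmem⟩ := hE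
    have he' : e ∈ E.filter (· ∈ Ioo p q) := Finset.mem_filter.2 ⟨he, hmem⟩
    refine trans p e q hmem.1.le hmem.2.le (ih _ ?_ p e hmem.1.le ?_ rfl)
      (ih _ ?_ e q hmem.2.le ?_ rfl)
    · rw [← hn]
      refine Finset.card_lt_card ⟨fun z hz => ?_, fun h => ?_⟩
      · rw [Finset.mem_filter] at hz ⊢
        exact ⟨hz.1, hz.2.1, hz.2.2.trans hmem.2⟩
      · exact lt_irrefl _ (Finset.mem_filter.1 (h he')).2.2
    · exact (Icc_subset_Icc_right hmem.2.le).trans hsub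
    · rw [← hn]
      refine Finset.card_lt_card ⟨fun z hz => ?_, fun h => ?_⟩
      · rw [Finset.mem_filter] at hz ⊢
        exact ⟨hz.1, hmem.1.trans hz.2.1, hz.2.2⟩
      · exact lt_irrefl _ (Finset.mem_filter.1 (h he')).2.1
    · exact (Icc_subset_Icc_left hmem.1.le).trans hsub

/-! ### Piecewise linear families -/

/-- Phrasing linearity on every node-free subinterval, rather than between consecutive nodes, lets
the node sets of several families be merged by a union. -/
lemma PiecewiseLinearFamily.exists_nodes {a : ℝ → Measure EReal} {s₀ s₁ : ℝ}
    (ha : PiecewiseLinearFamily a s₀ s₁) :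
    ∃ E : Finset ℝ, ∀ p q, p < q → Icc p q ⊆ Icc s₀ s₁ → (∀ e ∈ E, e ∉ Ioo p q) →
      ∀ u ∈ Icc (0 : ℝ) 1, a ((1 - u) * p + u * q) =
        ENNReal.ofReal (1 - u) • a p + ENNReal.ofReal u • a q := by
  classical
  obtain ⟨n, t, ht, h0, h1, hlin⟩ := ha
  refine ⟨(Finset.range (n + 1)).image t, fun p q hpq hsub hE u hu => ?_⟩
  have hp := (hsub (left_mem_Icc.2 hpq.le)).1
  have hq := (hsub (right_mem_Icc.2 hpq.le)).2
  -- Here t (k + 1) is the first node beyond p; being outside the open interval (p, q), it lies at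
  -- or beyond q.
  obtain ⟨k, hk, hkp, hkq⟩ : ∃ k < n, t k ≤ p ∧ q ≤ t (k + 1) := by
    have hex : ∃ m, p < t m := ⟨n, by rw [h1]; linarith⟩
    have hm := Nat.find_spec hex
    have hmn : Nat.find hex ≤ n := Nat.find_min' hex (by rw [h1]; linarith)
    have hm0 : Nat.find hex ≠ 0 := fun h => by rw [h, h0] at hm; linarith
    obtain ⟨k, hk⟩ := Nat.exists_eq_succ_of_ne_zero hm0
    refine ⟨k, by omega, not_lt.1 (Nat.find_min hex (by omega)), ?_⟩
    by_contra hlt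
    rw [hk] at hm
    refine hE (t (k + 1)) (Finset.mem_image.2 ⟨k + 1, Finset.mem_range.2 (by omega), rfl⟩)
      ⟨hm, not_le.1 hlt⟩
  have hd : 0 < t (k + 1) - t k := by linarith
  have rep : ∀ z ∈ Icc p q, ∃ v ∈ Icc (0 : ℝ) 1, z = (1 - v) * t k + v * t (k + 1) := fun z hz =>
    ⟨(z - t k) / (t (k + 1) - t k), ⟨div_nonneg (by linarith [hz.1]) hd.le,
      (div_le_one hd).2 (by linarith [hz.2])⟩, by field_simp; ring⟩
  obtain ⟨α, hα, eα⟩ := rep p (left_mem_Icc.2 hpq.le)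
  obtain ⟨β, hβ, eβ⟩ := rep q (right_mem_Icc.2 hpq.le)
  have hv0 : 0 ≤ (1 - u) * α + u * β :=
    add_nonneg (mul_nonneg (sub_nonneg.2 hu.2) hα.1) (mul_nonneg hu.1 hβ.1)
  have hv1 : 0 ≤ (1 - u) * (1 - α) + u * (1 - β) :=
    add_nonneg (mul_nonneg (sub_nonneg.2 hu.2) (sub_nonneg.2 hα.2))
      (mul_nonneg hu.1 (sub_nonneg.2 hβ.2))
  have e : (1 - u) * p + u * q =
      (1 - ((1 - u) * α + u * β)) * t k + ((1 - u) * α + u * β) * t (k + 1) := by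
    rw [eα, eβ]; ring
  have hu1 : 0 ≤ 1 - u := sub_nonneg.2 hu.2
  have e2 : 1 - ((1 - u) * α + u * β) = (1 - u) * (1 - α) + u * (1 - β) := by ring
  rw [e, hlin k hk _ ⟨hv0, by linarith⟩, e2]
  conv_rhs => rw [eα, eβ, hlin k hk α hα, hlin k hk β hβ]
  rw [ENNReal.ofReal_add (mul_nonneg hu1 (sub_nonneg.2 hα.2)) (mul_nonneg hu.1 (sub_nonneg.2 hβ.2)),
    ENNReal.ofReal_add (mul_nonneg hu1 hα.1) (mul_nonneg hu.1 hβ.1), ENNReal.ofReal_mul hu1,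
    ENNReal.ofReal_mul hu1, ENNReal.ofReal_mul hu.1, ENNReal.ofReal_mul hu.1]
  simp only [smul_add, smul_smul, add_smul]
  abel

lemma PiecewiseLinearFamily.exists_smooth_pieces {a : ℝ → Measure EReal} {s₀ s₁ : ℝ}
    (ha : PiecewiseLinearFamily a s₀ s₁) (hsymm : ∀ s ∈ Icc s₀ s₁, SymmetricLaw (a s)) :
    ∃ E : Finset ℝ, ∀ p q, p < q → Icc p q ⊆ Icc s₀ s₁ → (∀ e ∈ E, e ∉ Ioo p q) →
      SmoothFamily (Icc p q) a := by
  obtain ⟨E, hE⟩ := ha.exists_nodes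
  refine ⟨E, fun p q hpq hsub hfree => ⟨?_, fun s hs => hsymm s (hsub hs)⟩⟩
  have := (hsymm p (hsub (left_mem_Icc.2 hpq.le))).prob
  have := (hsymm q (hsub (right_mem_Icc.2 hpq.le))).prob
  exact .of_affine hpq (hE p q hpq hsub hfree)

/-! ### The Bethe functional along the family -/

section Family

variable {l r L w : ℕ} {c : ℝ → Measure EReal} {x : ℝ → ℤ → Measure EReal} {s₀ s₁ : ℝ}

lemma SymmetricLaw.gHat (hw : 1 ≤ w) {x : ℤ → Measure EReal} (hx : ∀ i, SymmetricLaw (x i))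
    (i : ℤ) : SymmetricLaw (gHat l r w x i) :=
  (SymmetricLaw.checkMessage hw hx i).varPow l

lemma SymmetricLaw.g (hw : 1 ≤ w) {x : ℤ → Measure EReal} (hx : ∀ i, SymmetricLaw (x i))
    (i : ℤ) : SymmetricLaw (g l r w x i) :=
  (SymmetricLaw.checkMessage hw hx i).varPow (l - 1)

/-- Finitely many nodes suffice for infinitely many positions because the family is constantly
Δ_{+∞} outside [-L, L]. -/
lemma exists_system_nodes (hc : ∀ σ ∈ Icc s₀ s₁, SymmetricLaw (c σ))
    (hx : ∀ σ ∈ Icc s₀ s₁, ∀ i, SymmetricLaw (x σ i))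
    (hc_linear : PiecewiseLinearFamily c s₀ s₁)
    (hx_linear : ∀ i : ℤ, PiecewiseLinearFamily (fun σ => x σ i) s₀ s₁)
    (hout : ∀ σ ∈ Icc s₀ s₁, ∀ i, i ∉ Icc (-(L : ℤ)) L → x σ i = deltaTop) :
    ∃ E : Finset ℝ, ∀ p q, p < q → Icc p q ⊆ Icc s₀ s₁ → (∀ e ∈ E, e ∉ Ioo p q) →
      SmoothFamily (Icc p q) c ∧ ∀ i, SmoothFamily (Icc p q) fun σ => x σ i := by
  classical
  obtain ⟨E, hE⟩ := hc_linear.exists_smooth_pieces hc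
  choose E' hE' using fun i => (hx_linear i).exists_smooth_pieces fun s hs => hx s hs i
  refine ⟨E ∪ (Finset.Icc (-(L : ℤ)) L).biUnion E', fun p q hpq hsub hfree =>
    ⟨hE p q hpq hsub fun e he => hfree e (Finset.mem_union_left _ he), fun i => ?_⟩⟩
  by_cases hi : i ∈ Icc (-(L : ℤ)) L
  · exact hE' i p q hpq hsub fun e he => hfree e (Finset.mem_union_right _
      (Finset.mem_biUnion.2 ⟨i, Finset.mem_Icc.2 hi, he⟩))
  · exact ⟨(symmetricLaw_deltaTop.smoothFamily_const (S := Icc p q)).mixture.congr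
      fun s hs => hout s (hsub hs) i hi, fun s hs => hx s (hsub hs) i⟩

/-- The increment of the Bethe functional is the total GEXIT integral up to the accumulated
defect of the approximate fixed points. -/
lemma bethe_increment (hl : 1 ≤ l) (hr : 1 ≤ r) (hw : 1 ≤ w) (hs : s₀ ≤ s₁)
    (hc : ∀ σ ∈ Icc s₀ s₁, SymmetricLaw (c σ))
    (hx : ∀ σ ∈ Icc s₀ s₁, ∀ i, SymmetricLaw (x σ i))
    (hx_ordered : ∀ i : ℤ, OrderedFamily (fun σ => x σ i) s₀ s₁)
    (hc_linear : PiecewiseLinearFamily c s₀ s₁)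
    (hx_linear : ∀ i : ℤ, PiecewiseLinearFamily (fun σ => x σ i) s₀ s₁)
    (hout : ∀ σ ∈ Icc s₀ s₁, ∀ i, i ∉ Icc (-(L : ℤ)) L → x σ i = deltaTop)
    {ε : ℤ → ℕ → ℝ} (hε : ∀ i n, ε i n ≤ 1)
    (hgap : ∀ σ ∈ Icc s₀ s₁, ∀ i ∈ Icc (-(L : ℤ)) L, ∀ n,
      |softMoment (varConv (c σ) (g l r w (x σ) i)) n - softMoment (x σ i) n| ≤ ε i n) :
    (∀ i ∈ Finset.Icc (-(L : ℤ)) L,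
      IntervalIntegrable (gexit c fun σ => gHat l r w (x σ) i) volume s₀ s₁) ∧
    |bethe l r L w (c s₁) (x s₁) - bethe l r L w (c s₀) (x s₀) -
        totalGexitIntegral l r L w c x s₀ s₁| ≤
      l * ∑ i ∈ Finset.Icc (-(L : ℤ)) L, (weightedMoment (ε i) (checkMessage r w (x s₀) i) -
        weightedMoment (ε i) (checkMessage r w (x s₁) i)) := by
  obtain ⟨E, hE⟩ := exists_system_nodes hc hx hc_linear hx_linear hout
  refine interval_induction (P := fun p q => (∀ i ∈ Finset.Icc (-(L : ℤ)) L,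
      IntervalIntegrable (gexit c fun σ => gHat l r w (x σ) i) volume p q) ∧
    |bethe l r L w (c q) (x q) - bethe l r L w (c p) (x p) -
        totalGexitIntegral l r L w c x p q| ≤
      l * ∑ i ∈ Finset.Icc (-(L : ℤ)) L, (weightedMoment (ε i) (checkMessage r w (x p) i) -
        weightedMoment (ε i) (checkMessage r w (x q) i))) E hs (fun p => ?_) ?_ ?_
  · simp [totalGexitIntegral, gexitIntegral]
  · intro p q hpq hsub hfree
    obtain ⟨sc, sx⟩ := hE p q hpq hsub hfree
    have sy := fun i => SmoothFamily.checkMessage (r := r) hw sx i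
    have hε' : ∀ i ∈ Finset.Icc (-(L : ℤ)) L, ∀ n, |ε i n| ≤ 1 := fun i hi n => by
      have hp : p ∈ Icc s₀ s₁ := hsub (left_mem_Icc.2 hpq.le)
      rw [abs_of_nonneg ((abs_nonneg _).trans (hgap p hp i (Finset.mem_Icc.1 hi) n))]
      exact hε i n
    have pg : ∀ i, PolynomialOn (Ioo p q) (gexit c fun σ => gHat l r w (x σ) i) := fun i => by
      have := (sc.bipolynomialOn_varConv ((sy i).varPow l)).deriv_left
      rwa [interior_Icc] at this
    have ig : ∀ i ∈ Finset.Icc (-(L : ℤ)) L,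
        IntervalIntegrable (gexit c fun σ => gHat l r w (x σ) i) volume p q :=
      fun i _ => intervalIntegrable_of_polynomialOn_Ioo hpq.le (pg i)
    refine ⟨ig, ?_⟩
    have pW : ∀ i ∈ Finset.Icc (-(L : ℤ)) L, PolynomialOn (Icc p q)
        fun s => weightedMoment (ε i) (checkMessage r w (x s) i) :=
      fun i hi => (sy i).mixture.weightedMoment (hε' i hi)
    have main := abs_increment_sub_integral_le hpq
      (SmoothFamily.polynomialOn_bethe (l := l) (r := r) (L := L) hw sc sx)
      ((PolynomialOn.sum pW).const_mul (l : ℝ))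
      (PolynomialOn.sum (A := Finset.Icc (-(L : ℤ)) L) fun i _ => pg i) fun s hs => by
        have hn : Icc p q ∈ nhds s := Icc_mem_nhds hs.1 hs.2
        have hs' := hsub (Ioo_subset_Icc_self hs)
        have dW := fun i hi => (pW i hi).differentiableAt hn
        rw [(hasDerivAt_bethe hl hr hw sc sx (fun s hs => hout s (hsub hs)) hn).deriv,
          add_sub_cancel_left, deriv_const_mul _ (DifferentiableAt.fun_sum dW),
          deriv_fun_sum dW, abs_mul, Nat.abs_cast, ← mul_neg]
        refine mul_le_mul_of_nonneg_left ?_ (Nat.cast_nonneg l)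
        rw [← Finset.sum_neg_distrib]
        refine (Finset.abs_sum_le_sum_abs _ _).trans (Finset.sum_le_sum fun i hi => ?_)
        -- The messages inherit antitone moments from the ordered x_j, since the moment of a message
        -- is a monotone function of the moments of the inputs.
        refine abs_deriv_entropy_sub_le ((hc s hs').varConv (SymmetricLaw.g hw (hx s hs') i))
          (hx s hs' i) (sy i) (fun n u hu v hv huv => ?_) (hgap s hs' i (Finset.mem_Icc.1 hi))
          (hε i) hn
        exact softMoment_checkMessage_mono hw (hx u (hsub hu)) (hx v (hsub hv)) n
          (fun j => (hx_ordered j u (hsub hu) v (hsub hv) huv).softMoment_le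
            (hx u (hsub hu) j) (hx v (hsub hv) j) n) i
    rw [intervalIntegral.integral_finsetSum ig, ← mul_sub, ← Finset.sum_sub_distrib] at main
    exact main
  · rintro p e q - - ⟨i1, h1⟩ ⟨i2, h2⟩
    refine ⟨fun i hi => (i1 i hi).trans (i2 i hi), ?_⟩
    have add : totalGexitIntegral l r L w c x p q =
        totalGexitIntegral l r L w c x p e + totalGexitIntegral l r L w c x e q := by
      rw [totalGexitIntegral, totalGexitIntegral, totalGexitIntegral, ← Finset.sum_add_distrib]
      exact Finset.sum_congr rfl fun i hi =>
        (intervalIntegral.integral_add_adjacent_intervals (i1 i hi) (i2 i hi)).symm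
    rw [Finset.sum_sub_distrib] at h1 h2 ⊢
    rw [add]
    rw [abs_le] at h1 h2 ⊢
    constructor <;> linarith [h1.1, h1.2, h2.1, h2.2]

lemma gexitIntegralExists (hw : 1 ≤ w) (hc : ∀ σ ∈ Icc s₀ s₁, SymmetricLaw (c σ))
    (hx : ∀ σ ∈ Icc s₀ s₁, ∀ i, SymmetricLaw (x σ i))
    (hc_linear : PiecewiseLinearFamily c s₀ s₁) (i : ℤ)
    (hint : IntervalIntegrable (gexit c fun σ => gHat l r w (x σ) i) volume s₀ s₁) :
    GexitIntegralExists c (fun σ => gHat l r w (x σ) i) s₀ s₁ := by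
  refine ⟨fun s hs σ hσ =>
    ((hc s hs).varConv (SymmetricLaw.gHat hw (hx σ hσ) i)).integrable_entropyKernel, ?_, hint⟩
  -- The second factor is frozen at σ, so only the nodes of the channel family can obstruct
  -- differentiability.
  obtain ⟨E, hE⟩ := hc_linear.exists_smooth_pieces hc
  refine ⟨E, E.finite_toSet, fun σ hσ => ?_⟩
  have hopen : Ioo s₀ s₁ \ (E : Set ℝ) ∈ nhds σ :=
    (isOpen_Ioo.sdiff E.finite_toSet.isClosed).mem_nhds hσ
  obtain ⟨ρ, hρ, hball⟩ := Metric.nhds_basis_closedBall.mem_iff.1 hopen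
  rw [Real.closedBall_eq_Icc] at hball
  have sc := hE (σ - ρ) (σ + ρ) (by linarith)
    (hball.trans (sdiff_subset.trans Ioo_subset_Icc_self))
    fun e he hmem => (hball (Ioo_subset_Icc_self hmem)).2 he
  have hσ' : σ ∈ Icc (σ - ρ) (σ + ρ) := ⟨by linarith, by linarith⟩
  have hz := SymmetricLaw.gHat (l := l) (r := r) hw (hx σ (Ioo_subset_Icc_self hσ.1)) i
  exact ((sc.bipolynomialOn_varConv hz.smoothFamily_const).left hσ').differentiableAt
    (Icc_mem_nhds (by linarith) (by linarith))

end Family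

/-! ### The Bethe functional of a flat constellation -/

lemma abs_entropy_varConv_sub_le {A B y : Measure EReal} (hA : SymmetricLaw A)
    (hB : SymmetricLaw B) (hy : SymmetricLaw y) {ε : ℕ → ℝ}
    (hAB : ∀ n, |softMoment A n - softMoment B n| ≤ ε n) (hε : ∀ n, ε n ≤ 1) :
    |entropy (varConv A y) - entropy (varConv B y)| ≤ ∑' n, entropyCoeff n * ε n := by
  have := hy.prob
  have hε0 : ∀ n, 0 ≤ ε n := fun n => (abs_nonneg _).trans (hAB n)
  have h1 := (hA.hasSum_entropy_varConv hy).sub (hB.hasSum_entropy_varConv hy)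
  have h2 := (summable_entropyCoeff_mul (ε := ε) fun n => by
    rw [abs_of_nonneg (hε0 n)]; exact hε n).hasSum
  have main : ∀ n, |(softMoment A n - softMoment B n) * (1 - softMoment y n)| ≤ ε n := fun n => by
    have h0 := softMoment_nonneg y n
    have h1 := softMoment_le_one y n
    rw [abs_mul, abs_of_nonneg (sub_nonneg.2 h1)]
    exact (mul_le_of_le_one_right (abs_nonneg _) (by linarith)).trans (hAB n)
  rw [abs_le]
  constructor
  · refine hasSum_le (fun n => ?_) h2.neg h1
    have := mul_le_mul_of_nonneg_left (abs_le.1 (main n)).2 (entropyCoeff_nonneg n)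
    linarith
  · refine hasSum_le (fun n => ?_) h1 h2
    have := mul_le_mul_of_nonneg_left (abs_le.1 (main n)).1 (entropyCoeff_nonneg n)
    linarith

lemma average_const {w : ℕ} (hw : 1 ≤ w) (a : Measure EReal) : average w (fun _ => a) = a := by
  rw [average, Finset.sum_const, Finset.card_range, ← Nat.cast_smul_eq_nsmul ℝ≥0∞, smul_smul,
    ENNReal.inv_mul_cancel (by simp; omega) (by simp), one_smul]

lemma average_congr {w : ℕ} {a b : ℕ → Measure EReal} (h : ∀ k < w, a k = b k) :
    average w a = average w b := by
  rw [average, average, Finset.sum_congr rfl fun k hk => h k (Finset.mem_range.1 hk)]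

/-- The right-hand side is the Bethe functional per position of an uncoupled system at a fixed
point, where H(c ⊛ y^{⊛ l}) = H(X ⊛ y) with y = X^{⊠(r-1)}. Duality expands it into A(X). -/
lemma areaFunctional_eq {l r : ℕ} (hr : 1 ≤ r) {X : Measure EReal} (hX : SymmetricLaw X) :
    areaFunctional l r X =
      (1 - l) * entropy (varConv X (checkPow X (r - 1))) + l * checkTerm r X := by
  obtain ⟨r, rfl⟩ : ∃ k, r = k + 1 := ⟨r - 1, by omega⟩
  have := hX.prob
  have := (hX.checkPow r).prob
  rw [areaFunctional, checkTerm, Nat.add_sub_cancel, hX.entropy_varConv (hX.checkPow r),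
    checkConv_comm X, checkPow]
  ring

lemma abs_checkTerm_le {r : ℕ} (hr : 1 ≤ r) {a : Measure EReal} (ha : SymmetricLaw a) :
    |checkTerm r a| ≤ 1 := by
  have hr' : (1 : ℝ) ≤ r := by exact_mod_cast hr
  have h1 := ha.entropy_mem_Icc
  have h2 := (ha.checkPow r).entropy_mem_Icc
  have h3 : entropy (checkPow a r) / r ≤ 1 := (div_le_one (by linarith)).2 (h2.2.trans hr')
  have h4 : 0 ≤ entropy (checkPow a r) / r := div_nonneg h2.1 (by linarith)
  rw [checkTerm, abs_le]
  constructor <;> linarith [h1.1, h1.2]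

lemma abs_checkTerm_sub_le {r : ℕ} (hr : 1 ≤ r) {a b : Measure EReal} (ha : SymmetricLaw a)
    (hb : SymmetricLaw b) : |checkTerm r a - checkTerm r b| ≤ 2 := by
  linarith [abs_sub (checkTerm r a) (checkTerm r b), abs_checkTerm_le hr ha,
    abs_checkTerm_le hr hb]

/-- The positions where the fixed-point equation is required. -/
def interiorPositions (L w : ℕ) : Set ℤ :=
  Icc (-(L : ℤ) + w - 1) (-(w : ℤ) + 1) ∪ Icc ((w : ℤ) - 1) ((L : ℤ) - w + 1)

-- The excluded positions form three blocks: at most w - 1 at each end and at most 2w - 3 (none if w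
-- = 1) around the origin.
open Classical in
lemma sum_indicator_not_interior_le (L : ℕ) {w : ℕ} (hw : 1 ≤ w) :
    ∑ i ∈ Finset.Icc (-(L : ℤ)) L, (if i ∈ interiorPositions L w then (0 : ℝ) else 1) ≤ 4 * w := by
  have hsub : (Finset.Icc (-(L : ℤ)) L).filter (fun i => ¬ i ∈ interiorPositions L w) ⊆
      Finset.Icc (-(L : ℤ)) (-L + w - 2) ∪ Finset.Icc (-(w : ℤ) + 2) (w - 2) ∪
        Finset.Icc ((L : ℤ) - w + 2) L := by
    intro i hi
    simp only [interiorPositions, mem_union, mem_Icc, Finset.mem_filter, Finset.mem_Icc,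
      Finset.mem_union] at hi ⊢
    omega
  have hcard : ((Finset.Icc (-(L : ℤ)) L).filter (fun i => ¬ i ∈ interiorPositions L w)).card ≤
      4 * w := by
    refine (Finset.card_le_card hsub).trans ((Finset.card_union_le _ _).trans
      ((Nat.add_le_add_right (Finset.card_union_le _ _) _).trans ?_))
    simp only [Int.card_Icc]
    omega
  have e : ∀ i, (if i ∈ interiorPositions L w then (0 : ℝ) else 1) =
      if ¬ i ∈ interiorPositions L w then 1 else 0 := fun i => by split_ifs <;> simp_all
  simp_rw [e]
  rw [← Finset.sum_filter, Finset.sum_const, nsmul_eq_mul, mul_one]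
  exact_mod_cast hcard

lemma card_positions (L : ℕ) : ((Finset.Icc (-(L : ℤ)) L).card : ℝ) = 2 * L + 1 := by
  rw [Int.card_Icc]
  have : ((L : ℤ) + 1 - -(L : ℤ)).toNat = 2 * L + 1 := by omega
  rw [this]; push_cast; ring

/-- A check whose whole window lies in [-L, L] sees exactly `X`. Fewer than w checks at the left end
err by at most 2 each, and the w - 1 checks beyond L contribute at most 1 each. -/
lemma abs_sum_checkTerm_sub_le {r L w : ℕ} (hr : 1 ≤ r) (hw : 1 ≤ w) {x : ℤ → Measure EReal}
    {X : Measure EReal} (hx : ∀ i, SymmetricLaw (x i)) (hX : SymmetricLaw X)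
    (hflat : ∀ i ∈ Icc (-(L : ℤ)) L, x i = X) :
    |∑ m ∈ Finset.Icc (-(L : ℤ)) (L + w - 1), checkTerm r (checkInput w x m) -
      (2 * L + 1) * checkTerm r X| ≤ 3 * w := by
  have hsplit : Finset.Icc (-(L : ℤ)) (L + w - 1) =
      Finset.Icc (-(L : ℤ)) L ∪ Finset.Icc ((L : ℤ) + 1) (L + w - 1) := by
    ext m; simp only [Finset.mem_union, Finset.mem_Icc]; omega
  have hdisj : Disjoint (Finset.Icc (-(L : ℤ)) L) (Finset.Icc ((L : ℤ) + 1) (L + w - 1)) := by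
    rw [Finset.disjoint_left]; intro m; simp only [Finset.mem_Icc]; omega
  have hX' := fun m => symmetricLaw_checkInput (w := w) hw hx m
  have full : ∀ m ∈ Finset.Icc (-(L : ℤ)) L, ¬ m ≤ -(L : ℤ) + w - 2 → checkInput w x m = X := by
    intro m hm hm'
    rw [Finset.mem_Icc] at hm
    refine (average_congr fun k hk => hflat _ ?_).trans (average_const hw X)
    rw [mem_Icc]; omega
  rw [hsplit, Finset.sum_union hdisj]
  have e : (2 * (L : ℝ) + 1) * checkTerm r X = ∑ m ∈ Finset.Icc (-(L : ℤ)) L, checkTerm r X := by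
    rw [Finset.sum_const, nsmul_eq_mul, card_positions]
  rw [e, add_sub_right_comm, ← Finset.sum_sub_distrib]
  have b1 : |∑ m ∈ Finset.Icc (-(L : ℤ)) L, (checkTerm r (checkInput w x m) - checkTerm r X)| ≤
      2 * w := by
    refine (Finset.abs_sum_le_sum_abs _ _).trans ?_
    have : ∀ m ∈ Finset.Icc (-(L : ℤ)) L, |checkTerm r (checkInput w x m) - checkTerm r X| ≤
        if m ≤ -(L : ℤ) + w - 2 then 2 else 0 := by
      intro m hm
      split_ifs with h
      · exact abs_checkTerm_sub_le hr (hX' m) hX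
      · rw [full m hm h, sub_self, abs_zero]
    refine (Finset.sum_le_sum this).trans ?_
    rw [← Finset.sum_filter, Finset.sum_const, nsmul_eq_mul, mul_comm]
    have hc : ((Finset.Icc (-(L : ℤ)) L).filter (· ≤ -(L : ℤ) + w - 2)).card ≤ w := by
      refine (Finset.card_le_card (t := Finset.Icc (-(L : ℤ)) (-(L : ℤ) + w - 2)) ?_).trans ?_
      · intro m hm
        simp only [Finset.mem_filter, Finset.mem_Icc] at hm ⊢
        omega
      · rw [Int.card_Icc]; omega
    gcongr
  have b2 : |∑ m ∈ Finset.Icc ((L : ℤ) + 1) (L + w - 1), checkTerm r (checkInput w x m)| ≤ w := by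
    refine (Finset.abs_sum_le_sum_abs _ _).trans ?_
    refine (Finset.sum_le_sum fun m _ => abs_checkTerm_le hr (hX' m)).trans ?_
    rw [Finset.sum_const, nsmul_eq_mul, mul_one, Int.card_Icc]
    exact_mod_cast (by omega : ((L : ℤ) + w - 1 + 1 - (L + 1)).toNat ≤ w)
  refine (abs_add_le _ _).trans ?_
  linarith

-- At an interior position the window sees only `X`, so the message is X^{⊠(r-1)} and the
-- approximate fixed-point equation replaces c ⊛ g by X at cost K. Other positions cost at most l
-- each, at most 4w of them; the check terms add 3wl, whence 7wl.
open Classical in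
lemma abs_bethe_sub_le {l r L w : ℕ} (hl : 1 ≤ l) (hr : 1 ≤ r) (hw : 1 ≤ w)
    {c X : Measure EReal} {x : ℤ → Measure EReal} (hc : SymmetricLaw c)
    (hx : ∀ i, SymmetricLaw (x i)) (hX : SymmetricLaw X)
    (hflat : ∀ i ∈ Icc (-(L : ℤ)) L, x i = X) {ε : ℕ → ℝ} (hε0 : ∀ n, 0 ≤ ε n)
    (hε : ∀ n, ε n ≤ 1)
    (hgap : ∀ i ∈ interiorPositions L w, ∀ n,
      |softMoment (varConv c (g l r w x i)) n - softMoment (x i) n| ≤ ε n) :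
    |bethe l r L w c x - (2 * L + 1) * areaFunctional l r X| ≤
      (2 * L + 1) * ∑' n, entropyCoeff n * ε n + 7 * (w * l) := by
  have hl' : (1 : ℝ) ≤ l := by exact_mod_cast hl
  set K := ∑' n, entropyCoeff n * ε n with hK
  have hK0 : 0 ≤ K := tsum_nonneg fun n => mul_nonneg (entropyCoeff_nonneg n) (hε0 n)
  set T := entropy (varConv X (checkPow X (r - 1))) with hT
  have hT01 : T ∈ Icc (0 : ℝ) 1 := (hX.varConv (hX.checkPow (r - 1))).entropy_mem_Icc
  have hy := fun i => SymmetricLaw.checkMessage (r := r) hw hx i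
  have site : ∀ i ∈ Finset.Icc (-(L : ℤ)) L,
      |entropy (varConv c (gHat l r w x i)) - l * entropy (varConv (x i) (checkMessage r w x i)) -
        (1 - l) * T| ≤ K + l * (if i ∈ interiorPositions L w then 0 else 1) := by
    intro i hi
    split_ifs with hgood
    · have hgood' := hgood
      simp only [interiorPositions, mem_union, mem_Icc] at hgood'
      rw [Finset.mem_Icc] at hi
      have hmsg : checkMessage r w x i = checkPow X (r - 1) := by
        refine (average_congr fun j hj => ?_).trans (average_const hw _)
        congr 1
        refine (average_congr fun k hk => hflat _ ?_).trans (average_const hw X)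
        rw [mem_Icc]; omega
      -- One of the l messages is split off, exposing c ⊛ g, which is what the fixed-point
      -- hypothesis compares with x_i.
      have hpow : entropy (varConv c (gHat l r w x i)) =
          entropy (varConv (varConv c (g l r w x i)) (checkMessage r w x i)) := by
        have := hc.prob
        have := (hy i).prob
        have := ((hy i).varPow (l - 1)).prob
        rw [gHat, g]
        nth_rw 1 [show l = (l - 1) + 1 by omega]
        rw [varPow]
        exact congrArg entropy (Measure.conv_assoc _ _ _).symm
      have hb := abs_entropy_varConv_sub_le (hc.varConv (SymmetricLaw.g hw hx i)) (hx i) (hy i)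
        (hgap i hgood) hε
      have hTi : entropy (varConv (x i) (checkMessage r w x i)) = T := by
        rw [hmsg, hflat i (mem_Icc.2 hi)]
      rw [← hpow, hTi] at hb
      rw [hTi, mul_zero, add_zero]
      convert hb using 2
      ring
    · have h1 := (hc.varConv (SymmetricLaw.gHat (l := l) (r := r) hw hx i)).entropy_mem_Icc
      have h2 := ((hx i).varConv (hy i)).entropy_mem_Icc
      have h3 : l * entropy (varConv (x i) (checkMessage r w x i)) ≤ l :=
        mul_le_of_le_one_right (by positivity) h2.2
      have h4 : 0 ≤ l * entropy (varConv (x i) (checkMessage r w x i)) :=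
        mul_nonneg (by positivity) h2.1
      have h5 : ((l : ℝ) - 1) * T ≤ l - 1 := mul_le_of_le_one_right (by linarith) hT01.2
      have h6 : 0 ≤ ((l : ℝ) - 1) * T := mul_nonneg (by linarith) hT01.1
      rw [abs_le]
      constructor <;> linarith [h1.1, h1.2]
  have hsites : |∑ i ∈ Finset.Icc (-(L : ℤ)) L, (entropy (varConv c (gHat l r w x i)) -
      l * entropy (varConv (x i) (checkMessage r w x i)) - (1 - l) * T)| ≤
      (2 * L + 1) * K + l * (4 * w) := by
    refine (Finset.abs_sum_le_sum_abs _ _).trans ((Finset.sum_le_sum site).trans ?_)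
    rw [Finset.sum_add_distrib, Finset.sum_const, nsmul_eq_mul, card_positions, ← Finset.mul_sum]
    have := sum_indicator_not_interior_le L hw
    gcongr
  have hchecks := abs_sum_checkTerm_sub_le hr hw hx hX hflat
  have hchecks' := mul_le_mul_of_nonneg_left hchecks (Nat.cast_nonneg (α := ℝ) l)
  rw [← Nat.abs_cast (R := ℝ) l, ← abs_mul, Nat.abs_cast] at hchecks'
  have e : bethe l r L w c x - (2 * L + 1) * areaFunctional l r X =
      ∑ i ∈ Finset.Icc (-(L : ℤ)) L, (entropy (varConv c (gHat l r w x i)) -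
        l * entropy (varConv (x i) (checkMessage r w x i)) - (1 - l) * T) +
      l * (∑ m ∈ Finset.Icc (-(L : ℤ)) (L + w - 1), checkTerm r (checkInput w x m) -
        (2 * L + 1) * checkTerm r X) := by
    rw [areaFunctional_eq hr hX, bethe, ← hT, Finset.sum_sub_distrib (f := fun i =>
      entropy (varConv c (gHat l r w x i)) - l * entropy (varConv (x i) (checkMessage r w x i))),
      Finset.sum_const, nsmul_eq_mul, card_positions]
    ring
  rw [e]
  refine (abs_add_le _ _).trans ((add_le_add hsites hchecks').trans_eq ?_)
  ring

/-- Bounds the telescoped defect of a position: moments lie in [0, 1], so the total decrease of the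
weighted moment cannot exceed the sum of its weights. -/
lemma weightedMoment_sub_le {ε : ℕ → ℝ} (hε0 : ∀ n, 0 ≤ ε n) (hε : ∀ n, ε n ≤ 1)
    {a : Measure EReal} (ha : SymmetricLaw a) (b : Measure EReal) :
    weightedMoment ε a - weightedMoment ε b ≤ ∑' n, entropyCoeff n * ε n := by
  have := ha.prob
  have h0 : 0 ≤ weightedMoment ε b := tsum_nonneg fun n =>
    mul_nonneg (entropyCoeff_nonneg n) (mul_nonneg (hε0 n) (softMoment_nonneg b n))
  have h1 : weightedMoment ε a ≤ ∑' n, entropyCoeff n * ε n := by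
    refine Summable.tsum_le_tsum (fun n => mul_le_mul_of_nonneg_left
      (mul_le_of_le_one_right (hε0 n) (softMoment_le_one a n)) (entropyCoeff_nonneg n))
      (summable_entropyCoeff_mul fun n => ?_) (summable_entropyCoeff_mul fun n => ?_)
    · rw [abs_of_nonneg (mul_nonneg (hε0 n) (softMoment_nonneg a n))]
      exact mul_le_one₀ (hε n) (softMoment_nonneg a n) (softMoment_le_one a n)
    · rw [abs_of_nonneg (hε0 n)]; exact hε n
  linarith

/-- The area theorem with the error expressed through the moment gap. -/
lemma area_estimate {l r L w : ℕ} (hl : 1 ≤ l) (hr : 1 ≤ r) (hw : 1 ≤ w) {δ : ℝ} (hδ : 0 ≤ δ)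
    {s₀ s₁ : ℝ} (hs : s₀ ≤ s₁) {c : ℝ → Measure EReal} {x : ℝ → ℤ → Measure EReal}
    (hc : ∀ σ ∈ Icc s₀ s₁, SymmetricLaw (c σ))
    (hx : ∀ σ ∈ Icc s₀ s₁, ∀ i, SymmetricLaw (x σ i))
    (hx_ordered : ∀ i : ℤ, OrderedFamily (fun σ => x σ i) s₀ s₁)
    (hc_linear : PiecewiseLinearFamily c s₀ s₁)
    (hx_linear : ∀ i : ℤ, PiecewiseLinearFamily (fun σ => x σ i) s₀ s₁)
    (hout : ∀ σ ∈ Icc s₀ s₁, ∀ i, i ∉ Icc (-(L : ℤ)) L → x σ i = deltaTop)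
    {xLower xUpper : Measure EReal}
    (hx_lower : ∀ i ∈ Icc (-(L : ℤ)) L, x s₀ i = xLower)
    (hx_upper : ∀ i ∈ Icc (-(L : ℤ)) L, x s₁ i = xUpper)
    (hx_approx : ∀ σ ∈ Icc s₀ s₁, ∀ i ∈ interiorPositions L w,
      wasserstein (x σ i) (varConv (c σ) (g l r w (x σ) i)) ≤ δ) :
    (∀ i ∈ Icc (-(L : ℤ)) L,
      GexitIntegralExists c (fun σ => gHat l r w (x σ) i) s₀ s₁) ∧
    |totalGexitIntegral l r L w c x s₀ s₁ - (2 * L + 1) * areaFunctional l r xUpper +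
        (2 * L + 1) * areaFunctional l r xLower| ≤
      18 * (w * l) + (2 * L + 1) * ((l + 2) * ∑' n, entropyCoeff n * momentGap δ n) := by
  classical
  -- Positions without a fixed-point bound get the trivial moment difference 1, costing Σ c_n = 1
  -- each. The weights do not depend on σ, as telescoping requires.
  let ε : ℤ → ℕ → ℝ := fun i n => if i ∈ interiorPositions L w then momentGap δ n else 1
  have hε : ∀ i n, ε i n ≤ 1 := fun i n => by
    simp only [ε]; split_ifs
    exacts [momentGap_le_one δ n, le_rfl]
  have hε0 : ∀ i n, 0 ≤ ε i n := fun i n => by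
    simp only [ε]; split_ifs
    exacts [momentGap_nonneg hδ n, zero_le_one]
  have hg : ∀ σ ∈ Icc s₀ s₁, ∀ i, SymmetricLaw (varConv (c σ) (g l r w (x σ) i)) :=
    fun σ hσ i => (hc σ hσ).varConv (SymmetricLaw.g hw (hx σ hσ) i)
  have hgood : ∀ σ ∈ Icc s₀ s₁, ∀ i ∈ interiorPositions L w, ∀ n,
      |softMoment (varConv (c σ) (g l r w (x σ) i)) n - softMoment (x σ i) n| ≤ momentGap δ n :=
    fun σ hσ i hi n => by
      have := (hg σ hσ i).prob
      have := (hx σ hσ i).prob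
      rw [abs_sub_comm]
      exact abs_softMoment_sub_le_momentGap (hx_approx σ hσ i hi) n
  have hgap : ∀ σ ∈ Icc s₀ s₁, ∀ i ∈ Icc (-(L : ℤ)) L, ∀ n,
      |softMoment (varConv (c σ) (g l r w (x σ) i)) n - softMoment (x σ i) n| ≤ ε i n :=
    fun σ hσ i _ n => by
      simp only [ε]; split_ifs with hi
      · exact hgood σ hσ i hi n
      · have := (hg σ hσ i).prob
        have := (hx σ hσ i).prob
        exact abs_softMoment_sub_le_one _ _ n
  have m₀ : s₀ ∈ Icc s₀ s₁ := left_mem_Icc.2 hs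
  have m₁ : s₁ ∈ Icc s₀ s₁ := right_mem_Icc.2 hs
  have zero_mem : (0 : ℤ) ∈ Icc (-(L : ℤ)) L := by rw [mem_Icc]; omega
  obtain ⟨hint, hinc⟩ := bethe_increment hl hr hw hs hc hx hx_ordered hc_linear hx_linear hout
    hε hgap
  refine ⟨fun i hi => gexitIntegralExists hw hc hx hc_linear i (hint i (Finset.mem_Icc.2 hi)), ?_⟩
  have hlow := abs_bethe_sub_le hl hr hw (hc s₀ m₀) (hx s₀ m₀)
    (hx_lower 0 zero_mem ▸ hx s₀ m₀ 0) hx_lower (momentGap_nonneg hδ) (momentGap_le_one δ)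
    (hgood s₀ m₀)
  have hupp := abs_bethe_sub_le hl hr hw (hc s₁ m₁) (hx s₁ m₁)
    (hx_upper 0 zero_mem ▸ hx s₁ m₁ 0) hx_upper (momentGap_nonneg hδ) (momentGap_le_one δ)
    (hgood s₁ m₁)
  set K := ∑' n, entropyCoeff n * momentGap δ n with hK
  have hK0 : 0 ≤ K := tsum_nonneg fun n =>
    mul_nonneg (entropyCoeff_nonneg n) (momentGap_nonneg hδ n)
  have hsum : ∑ i ∈ Finset.Icc (-(L : ℤ)) L, (weightedMoment (ε i) (checkMessage r w (x s₀) i) -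
        weightedMoment (ε i) (checkMessage r w (x s₁) i)) ≤ (2 * L + 1) * K + 4 * w := by
    have term : ∀ i ∈ Finset.Icc (-(L : ℤ)) L,
        weightedMoment (ε i) (checkMessage r w (x s₀) i) -
          weightedMoment (ε i) (checkMessage r w (x s₁) i) ≤
        K + if i ∈ interiorPositions L w then 0 else 1 := fun i _ => by
      refine (weightedMoment_sub_le (hε0 i) (hε i) (SymmetricLaw.checkMessage hw (hx s₀ m₀) i)
        _).trans ?_
      simp only [ε]
      split_ifs
      · rw [add_zero]
      · simp only [mul_one]
        rw [hasSum_entropyCoeff.tsum_eq]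
        linarith
    refine (Finset.sum_le_sum term).trans ?_
    rw [Finset.sum_add_distrib, Finset.sum_const, nsmul_eq_mul, card_positions]
    have := sum_indicator_not_interior_le L hw
    gcongr
  have hsum' := mul_le_mul_of_nonneg_left hsum (Nat.cast_nonneg (α := ℝ) l)
  have hinc' := abs_le.1 (hinc.trans hsum')
  have hlow' := abs_le.1 hlow
  have hupp' := abs_le.1 hupp
  rw [abs_le]
  -- The boundary error is 7wl from each end of the parameter interval plus 4wl from the accumulated
  -- defect, making 18wl; the multiples of (2L+1)K are 1 + 1 + l.
  constructor <;> nlinarith [hinc'.1, hinc'.2, hlow'.1, hlow'.2, hupp'.1, hupp'.2]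

end CoupledDE

/-! ### Passage to the stated constants. -/

theorem mainTheorem9
    (l r L w : ℕ) (hl : 3 ≤ l) (hlr : l ≤ r) (hw : 1 ≤ w)
    (δ : ℝ) (hδ : 0 ≤ δ) (s₀ s₁ : ℝ) (hs : s₀ ≤ s₁)
    (c : ℝ → MeasureTheory.Measure EReal) (x : ℝ → ℤ → MeasureTheory.Measure EReal)
    (hc : ∀ σ ∈ Set.Icc s₀ s₁, CoupledDE.IsLDistribution (c σ))
    (hx : ∀ σ ∈ Set.Icc s₀ s₁, ∀ i : ℤ, CoupledDE.IsLDistribution (x σ i))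
    -- (i) ordered by degradation, increasing, and piecewise linear
    (hc_ordered : CoupledDE.OrderedFamily c s₀ s₁)
    (hx_ordered : ∀ i : ℤ, CoupledDE.OrderedFamily (fun σ => x σ i) s₀ s₁)
    (hc_linear : CoupledDE.PiecewiseLinearFamily c s₀ s₁)
    (hx_linear : ∀ i : ℤ, CoupledDE.PiecewiseLinearFamily (fun σ => x σ i) s₀ s₁)
    -- (ii) perfect information outside `[-L, L]`
    (hx_outside : ∀ σ ∈ Set.Icc s₀ s₁, ∀ i : ℤ, i ∉ Set.Icc (-(L : ℤ)) L →
      x σ i = CoupledDE.deltaTop)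
    -- (iii), (iv) spatially flat at both endpoints
    (xLower xUpper : MeasureTheory.Measure EReal)
    (hx_lower : ∀ i ∈ Set.Icc (-(L : ℤ)) L, x s₀ i = xLower)
    (hx_upper : ∀ i ∈ Set.Icc (-(L : ℤ)) L, x s₁ i = xUpper)
    -- (v) approximate fixed point in the interior
    (hx_approx : ∀ σ ∈ Set.Icc s₀ s₁, ∀ i : ℤ,
      i ∈ Set.Icc (-(L : ℤ) + w - 1) (-(w : ℤ) + 1) ∪ Set.Icc ((w : ℤ) - 1) ((L : ℤ) - w + 1) →
      CoupledDE.wasserstein (x σ i)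
        (CoupledDE.varConv (c σ) (CoupledDE.g l r w (x σ) i)) ≤ δ) :
    (∀ i ∈ Set.Icc (-(L : ℤ)) L,
      CoupledDE.GexitIntegralExists c (fun σ => CoupledDE.gHat l r w (x σ) i) s₀ s₁) ∧
    |CoupledDE.totalGexitIntegral l r L w c x s₀ s₁ / (2 * (L : ℝ) + 1)
        - CoupledDE.areaFunctional l r xUpper + CoupledDE.areaFunctional l r xLower|
      ≤ 11 * (w : ℝ) * (1 + (l : ℝ) * r) / (2 * (L : ℝ) + 1)
        + 4 * (Real.sqrt 2 + 2 / Real.log 2 * l * ((r : ℝ) - 1)) * Real.sqrt δ := by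
  obtain ⟨hex, hest⟩ := CoupledDE.area_estimate (l := l) (r := r) (by omega) (by omega) hw hδ hs
    (fun σ hσ => (hc σ hσ).symmetricLaw) (fun σ hσ i => (hx σ hσ i).symmetricLaw) hx_ordered
    hc_linear hx_linear hx_outside hx_lower hx_upper hx_approx
  refine ⟨hex, ?_⟩
  have hN : (0 : ℝ) < 2 * L + 1 := by positivity
  have hl3 : (3 : ℝ) ≤ l := by exact_mod_cast hl
  have hr3 : (3 : ℝ) ≤ r := by exact_mod_cast hl.trans hlr
  have hw1 : (1 : ℝ) ≤ w := by exact_mod_cast hw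
  have hlog := CoupledDE.log_two_pos
  have hK := CoupledDE.tsum_entropyCoeff_mul_momentGap_le hδ
  set K := ∑' n, CoupledDE.entropyCoeff n * CoupledDE.momentGap δ n
  set T := CoupledDE.totalGexitIntegral l r L w c x s₀ s₁
  set A₁ := CoupledDE.areaFunctional l r xUpper
  set A₀ := CoupledDE.areaFunctional l r xLower
  have e : T / (2 * (L : ℝ) + 1) - A₁ + A₀ =
      (T - (2 * L + 1) * A₁ + (2 * L + 1) * A₀) / (2 * L + 1) := by field_simp
  rw [e, abs_div, abs_of_pos hN]
  -- Since r ≥ 3, the right-hand side is at least 33wl.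
  have h1 : 18 * ((w : ℝ) * l) ≤ 11 * w * (1 + l * r) := by
    nlinarith [mul_nonneg (by linarith : (0 : ℝ) ≤ w) (by linarith : (0 : ℝ) ≤ l),
      mul_nonneg (mul_nonneg (by linarith : (0 : ℝ) ≤ w) (by linarith : (0 : ℝ) ≤ l))
        (by linarith : (0 : ℝ) ≤ r - 3)]
  -- The bound K ≤ (4 / ln 2) √δ and l + 2 ≤ 4l ≤ 2l(r - 1) already fit into the second summand; the
  -- √2 term is slack.
  have h2 : ((l : ℝ) + 2) * K ≤ 4 * (Real.sqrt 2 + 2 / Real.log 2 * l * ((r : ℝ) - 1)) * √δ := by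
    have a1 : ((l : ℝ) + 2) * K ≤ (l + 2) * (4 / Real.log 2 * √δ) := by gcongr
    have a2 : (l : ℝ) + 2 ≤ 2 * l * (r - 1) := by nlinarith
    have a3 : ((l : ℝ) + 2) * (4 / Real.log 2 * √δ) ≤
        2 * l * (r - 1) * (4 / Real.log 2 * √δ) := by gcongr
    have a4 : 0 ≤ 4 * Real.sqrt 2 * √δ := by positivity
    calc _ ≤ _ := a1.trans a3
      _ ≤ 4 * Real.sqrt 2 * √δ + 2 * l * (r - 1) * (4 / Real.log 2 * √δ) := by linarith
      _ = _ := by ring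
  calc _ ≤ (18 * ((w : ℝ) * l) + (2 * L + 1) * ((l + 2) * K)) / (2 * L + 1) := by gcongr
    _ = 18 * ((w : ℝ) * l) / (2 * L + 1) + (l + 2) * K := by field_simp
    _ ≤ _ := by gcongr
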